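/- Let $(K,v)$ be a field that is complete with respect to a (normalized, surjective) discrete valuation $v:K^\times\to\mathbb Z$, let $L/K$ be a finite Galois extension with group $G=\mathrm{Gal}(L/K)$, let $v_L:L^\times\to\mathbb Z$ be the normalized discrete valuation of $L$ extending $v$ (so that $v_L|_K=e\,v$ for an integer $e\ge 1$), and let $A\subseteq K$, $B\subseteq L$ be the valuation rings. Assume that the extension of residue fields is separable, and let $f$ be its degree. Then there is an $x\in B$ with $B=A[x]$, and for $g\in G\setminus\{1\}$ the integer $i_G(g):=v_L(g x-x)$ does not depend on the choice of such an $x$. Define the Artin function $a_G:G\to\mathbb Z$ by \[ a_G(g)=\begin{cases}-f\,i_G(g) & \text{if } g\neq 1,\\ f\sum_{g'\neq 1} i_G(g') & \text{if } g=1.\end{cases} \] Let $G_0\trianglelefteq G$ be the inertia group (the kernel of the action of $G$ on the residue field of $L$), let $r_G$ be the character of the regular representation $\mathbb C[G]$, let $r_{G/G_0}$ be the character of the regular representation of $G/G_0$ composed with $G\to G/G_0$, and define the Swan function $\mathrm{sw}_G:=a_G-(r_G-r_{G/G_0})$. For functions $\varphi,\psi:G\to\mathbb C$ write $(\varphi|\psi)=\frac1{|G|}\sum_{g\in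 G}\varphi(g)\overline{\psi(g)}$. Then: 1. $a_G$ is the character of a finite-dimensional complex representation of $G$; 2. for every character $\chi$ of a finite-dimensional complex representation of $G$, $(a_G|\chi)\in\mathbb Z_{\ge 0}$; 3. $\mathrm{sw}_G$ is the character of a finite-dimensional complex representation of $G$. -/

import Mathlib

open scoped WithZero

noncomputable section

namespace ArtinSwan

/-! ### Complex characters of a finite group -/

/-- `χ : G → ℂ` is the character `g ↦ Tr (ρ g)` of a finite-dimensional complex representation
`ρ` of `G`. -/
def IsComplexCharacter {G : Type*} [Group G] (χ : G → ℂ) : Prop :=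
  ∃ (V : Type) (_ : AddCommGroup V) (_ : Module ℂ V) (_ : FiniteDimensional ℂ V)
    (ρ : Representation ℂ G V), χ = ρ.character

/-- The Hermitian pairing `(φ | ψ) = |G|⁻¹ ∑_g φ(g) * conj (ψ(g))` of functions on a finite
group. -/
def charPairing {G : Type*} [Group G] [Fintype G] (φ ψ : G → ℂ) : ℂ :=
  (Fintype.card G : ℂ)⁻¹ * ∑ g : G, φ g * starRingEnd ℂ (ψ g)

/-- `r_G`, the character of the regular representation `ℂ[G]`. -/
def regularCharacter (G : Type*) [Group G] : G → ℂ :=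
  (Representation.leftRegular ℂ G).character

/-- The character of the permutation representation `ℂ[G ⧸ H]` of `G`. If `H` is normal, this is
the composite of `G → G ⧸ H` with the character of the regular representation of the group
`G ⧸ H`. -/
def cosetCharacter {G : Type*} [Group G] (H : Subgroup G) : G → ℂ :=
  (Representation.ofMulAction ℂ G (G ⧸ H)).character

/-! ### The Artin and Swan functions -/

/-- The valuation ring of a field `F` with a valuation. -/
abbrev valRing (F : Type*) [Field F] [Valued F ℤᵐ⁰] : ValuationSubring F :=
  (Valued.v : Valuation F ℤᵐ⁰).valuationSubring

/-- The residue field of a field `F` with a valuation. -/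
abbrev resField (F : Type*) [Field F] [Valued F ℤᵐ⁰] : Type _ :=
  IsLocalRing.ResidueField (valRing F)

/-- The additive valuation of a nonzero element `y` of a field with a (multiplicatively written)
valuation in `ℤᵐ⁰`. Only its values at `y ≠ 0` are meaningful. -/
def addOrd {F : Type*} [Field F] [Valued F ℤᵐ⁰] (y : F) : ℤ :=
  -WithZero.log (Valued.v y : ℤᵐ⁰)

section

variable {K L : Type*} [Field K] [Field L] [Algebra K L]

/-- `i_G(g) = v_L(g x - x)` for `g ≠ 1`, where `x` generates the valuation ring of `L` as an
algebra over that of `K`. The value at `g = 1`, which is `∞` by convention, is never used. -/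
def iG [Valued L ℤᵐ⁰] (x : valRing L) (g : L ≃ₐ[K] L) : ℤ :=
  addOrd (g (x : L) - (x : L))

variable (K L) in
/-- The inertia group `G₀` as a subgroup of `G = Gal(L/K)`: the kernel of the action of the
decomposition group (which is all of `G` if `K` is complete) on the residue field of `L`. -/
def inertia [Valued L ℤᵐ⁰] : Subgroup (L ≃ₐ[K] L) :=
  ((valRing L).inertiaSubgroup K).map ((valRing L).decompositionSubgroup K).subtype

variable [Valued K ℤᵐ⁰] [Valued L ℤᵐ⁰]
  [Valuation.HasExtension (Valued.v : Valuation K ℤᵐ⁰) (Valued.v : Valuation L ℤᵐ⁰)]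

variable (K L) in
/-- The residue degree `f` of `L/K`. -/
def resDegree : ℕ := Module.finrank (resField K) (resField L)

open Classical in
/-- The Artin function `a_G`, for a generator `x` of the valuation ring of `L`. -/
def artin [FiniteDimensional K L] (x : valRing L) (g : L ≃ₐ[K] L) : ℤ :=
  if g = 1 then (resDegree K L : ℤ) * ∑ g' ∈ Finset.univ.erase (1 : L ≃ₐ[K] L), iG x g'
  else -((resDegree K L : ℤ) * iG x g)

/-- The Swan function `sw_G = a_G - (r_G - r_{G/G₀})`. -/
def swan [FiniteDimensional K L] (x : valRing L) (g : L ≃ₐ[K] L) : ℂ :=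
  (artin x g : ℂ) - (regularCharacter (L ≃ₐ[K] L) g - cosetCharacter (inertia K L) g)

end

end ArtinSwan

end

/-!
Let `G₀` be the inertia group and, for `g ≠ 1` in `G₀`, let `j(g) = i_G(g) - 1`, with `j(1) = 0`.
For the character `χ` of a representation `V` of `G` one computes

* `(sw_G | χ) = |G₀|⁻¹ ∑_{g ∈ G₀} j(g) (χ(1) - χ(g))`,
* `(a_G | χ) = (sw_G | χ) + dim V - dim V ^ G₀`.

A class function whose pairings with all characters are natural numbers is a character
(`isComplexCharacter_of_bilinPairing`), so all the assertions follow once the sum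
`T = ∑_{g ∈ G₀} j(g) (χ(1) - χ(g))`, called `defectSum` below, is known to be a natural number
divisible by `|G₀|` (`IsTotallyRamified.exists_defectSum_eq_card_mul`). That it is a natural number
follows by summing over the ramification groups `{g | t < j(g)} ∪ {1}`. The divisibility is a
statement about the totally ramified action of `G₀` on `L`, and it is checked one prime at a time,
on a Sylow subgroup `Q` of `G₀`. Brauer's induction theorem is not needed.

If `Q` is a Sylow subgroup for a prime other than the residue characteristic, then `g ↦ g π / π`
embeds it into the multiplicative group of the residue field, so `Q` is cyclic. The orbits of `Q`
acting by conjugation on `G₀` contribute multiples of `|Q|` to `T`, because the order of an element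
of `Q` that commutes with `g` divides `j(g)` (`IsTotallyRamified.tameCharacter_pow_jump`).

If `Q` is a Sylow subgroup for the residue characteristic `p`, then `j` vanishes outside `Q`, and
`G₀` may be replaced by the `p`-group `Q`. The proof for `p`-groups has three steps.

* For a cyclic group generated by `σ` and a faithful character of degree one, the divisibility
  amounts to congruences between the jumps `j(σ ^ (p ^ k))`, that is, to the Hasse–Arf theorem. They
  come from Euler's formula `∑_g g(π ^ i / F'(π)) = 0` for `i < |Q| - 1`, where `F` is the minimal
  polynomial of `π`: it shows that elements of a certain valuation modulo `|Q|` have nonzero trace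
  (`IsTotallyRamified.sum_smul_ne_zero`), whereas `σ x - x` has trace zero. Letting `x` run through
  products of conjugates of `π` yields the congruences.
* A character of degree one with kernel `N` is a faithful character of the cyclic group `Q / N`,
  which acts on the fixed field of `N`. The jump of a class modulo `N` is the mean of the jumps of
  its elements (`IsTotallyRamified.sum_jump_coset`), and this gives the divisibility for all
  characters of degree one (`IsTotallyRamified.exists_sum_jump_mul_one_sub_eq`).
* An irreducible representation of a `p`-group that does not act by scalars has a character
  vanishing outside a proper normal subgroup, and its restriction to that subgroup decomposes into
  pieces permuted by the group. By induction on the order, this reduces the divisibility to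
  characters of degree one (`exists_defectSum_eq_of_isPGroup`).

It remains to see that `G₀` acts on `L` in a totally ramified way and that the residue degree is the
index of `G₀`. The valuation of `L` is Galois invariant because the absolute value attached to it is
the spectral norm (`val_algEquiv`). A residue class invariant under a subgroup `H` of `G` is
represented by an element fixed by `H`, thanks to the separability of the residue extension
(`exists_fixed_residue_eq`). With `H = G` this identifies the residue degree
(`resDegree_mul_card_inertia`), and with `H = G₀` it shows that the valuation ring is generated by
`π` over the ring fixed by `G₀`, which gives the total ramification (`isTotallyRamified_inertia`).
Separability also provides the generator of the valuation ring over that of `K`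
(`exists_adjoin_eq_top`).
-/

open scoped WithZero

noncomputable section

namespace ArtinSwan

open WithZero

/-! ### Totally ramified finite group actions on a discretely valued field -/

section TotallyRamified

variable {L : Type*} [Field L]

/-- The action of a finite group `P` on a field `L` with a normalized discrete valuation `v` is
totally ramified: it preserves `v`, and the order of `P` divides the valuation of every nonzero
`P`-invariant element. If `P` acts faithfully, the second condition says that `L` has ramification
index `|P| = [L : L ^ P]` over the fixed field `L ^ P`. -/
structure IsTotallyRamified (v : Valuation L ℤᵐ⁰) (P : Type*) [Group P] [MulSemiringAction P L] :
    Prop where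
  surjective : Function.Surjective v
  map_smul : ∀ (g : P) (x : L), v (g • x) = v x
  dvd_of_fixed : ∀ a : L, a ≠ 0 → (∀ g : P, g • a = a) → (Nat.card P : ℤ) ∣ log (v a)

/-- The lower numbering jump of `g`: the integer `v(g π / π - 1)`, written additively, for a
uniformizer `π`. In terms of `i(g) = v(g π - π)` it is `i(g) - 1` if `g ≠ 1`, and the convention
`log 0 = 0` gives it the value `0` at `g = 1`. -/
def jump (v : Valuation L ℤᵐ⁰) (π : L) {P : Type*} [Group P] [MulSemiringAction P L] (g : P) : ℤ :=
  -log (v (g • π / π - 1))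

variable {v : Valuation L ℤᵐ⁰} {π : L}

lemma ne_zero_of_val_eq_exp {n : ℤ} (hπ : v π = exp n) : π ≠ 0 := by
  rintro rfl
  rw [map_zero] at hπ
  exact exp_ne_zero hπ.symm

lemma val_pow_uniformizer (hπ : v π = exp (-1)) (n : ℕ) : v (π ^ n) = exp (-n : ℤ) := by
  rw [map_pow, hπ, ← exp_nsmul]
  simp

lemma val_eq_exp_log {x : L} (hx : x ≠ 0) : v x = exp (log (v x)) :=
  (exp_log ((Valuation.ne_zero_iff v).2 hx)).symm

lemma prod_exp {ι : Type*} (s : Finset ι) (f : ι → ℤ) :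
    ∏ i ∈ s, (exp (f i) : ℤᵐ⁰) = exp (∑ i ∈ s, f i) := by
  classical
  induction s using Finset.induction_on with
  | empty => simp
  | insert a s ha ih => rw [Finset.prod_insert ha, Finset.sum_insert ha, ih, exp_add]

/-- A combination of `1, π, …, π ^ (N - 1)` whose coefficients have valuations divisible by `N`
has the valuation of its dominant term, since the nonzero terms have distinct valuations. -/
lemma exists_val_sum_eq (hπ : v π = exp (-1)) {N : ℕ} (hN : 0 < N) {a : ℕ → L}
    (ha : ∀ i, a i ≠ 0 → (N : ℤ) ∣ log (v (a i))) :
    ∃ i < N, v (∑ i ∈ Finset.range N, a i * π ^ i) = v (a i * π ^ i) ∧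
      ∀ j < N, v (a j * π ^ j) ≤ v (a i * π ^ i) := by
  obtain ⟨i, hi, hmax⟩ := Finset.exists_max_image (Finset.range N) (fun i => v (a i * π ^ i))
    ⟨0, by simpa using hN⟩
  simp only [Finset.mem_range] at hi hmax
  refine ⟨i, hi, ?_, hmax⟩
  rcases eq_or_ne (v (a i * π ^ i)) 0 with h0 | h0
  · rw [h0] at hmax ⊢
    exact le_antisymm (v.map_sum_le fun j hj => hmax j (Finset.mem_range.1 hj)) zero_le
  refine v.map_sum_eq_of_lt (Finset.mem_range.2 hi) ?_
  intro j hj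
  simp only [Finset.mem_sdiff, Finset.mem_range, Finset.mem_singleton] at hj
  refine lt_of_le_of_ne (hmax j hj.1) fun h => hj.2 ?_
  have hai : a i ≠ 0 := by
    rintro h'
    simp [h'] at h0
  have haj : a j ≠ 0 := by
    rintro h'
    rw [h', zero_mul, map_zero] at h
    exact h0 h.symm
  rw [map_mul, map_mul, val_pow_uniformizer hπ, val_pow_uniformizer hπ, val_eq_exp_log hai,
    val_eq_exp_log haj, ← exp_add, ← exp_add, exp_inj] at h
  have h1 := ha i hai
  have h2 := ha j haj
  have h3 : (N : ℤ) ∣ (i : ℤ) - j := by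
    have : (i : ℤ) - j = log (v (a i)) - log (v (a j)) := by linarith
    rw [this]
    exact dvd_sub h1 h2
  have h4 : (i : ℤ) - j = 0 := Int.eq_zero_of_abs_lt_dvd h3 (by
    rw [abs_lt]; constructor <;> linarith [hj.1])
  omega

namespace IsTotallyRamified

variable {P : Type*} [Group P] [MulSemiringAction P L]

lemma exists_uniformizer (h : IsTotallyRamified v P) : ∃ π : L, v π = exp (-1) :=
  h.surjective _

variable [Finite P] [FaithfulSMul P L]

/-- The powers `1, π, …, π ^ (|P| - 1)` of a uniformizer are a basis of `L` over its fixed field,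
and the valuation of an element is that of the dominant term of its expansion in this basis. -/
lemma exists_expansion (h : IsTotallyRamified v P) (hπ : v π = exp (-1)) (z : L) :
    ∃ a : ℕ → L, (∀ i, ∀ g : P, g • a i = a i) ∧
      z = ∑ i ∈ Finset.range (Nat.card P), a i * π ^ i ∧
      (∀ i < Nat.card P, v (a i * π ^ i) ≤ v z) ∧
      ∃ i < Nat.card P, v (a i * π ^ i) = v z := by
  classical
  have := Fintype.ofFinite P
  have hN : 0 < Nat.card P := Nat.card_pos
  set M := FixedPoints.subfield P L
  have hfin : Module.finrank M L = Nat.card P := by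
    rw [FixedPoints.finrank_eq_card, Nat.card_eq_fintype_card]
  -- extends a family of elements of the fixed field by zero
  let ext (c : Fin (Nat.card P) → M) (i : ℕ) : L :=
    if hi : i < Nat.card P then (c ⟨i, hi⟩ : L) else 0
  have hext : ∀ c, ∀ i, ∀ g : P, g • ext c i = ext c i := by
    intro c i g
    simp only [ext]
    split_ifs with hi
    · exact (c ⟨i, hi⟩).2 g
    · simp
  have hsum : ∀ c : Fin (Nat.card P) → M, ∑ i, c i • π ^ (i : ℕ) =
      ∑ i ∈ Finset.range (Nat.card P), ext c i * π ^ i := by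
    intro c
    rw [Finset.sum_range]
    refine Finset.sum_congr rfl fun i _ => ?_
    simp only [ext, dif_pos i.2, Subfield.smul_def, smul_eq_mul]
  have hval : ∀ c, ∃ i < Nat.card P,
      v (∑ i ∈ Finset.range (Nat.card P), ext c i * π ^ i) = v (ext c i * π ^ i) ∧
      ∀ j < Nat.card P, v (ext c j * π ^ j) ≤ v (ext c i * π ^ i) := fun c =>
    exists_val_sum_eq hπ hN fun i hi => h.dvd_of_fixed _ hi (hext c i)
  have hli : LinearIndependent M (fun i : Fin (Nat.card P) => π ^ (i : ℕ)) := by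
    rw [Fintype.linearIndependent_iff]
    intro c hc i
    obtain ⟨j, hj, h1, h2⟩ := hval c
    rw [← hsum, hc, map_zero] at h1
    have h3 := h2 i i.2
    rw [← h1] at h3
    have h4 : ext c i * π ^ (i : ℕ) = 0 := by
      rw [← Valuation.zero_iff v]
      exact le_antisymm h3 zero_le
    have h5 := (mul_eq_zero.1 h4).resolve_right (pow_ne_zero _ (ne_zero_of_val_eq_exp hπ))
    simpa only [ext, dif_pos i.2, ZeroMemClass.coe_eq_zero] using h5
  have : Nonempty (Fin (Nat.card P)) := ⟨⟨0, hN⟩⟩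
  let b := basisOfLinearIndependentOfCardEqFinrank hli (by rw [hfin]; simp)
  have hz : z = ∑ i ∈ Finset.range (Nat.card P), ext (b.repr z) i * π ^ i := by
    rw [← hsum]
    conv_lhs => rw [← b.sum_repr z]
    simp [b]
  obtain ⟨i, hi, h1, h2⟩ := hval (b.repr z)
  rw [← hz] at h1
  exact ⟨ext (b.repr z), hext _, hz, fun j hj => (h2 j hj).trans h1.ge, i, hi, h1.symm⟩

omit [Finite P] [FaithfulSMul P L] in
lemma val_smul_div (h : IsTotallyRamified v P) {x : L} (hx : x ≠ 0) (g : P) :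
    v (g • x / x) = 1 := by
  rw [map_div₀, h.map_smul, div_self ((Valuation.ne_zero_iff v).2 hx)]

omit [Finite P] [FaithfulSMul P L] in
lemma val_smul_div_sub_one_le (h : IsTotallyRamified v P) {x : L} (hx : x ≠ 0) (g : P) :
    v (g • x / x - 1) ≤ 1 :=
  v.map_sub_le (h.val_smul_div hx g).le (by simp)

/-- For a unit `u` of the valuation ring, `u ^ n - 1` is divisible by `u - 1`. -/
lemma val_pow_sub_one_le {u : L} (hu : v u ≤ 1) (n : ℕ) : v (u ^ n - 1) ≤ v (u - 1) := by
  rw [← mul_geom_sum u n, map_mul]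
  refine mul_le_of_le_one_right' (v.map_sum_le fun i _ => ?_)
  rw [map_pow]
  exact pow_le_one' hu i

omit [Finite P] [FaithfulSMul P L] in
lemma smul_mul_pow_sub (g : P) {a : L} (ha : g • a = a) (hπ0 : π ≠ 0) (i : ℕ) :
    g • (a * π ^ i) - a * π ^ i = a * π ^ i * ((g • π / π) ^ i - 1) := by
  rw [smul_mul', smul_pow', ha, div_pow, mul_sub, mul_one, mul_assoc,
    mul_div_cancel₀ _ (pow_ne_zero _ hπ0)]

/-- Moving an arbitrary element: `v(g x - x) ≥ v(x) + j(g)` in additive notation. -/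
lemma val_smul_sub_le (h : IsTotallyRamified v P) (hπ : v π = exp (-1)) (g : P) (x : L) :
    v (g • x - x) ≤ v x * v (g • π / π - 1) := by
  obtain ⟨a, ha, hx, hle, -⟩ := h.exists_expansion hπ x
  have hπ0 := ne_zero_of_val_eq_exp hπ
  have : g • x - x = ∑ i ∈ Finset.range (Nat.card P), a i * π ^ i * ((g • π / π) ^ i - 1) := by
    conv_lhs => rw [hx]
    rw [Finset.smul_sum, ← Finset.sum_sub_distrib]
    exact Finset.sum_congr rfl fun i _ => smul_mul_pow_sub g (ha i g) hπ0 i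
  rw [this]
  refine v.map_sum_le fun i hi => ?_
  rw [map_mul]
  exact mul_le_mul' (hle i (Finset.mem_range.1 hi)) (val_pow_sub_one_le (h.val_smul_div hπ0 g).le i)

lemma exists_expansion_of_integral (h : IsTotallyRamified v P) (hπ : v π = exp (-1)) {y : L}
    (hy : v y ≤ 1) : ∃ a : ℕ → L, (∀ i, ∀ g : P, g • a i = a i) ∧
      y = ∑ i ∈ Finset.range (Nat.card P), a i * π ^ i ∧ ∀ i < Nat.card P, v (a i) ≤ 1 := by
  obtain ⟨a, ha, hx, hle, -⟩ := h.exists_expansion hπ y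
  refine ⟨a, ha, hx, fun i hi => ?_⟩
  rcases eq_or_ne (a i) 0 with h0 | h0
  · simp [h0]
  have h1 := (hle i hi).trans hy
  rw [map_mul, val_pow_uniformizer hπ, val_eq_exp_log h0, ← exp_add, ← exp_zero, exp_le_exp] at h1
  rw [val_eq_exp_log h0, ← exp_zero, exp_le_exp]
  -- the valuation of the invariant coefficient is a multiple of `|P|`, and `i < |P|`
  obtain ⟨k, hk⟩ := h.dvd_of_fixed _ h0 (ha i)
  rw [hk] at h1 ⊢
  have : k ≤ 0 := by
    by_contra hk0
    have : (Nat.card P : ℤ) * 1 ≤ Nat.card P * k :=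
      mul_le_mul_of_nonneg_left (by omega) (by positivity)
    omega
  exact mul_nonpos_of_nonneg_of_nonpos (by positivity) this

/-- Moving an integral element: `v(g y - y) ≥ v(g π - π)` in additive notation. -/
lemma val_smul_sub_le_of_integral (h : IsTotallyRamified v P) (hπ : v π = exp (-1)) (g : P) {y : L}
    (hy : v y ≤ 1) : v (g • y - y) ≤ v (g • π - π) := by
  obtain ⟨a, ha, hx, hle⟩ := h.exists_expansion_of_integral hπ hy
  have hπ0 := ne_zero_of_val_eq_exp hπ
  have hgπ : v (g • π - π) = exp (-1) * v (g • π / π - 1) := by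
    rw [← hπ, ← map_mul, mul_sub, mul_one, mul_div_cancel₀ _ hπ0]
  have : g • y - y = ∑ i ∈ Finset.range (Nat.card P), a i * π ^ i * ((g • π / π) ^ i - 1) := by
    conv_lhs => rw [hx]
    rw [Finset.smul_sum, ← Finset.sum_sub_distrib]
    exact Finset.sum_congr rfl fun i _ => smul_mul_pow_sub g (ha i g) hπ0 i
  rw [this, hgπ]
  refine v.map_sum_le fun i hi => ?_
  rcases Nat.eq_zero_or_pos i with rfl | hi0
  · simp
  rw [map_mul, map_mul, val_pow_uniformizer hπ]
  refine mul_le_mul' ?_ (val_pow_sub_one_le (h.val_smul_div hπ0 g).le i)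
  refine (mul_le_of_le_one_left' (hle i (Finset.mem_range.1 hi))).trans ?_
  rw [exp_le_exp]
  omega

lemma smul_div_sub_one_eq_zero_iff (h : IsTotallyRamified v P) (hπ : v π = exp (-1)) {g : P} :
    g • π / π - 1 = 0 ↔ g = 1 := by
  constructor
  · intro h0
    refine FaithfulSMul.eq_of_smul_eq_smul (α := L) fun x => ?_
    have := h.val_smul_sub_le hπ g x
    rw [h0, map_zero, mul_zero] at this
    rw [one_smul, ← sub_eq_zero, ← Valuation.zero_iff v]
    exact le_antisymm this zero_le
  · rintro rfl
    rw [one_smul, div_self (ne_zero_of_val_eq_exp hπ), sub_self]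

lemma val_smul_div_sub_one (h : IsTotallyRamified v P) (hπ : v π = exp (-1)) {g : P}
    (hg : g ≠ 1) : v (g • π / π - 1) = exp (-jump v π g) := by
  rw [jump, neg_neg, exp_log]
  rw [Valuation.ne_zero_iff]
  exact (h.smul_div_sub_one_eq_zero_iff hπ).not.2 hg

lemma val_smul_sub (h : IsTotallyRamified v P) (hπ : v π = exp (-1)) {g : P}
    (hg : g ≠ 1) : v (g • π - π) = exp (-(jump v π g + 1)) := by
  have hπ0 := ne_zero_of_val_eq_exp hπ
  have : v (g • π - π) = exp (-1) * v (g • π / π - 1) := by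
    rw [← hπ, ← map_mul, mul_sub, mul_one, mul_div_cancel₀ _ hπ0]
  rw [this, h.val_smul_div_sub_one hπ hg, ← exp_add, neg_add, add_comm]

omit [Finite P] [FaithfulSMul P L] in
lemma jump_one : jump v π (1 : P) = 0 := by
  rcases eq_or_ne π 0 with h | h <;> simp [jump, h]

lemma jump_nonneg (h : IsTotallyRamified v P) (hπ : v π = exp (-1)) (g : P) : 0 ≤ jump v π g := by
  rcases eq_or_ne g 1 with rfl | hg
  · rw [jump_one]
  have := h.val_smul_div_sub_one_le (ne_zero_of_val_eq_exp hπ) g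
  rw [h.val_smul_div_sub_one hπ hg, ← exp_zero, exp_le_exp] at this
  omega

lemma val_smul_div_sub_one_eq (h : IsTotallyRamified v P) {π' : L} (hπ : v π = exp (-1))
    (hπ' : v π' = exp (-1)) (g : P) : v (g • π' / π' - 1) = v (g • π / π - 1) := by
  have key : ∀ {π π' : L}, v π = exp (-1) → v π' = exp (-1) →
      v (g • π' / π' - 1) ≤ v (g • π / π - 1) := by
    intro π π' hπ hπ'
    have h0 := ne_zero_of_val_eq_exp hπ'
    have := h.val_smul_sub_le hπ g π'
    have h2 : g • π' - π' = π' * (g • π' / π' - 1) := by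
      rw [mul_sub, mul_one, mul_div_cancel₀ _ h0]
    rw [h2, map_mul] at this
    exact (mul_le_mul_iff_right₀ (zero_lt_iff.2 ((Valuation.ne_zero_iff v).2 h0))).1 this
  exact le_antisymm (key hπ hπ') (key hπ' hπ)

lemma jump_eq_jump (h : IsTotallyRamified v P) {π' : L} (hπ : v π = exp (-1))
    (hπ' : v π' = exp (-1)) (g : P) : jump v π' g = jump v π g := by
  rw [jump, jump, h.val_smul_div_sub_one_eq hπ hπ']

lemma jump_conj (h : IsTotallyRamified v P) (hπ : v π = exp (-1)) (c g : P) :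
    jump v π (c * g * c⁻¹) = jump v π g := by
  have h1 : v (c⁻¹ • π) = exp (-1) := by rw [h.map_smul, hπ]
  rw [← h.jump_eq_jump hπ h1 g, jump, jump]
  congr 2
  rw [← h.map_smul c (g • c⁻¹ • π / c⁻¹ • π - 1), smul_sub, smul_div₀', smul_one, smul_inv_smul,
    mul_smul, mul_smul]

omit [Finite P] [FaithfulSMul P L] in
lemma val_inv_smul_div_sub_one (h : IsTotallyRamified v P) (hπ : v π = exp (-1)) (g : P) :
    v (g⁻¹ • π / π - 1) = v (g • π / π - 1) := by
  have hπ0 := ne_zero_of_val_eq_exp hπ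
  have key : ∀ g : P, v (g • π / π - 1) * v π = v (g • π - π) := by
    intro g
    rw [← map_mul, sub_mul, one_mul, div_mul_cancel₀ _ hπ0]
  have : v (g⁻¹ • π - π) = v (g • π - π) := by
    rw [← h.map_smul g, smul_sub, smul_inv_smul, Valuation.map_sub_swap]
  rw [← key, ← key] at this
  exact mul_right_cancel₀ ((Valuation.ne_zero_iff v).2 hπ0) this

omit [Finite P] [FaithfulSMul P L] in
lemma val_mul_smul_div_sub_one_le (h : IsTotallyRamified v P) (hπ : v π = exp (-1)) (g g' : P) :
    v ((g * g') • π / π - 1) ≤ max (v (g • π / π - 1)) (v (g' • π / π - 1)) := by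
  have hπ0 := ne_zero_of_val_eq_exp hπ
  have hv0 : 0 < v π := zero_lt_iff.2 ((Valuation.ne_zero_iff v).2 hπ0)
  have key : ∀ g : P, v (g • π / π - 1) * v π = v (g • π - π) := by
    intro g
    rw [← map_mul, sub_mul, one_mul, div_mul_cancel₀ _ hπ0]
  have h1 : (g * g') • π - π = (g • π - π) + g • (g' • π - π) := by
    rw [smul_sub, mul_smul]; ring
  have h2 := v.map_add (g • π - π) (g • (g' • π - π))
  rw [← h1, h.map_smul, ← key, ← key, ← key] at h2
  rcases le_max_iff.1 h2 with h3 | h3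
  · exact le_max_of_le_left ((mul_le_mul_iff_left₀ hv0).1 h3)
  · exact le_max_of_le_right ((mul_le_mul_iff_left₀ hv0).1 h3)

/-- The elements `g` with `v(g π / π - 1) ≤ c`, i.e. the ramification group with index `-log c`. -/
def ramificationSubgroup (h : IsTotallyRamified v P) (hπ : v π = exp (-1)) (c : ℤᵐ⁰) :
    Subgroup P where
  carrier := {g | v (g • π / π - 1) ≤ c}
  one_mem' := by simp [div_self (ne_zero_of_val_eq_exp hπ)]
  mul_mem' {g g'} hg hg' := (h.val_mul_smul_div_sub_one_le hπ g g').trans (max_le hg hg')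
  inv_mem' {g} hg := (h.val_inv_smul_div_sub_one hπ g).le.trans hg

omit [Finite P] [FaithfulSMul P L] in
lemma mem_ramificationSubgroup (h : IsTotallyRamified v P) (hπ : v π = exp (-1)) {c : ℤᵐ⁰}
    {g : P} : g ∈ h.ramificationSubgroup hπ c ↔ v (g • π / π - 1) ≤ c := Iff.rfl

omit [FaithfulSMul P L] in
/-- A subgroup of a totally ramified group is totally ramified: apply the condition to the norm
down to the larger group. -/
lemma subgroup (h : IsTotallyRamified v P) (H : Subgroup P) : IsTotallyRamified v H where
  surjective := h.surjective
  map_smul g x := h.map_smul g x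
  dvd_of_fixed a ha hfix := by
    classical
    have := Fintype.ofFinite (P ⧸ H)
    let f : P ⧸ H → L := Quotient.lift (fun g : P => g • a) (by
      intro g g' hgg'
      have h1 := QuotientGroup.leftRel_apply.1 hgg'
      have h2 := hfix ⟨_, h1⟩
      rw [Subgroup.mk_smul, mul_smul] at h2
      change g • a = g' • a
      nth_rw 1 [← h2]
      rw [smul_inv_smul])
    have hf : ∀ g : P, f g = g • a := fun g => rfl
    have hvf : ∀ q, v (f q) = v a := by
      intro q
      induction q using QuotientGroup.induction_on with
      | H g => rw [hf, h.map_smul]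
    have hf0 : ∏ q, f q ≠ 0 := by
      rw [← Valuation.ne_zero_iff v, map_prod]
      refine Finset.prod_ne_zero_iff.2 fun q _ => ?_
      rw [hvf, Valuation.ne_zero_iff]
      exact ha
    have h1 := h.dvd_of_fixed _ hf0 (by
      intro g
      rw [Finset.smul_prod']
      refine Fintype.prod_bijective (fun q => g • q) (MulAction.bijective g) _ _ ?_
      intro q
      induction q using QuotientGroup.induction_on with
      | H g' => rw [hf, ← mul_smul]; rfl)
    rw [map_prod, Finset.prod_congr rfl fun q _ => hvf q, Finset.prod_const, log_pow,
      Finset.card_univ, ← Nat.card_eq_fintype_card, nsmul_eq_mul, ← H.card_mul_index,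
      Subgroup.index, Nat.cast_mul, mul_comm] at h1
    exact Int.dvd_of_mul_dvd_mul_left (by exact_mod_cast (Nat.card_pos (α := P ⧸ H)).ne') h1

end IsTotallyRamified

end TotallyRamified

end ArtinSwan

namespace ArtinSwan

open WithZero

/-! ### Congruences between the jumps of a cyclic group of prime power order -/

section Cyclic

variable {L : Type*} [Field L] {v : Valuation L ℤᵐ⁰} {π : L}

namespace IsTotallyRamified

variable {P : Type*} [Group P] [MulSemiringAction P L] [FaithfulSMul P L]

/-- If `d` is the valuation of the different `∏_{g ≠ 1} (π - g π)`, then no nonzero element of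
valuation congruent to `-d - 1` modulo `|P|` has trace zero. By Euler's formula, the trace of `z` is
the coefficient of `π ^ (|P| - 1)` in the expansion of `z ∏_{g ≠ 1} (π - g π)` in powers of `π`, and
the congruence makes this the dominant term. -/
lemma sum_smul_ne_zero [Fintype P] (h : IsTotallyRamified v P) (hπ : v π = exp (-1)) {z : L}
    (hz : z ≠ 0) (hdvd : (Nat.card P : ℤ) ∣ -log (v z) + ∑ g : P, jump v π g) :
    ∑ g : P, g • z ≠ 0 := by
  classical
  have hN : 0 < Nat.card P := Nat.card_pos
  have hinj : Function.Injective (fun g : P => g • π) := by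
    intro g g' hgg'
    have h1 : (g'⁻¹ * g) • π / π - 1 = 0 := by
      rw [mul_smul, show g • π = g' • π from hgg', inv_smul_smul,
        div_self (ne_zero_of_val_eq_exp hπ), sub_self]
    have h2 := (h.smul_div_sub_one_eq_zero_iff hπ).1 h1
    exact (inv_mul_eq_one.1 h2).symm
  set D : L := ∏ g ∈ Finset.univ.erase (1 : P), (π - g • π) with hD
  have hvD : v D = exp (-(∑ g : P, jump v π g + (Nat.card P - 1))) := by
    rw [hD, map_prod]
    have : ∀ g ∈ Finset.univ.erase (1 : P), v (π - g • π) = exp (-(jump v π g + 1)) := by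
      intro g hg
      rw [Valuation.map_sub_swap, h.val_smul_sub hπ (Finset.ne_of_mem_erase hg)]
    rw [Finset.prod_congr rfl this]
    rw [prod_exp, exp_inj, Finset.sum_neg_distrib, neg_inj, Finset.sum_add_distrib,
      Finset.sum_erase _ jump_one, Finset.sum_const, Finset.card_erase_of_mem (Finset.mem_univ _),
      Finset.card_univ, Nat.card_eq_fintype_card, nsmul_eq_mul, mul_one,
      Nat.cast_sub Fintype.card_pos, Nat.cast_one]
  have hD0 : D ≠ 0 := ne_zero_of_val_eq_exp hvD
  obtain ⟨a, ha, hexp, -, i, hi, hvi⟩ := h.exists_expansion hπ (z * D)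
  let Q : Polynomial L := ∑ i ∈ Finset.range (Nat.card P), Polynomial.C (a i) * Polynomial.X ^ i
  have hdeg : Q.degree < (Finset.univ : Finset P).card := by
    rw [Finset.card_univ, ← Nat.card_eq_fintype_card]
    refine (Polynomial.degree_sum_le _ _).trans_lt ?_
    rw [Finset.sup_lt_iff (WithBot.bot_lt_coe _)]
    intro i hi
    refine (Polynomial.degree_C_mul_X_pow_le _ _).trans_lt ?_
    exact_mod_cast Finset.mem_range.1 hi
  have heval : ∀ g : P, Q.eval (g • π) = g • (z * D) := by
    intro g
    rw [hexp, Finset.smul_sum, Polynomial.eval_finsetSum]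
    refine Finset.sum_congr rfl fun i _ => ?_
    rw [smul_mul', smul_pow', ha]
    simp
  have hprod : ∀ g : P, ∏ j ∈ Finset.univ.erase g, (g • π - j • π) = g • D := by
    intro g
    rw [hD, Finset.smul_prod']
    refine (Finset.prod_nbij (fun j => g * j) ?_ ?_ ?_ ?_).symm
    · intro j hj
      simpa using hj
    · exact fun _ _ _ _ => mul_left_cancel
    · intro j hj
      refine ⟨g⁻¹ * j, ?_, by simp⟩
      simpa [inv_mul_eq_one, eq_comm] using hj
    · intro j _
      rw [smul_sub, mul_smul]
  have htr : Q.coeff (Nat.card P - 1) = ∑ g : P, g • z := by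
    have := Lagrange.coeff_eq_sum (s := Finset.univ) (v := fun g : P => g • π) hinj.injOn hdeg
    rw [Finset.card_univ, ← Nat.card_eq_fintype_card] at this
    rw [this]
    refine Finset.sum_congr rfl fun g _ => ?_
    rw [heval, hprod, smul_mul', mul_div_assoc, div_self, mul_one]
    exact (smul_ne_zero_iff_ne g).2 hD0
  have hcoeff : Q.coeff (Nat.card P - 1) = a (Nat.card P - 1) := by
    simp only [Q, Polynomial.finsetSum_coeff, Polynomial.coeff_C_mul_X_pow]
    rw [Finset.sum_ite_eq, if_pos (Finset.mem_range.2 (by omega))]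
  rw [← htr, hcoeff]
  have hzD : v (a i * π ^ i) ≠ 0 := by
    rw [hvi, Valuation.ne_zero_iff]
    exact mul_ne_zero hz hD0
  have hai : a i ≠ 0 := by
    rintro h0
    simp [h0] at hzD
  suffices i = Nat.card P - 1 by rwa [← this]
  rw [map_mul, map_mul, hvD, val_pow_uniformizer hπ, val_eq_exp_log hai, val_eq_exp_log hz,
    ← exp_add, ← exp_add, exp_inj] at hvi
  have h1 := h.dvd_of_fixed _ hai (ha i)
  have h2 : (Nat.card P : ℤ) ∣ (Nat.card P - 1) - i := by
    have : (Nat.card P - 1 : ℤ) - i =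
        -log (v (a i)) - (-log (v z) + ∑ g : P, jump v π g) := by linarith
    rw [this]
    exact dvd_sub (dvd_neg.2 h1) hdvd
  have h3 := Int.eq_zero_of_abs_lt_dvd h2 (by rw [abs_lt]; constructor <;> omega)
  omega

/-- For `x = π (σ π) ⋯ (σ ^ (m - 1) π)` one has `σ x / x = σ ^ m π / π`, so that `σ x - x` has
valuation `m + j(σ ^ m)`; since its trace is zero, that valuation avoids a residue class. -/
lemma not_dvd_add_jump_pow_add_sum [Fintype P] (h : IsTotallyRamified v P) (hπ : v π = exp (-1))
    {σ : P} {m : ℕ} (hm : σ ^ m ≠ 1) :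
    ¬ (Nat.card P : ℤ) ∣ m + jump v π (σ ^ m) + ∑ g : P, jump v π g := by
  intro hdvd
  have hπ0 := ne_zero_of_val_eq_exp hπ
  set x : L := ∏ k ∈ Finset.range m, σ ^ k • π with hx
  have hvx : v x = exp (-m : ℤ) := by
    rw [hx, map_prod, Finset.prod_congr rfl fun k _ => h.map_smul (σ ^ k) π, Finset.prod_const,
      Finset.card_range, ← map_pow, val_pow_uniformizer hπ]
  have hx0 := ne_zero_of_val_eq_exp hvx
  have hσx : σ • x * π = x * σ ^ m • π := by
    rw [hx, Finset.smul_prod', ← Finset.prod_range_succ, Finset.prod_range_succ', pow_zero,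
      one_smul]
    congr 1
    exact Finset.prod_congr rfl fun k _ => by rw [← mul_smul, pow_succ']
  have hy : σ • x - x = x * (σ ^ m • π / π - 1) := by
    rw [mul_sub, mul_one, mul_div_assoc', ← hσx, mul_div_cancel_right₀ _ hπ0]
  have hvy : v (σ • x - x) = exp (-(m + jump v π (σ ^ m)) : ℤ) := by
    rw [hy, map_mul, hvx, h.val_smul_div_sub_one hπ hm, ← exp_add, neg_add]
  refine h.sum_smul_ne_zero hπ (ne_zero_of_val_eq_exp hvy) ?_ ?_
  · rwa [hvy, log_exp, neg_neg]
  · simp only [smul_sub, ← mul_smul]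
    rw [Finset.sum_sub_distrib, sub_eq_zero]
    exact Fintype.sum_bijective (· * σ) (Group.mulRight_bijective σ) _ _ fun g => rfl

omit [FaithfulSMul P L] in
lemma jump_pow_eq [Finite P] (h : IsTotallyRamified v P) (hπ : v π = exp (-1)) {σ : P} {u : ℕ}
    (hu : u.Coprime (orderOf σ)) : jump v π (σ ^ u) = jump v π σ := by
  have key : ∀ (τ : P) (k : ℕ), v (τ ^ k • π / π - 1) ≤ v (τ • π / π - 1) := fun τ k =>
    (h.mem_ramificationSubgroup hπ).1
      (pow_mem ((h.mem_ramificationSubgroup hπ).2 le_rfl : τ ∈ h.ramificationSubgroup hπ _) k)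
  obtain ⟨m, hm⟩ := exists_pow_eq_self_of_coprime hu
  have h2 := key (σ ^ u) m
  rw [hm] at h2
  rw [jump, jump, le_antisymm (key σ u) h2]

end IsTotallyRamified

lemma sum_range_mul_eq {A : Type*} [AddCommMonoid A] {q : ℕ} (hq : 0 < q) (M : ℕ) (F : ℕ → A)
    (hF : ∀ m, ¬ q ∣ m → F m = 0) :
    ∑ m ∈ Finset.range (q * M), F m = ∑ m ∈ Finset.range M, F (q * m) := by
  classical
  have h1 : ∑ m ∈ (Finset.range M).image (q * ·), F m = ∑ m ∈ Finset.range M, F (q * m) :=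
    Finset.sum_image fun a _ b _ h => Nat.eq_of_mul_eq_mul_left hq h
  rw [← h1]
  refine (Finset.sum_subset ?_ ?_).symm
  · intro m hm
    obtain ⟨k, hk, rfl⟩ := Finset.mem_image.1 hm
    exact Finset.mem_range.2 (Nat.mul_lt_mul_of_pos_left (Finset.mem_range.1 hk) hq)
  · intro m hm hm'
    refine hF m ?_
    rintro ⟨k, rfl⟩
    exact hm' (Finset.mem_image.2
      ⟨k, Finset.mem_range.2 (Nat.lt_of_mul_lt_mul_left (Finset.mem_range.1 hm)), rfl⟩)

namespace IsTotallyRamified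

variable {P : Type*} [Group P] [MulSemiringAction P L] [FaithfulSMul P L] [Finite P] {p : ℕ}

omit [FaithfulSMul P L] in
lemma sum_zpowers_jump {σ : P} [Fintype (Subgroup.zpowers σ)] :
    ∑ g : Subgroup.zpowers σ, jump v π g = ∑ m ∈ Finset.range (orderOf σ), jump v π (σ ^ m) := by
  rw [Finset.sum_range]
  exact (Fintype.sum_equiv (finEquivZPowers (isOfFinOrder_of_finite σ)) _ _ fun m => by
    rw [finEquivZPowers_apply]; rfl).symm

lemma not_dvd_add_jump_pow (h : IsTotallyRamified v P) (hπ : v π = exp (-1)) {σ : P} {m : ℕ}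
    (hm : ¬ orderOf σ ∣ m) :
    ¬ (orderOf σ : ℤ) ∣ m + jump v π (σ ^ m) +
      ∑ k ∈ Finset.range (orderOf σ), jump v π (σ ^ k) := by
  have := Fintype.ofFinite (Subgroup.zpowers σ)
  have h1 := (h.subgroup (Subgroup.zpowers σ)).not_dvd_add_jump_pow_add_sum hπ
    (σ := ⟨σ, Subgroup.mem_zpowers σ⟩) (m := m) (by
      intro h1
      exact hm (orderOf_dvd_of_pow_eq_one (by simpa using congrArg Subtype.val h1)))
  rw [Nat.card_zpowers, sum_zpowers_jump] at h1
  exact h1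

omit [FaithfulSMul P L] in
/-- Raising `σ` to powers, `j(σ ^ m)` depends only on the `p`-adic valuation of `m`. -/
lemma jump_pow_of_orderOf (h : IsTotallyRamified v P) (hπ : v π = exp (-1)) (hp : p.Prime) {σ : P}
    {n k u : ℕ} (hσ : orderOf σ = p ^ n) (hu : ¬ p ∣ u) :
    jump v π (σ ^ (p ^ k * u)) = jump v π (σ ^ p ^ k) := by
  rw [pow_mul]
  refine h.jump_pow_eq hπ ?_
  have h1 : orderOf (σ ^ p ^ k) ∣ p ^ n := hσ ▸ orderOf_pow_dvd _
  exact Nat.Coprime.coprime_dvd_right h1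
    (((Nat.Prime.coprime_iff_not_dvd hp).2 hu).symm.pow_right n)

/-- If a power `p ^ k` with `k ≤ n` divides `j(σ ^ (p ^ k)) + S`, where `σ` has order `p ^ (n + 1)`
and `S` is the sum of the jumps of all the powers of `σ`, then so does `p ^ (k + 1)`. -/
lemma pow_succ_dvd_jump_add_sum (h : IsTotallyRamified v P) (hπ : v π = exp (-1)) (hp : p.Prime)
    {σ : P} {n k : ℕ} (hσ : orderOf σ = p ^ (n + 1)) (hk : k ≤ n)
    (hdvd : (p : ℤ) ^ k ∣ jump v π (σ ^ p ^ k) +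
      ∑ m ∈ Finset.range (p ^ (n + 1)), jump v π (σ ^ m)) :
    (p : ℤ) ^ (k + 1) ∣ jump v π (σ ^ p ^ k) +
      ∑ m ∈ Finset.range (p ^ (n + 1)), jump v π (σ ^ m) := by
  by_contra hnot
  set t := jump v π (σ ^ p ^ k) + ∑ m ∈ Finset.range (p ^ (n + 1)), jump v π (σ ^ m) with ht
  obtain ⟨c, hc⟩ := hdvd
  have hp0 : (0 : ℤ) < p := by exact_mod_cast hp.pos
  have hpc : ¬ (p : ℤ) ∣ c := by
    rintro ⟨d, rfl⟩
    exact hnot ⟨d, by rw [hc]; ring⟩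
  -- a natural number congruent to `-c` modulo `p ^ (n + 1)`
  obtain ⟨u, hu⟩ : ∃ u : ℕ, (p : ℤ) ^ (n + 1) ∣ u + c := by
    refine ⟨(-c % (p : ℤ) ^ (n + 1)).toNat, ?_⟩
    rw [Int.toNat_of_nonneg (Int.emod_nonneg _ (by positivity))]
    have := Int.mul_ediv_add_emod (-c) ((p : ℤ) ^ (n + 1))
    exact ⟨-(-c / (p : ℤ) ^ (n + 1)), by linarith⟩
  have hpu : ¬ p ∣ u := by
    intro h1
    have h2 : (p : ℤ) ∣ u + c := (dvd_pow_self _ (by omega)).trans hu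
    exact hpc ((Int.dvd_add_right (Int.natCast_dvd_natCast.2 h1)).1 h2)
  have hno : ¬ orderOf σ ∣ p ^ k * u := by
    rw [hσ]
    intro h1
    have h2 : p ^ k * p ∣ p ^ k * u := by
      rw [← pow_succ]
      exact (pow_dvd_pow p (by omega)).trans h1
    exact hpu (Nat.dvd_of_mul_dvd_mul_left (pow_pos hp.pos k) h2)
  refine h.not_dvd_add_jump_pow hπ hno ?_
  rw [h.jump_pow_of_orderOf hπ hp hσ hpu, add_assoc, hσ, ← ht, hc]
  push_cast
  rw [← mul_add]
  exact hu.mul_left _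

/-- The congruences between the jumps `j(σ ^ (p ^ k))`, `k ≤ n`, for `σ` of order `p ^ (n + 1)`. -/
lemma pow_succ_dvd_jump_sub_jump (h : IsTotallyRamified v P) (hπ : v π = exp (-1)) (hp : p.Prime)
    (n : ℕ) : ∀ {σ : P}, orderOf σ = p ^ (n + 1) →
      (∀ k ≤ n, (p : ℤ) ^ (k + 1) ∣ jump v π (σ ^ p ^ k) - jump v π (σ ^ p ^ n)) ∧
      (p : ℤ) ^ (n + 1) ∣ jump v π (σ ^ p ^ n) +
        ∑ m ∈ Finset.range (p ^ (n + 1)), jump v π (σ ^ m) := by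
  induction n with
  | zero =>
    intro σ hσ
    refine ⟨fun k hk => ?_, h.pow_succ_dvd_jump_add_sum hπ hp hσ le_rfl (by simp)⟩
    obtain rfl : k = 0 := by omega
    simp
  | succ n ih =>
    intro σ hσ
    have hσp : orderOf (σ ^ p) = p ^ (n + 1) := by
      rw [orderOf_pow_of_dvd hp.ne_zero (hσ ▸ dvd_pow_self p (by omega)), hσ, pow_succ,
        Nat.mul_div_cancel _ hp.pos]
    obtain ⟨ih1, ih2⟩ := ih hσp
    simp only [← pow_mul, ← pow_succ'] at ih1 ih2
    -- the jump is constant outside the multiples of `p`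
    have hS : ∑ m ∈ Finset.range (p ^ (n + 2)), jump v π (σ ^ m) =
        ∑ m ∈ Finset.range (p ^ (n + 1)), jump v π (σ ^ (p * m)) +
          (p : ℤ) ^ (n + 1) * ((p - 1) * jump v π σ) := by
      have h1 := sum_range_mul_eq hp.pos (p ^ (n + 1)) (fun m => jump v π (σ ^ m) - jump v π σ)
        (by
          intro m hm
          have := h.jump_pow_of_orderOf hπ hp hσ (k := 0) hm
          simp only [pow_zero, one_mul, pow_one] at this
          rw [this, sub_self])
      rw [← pow_succ', Finset.sum_sub_distrib, Finset.sum_sub_distrib] at h1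
      simp only [Finset.sum_const, Finset.card_range, nsmul_eq_mul] at h1
      push_cast at h1
      have h2 : (p : ℤ) ^ (n + 2) = p * p ^ (n + 1) := pow_succ' _ _
      rw [h2] at h1
      linear_combination h1
    have hSn : (p : ℤ) ^ (n + 1) ∣ jump v π (σ ^ p ^ (n + 1)) +
        ∑ m ∈ Finset.range (p ^ (n + 2)), jump v π (σ ^ m) := by
      rw [hS, ← add_assoc]
      exact dvd_add ih2 (Dvd.intro _ rfl)
    refine ⟨?_, h.pow_succ_dvd_jump_add_sum hπ hp hσ le_rfl hSn⟩
    intro k hk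
    rcases Nat.lt_or_ge n k with hk' | hk'
    · obtain rfl : k = n + 1 := by omega
      simp
    have h1 : (p : ℤ) ^ k ∣ jump v π (σ ^ p ^ k) - jump v π (σ ^ p ^ (n + 1)) := by
      rcases Nat.eq_zero_or_pos k with rfl | hk0
      · simp
      · have := ih1 (k - 1) (by omega)
        rwa [Nat.sub_add_cancel hk0] at this
    have h3 : ∀ {a : ℕ}, a ≤ n + 1 → (p : ℤ) ^ a ∣ jump v π (σ ^ p ^ (n + 1)) +
        ∑ m ∈ Finset.range (p ^ (n + 2)), jump v π (σ ^ m) := fun ha =>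
      (pow_dvd_pow _ ha).trans hSn
    have h4 := h.pow_succ_dvd_jump_add_sum hπ hp hσ hk (by
      have := dvd_add h1 (h3 (a := k) (by omega))
      rwa [← add_assoc, sub_add_cancel] at this)
    have := dvd_sub h4 (h3 (a := k + 1) (by omega))
    rwa [add_sub_add_right_eq_sub] at this

/-- The Hasse–Arf theorem for a cyclic group of prime power order, as the integrality of the pairing
of the jump function with `1 - χ` for a faithful character `χ`. -/
theorem exists_sum_jump_pow_eq (h : IsTotallyRamified v P) (hπ : v π = exp (-1)) (hp : p.Prime)
    {n : ℕ} {σ : P} (hσ : orderOf σ = p ^ (n + 1)) {ζ : ℂ} (hζ : IsPrimitiveRoot ζ (p ^ (n + 1))) :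
    ∃ c : ℤ, ∑ m ∈ Finset.range (p ^ (n + 1)), (jump v π (σ ^ m) : ℂ) * (1 - ζ ^ m) =
      (p : ℂ) ^ (n + 1) * c := by
  classical
  obtain ⟨hcong, -⟩ := h.pow_succ_dvd_jump_sub_jump hπ hp n hσ
  -- the successive differences of the jumps
  let e : ℕ → ℤ := fun l => jump v π (σ ^ p ^ l) - if l = 0 then 0 else jump v π (σ ^ p ^ (l - 1))
  have he : ∀ l ≤ n, (p : ℤ) ^ l ∣ e l := by
    intro l hl
    rcases Nat.eq_zero_or_pos l with rfl | hl0
    · simp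
    have h1 := hcong (l - 1) (by omega)
    rw [Nat.sub_add_cancel hl0] at h1
    have h2 := (pow_dvd_pow (p : ℤ) (Nat.le_succ l)).trans (hcong l hl)
    simp only [e, if_neg hl0.ne']
    have := dvd_sub h2 h1
    rwa [sub_sub_sub_cancel_right] at this
  have hsum_e : ∀ k, ∑ l ∈ Finset.range (k + 1), e l = jump v π (σ ^ p ^ k) := by
    intro k
    induction k with
    | zero => simp [e]
    | succ k ih => rw [Finset.sum_range_succ, ih]; simp [e]
  have hterm : ∀ m, (jump v π (σ ^ m) : ℂ) * (1 - ζ ^ m) =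
      ∑ l ∈ Finset.range (n + 1), (e l : ℂ) * if p ^ l ∣ m then 1 - ζ ^ m else 0 := by
    intro m
    by_cases hm : p ^ (n + 1) ∣ m
    · have : ζ ^ m = 1 := (hζ.pow_eq_one_iff_dvd m).2 hm
      simp [this]
    have hm0 : m ≠ 0 := by rintro rfl; simp at hm
    obtain ⟨k, u, hu, rfl⟩ := Nat.exists_eq_pow_mul_and_not_dvd hm0 p hp.ne_one
    have hdvd : ∀ l, p ^ l ∣ p ^ k * u ↔ l ≤ k := by
      intro l
      constructor
      · intro h1
        by_contra h2
        have h3 : p ^ k * p ∣ p ^ k * u := by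
          rw [← pow_succ]
          exact (pow_dvd_pow p (by omega)).trans h1
        exact hu (Nat.dvd_of_mul_dvd_mul_left (pow_pos hp.pos k) h3)
      · exact fun h1 => (pow_dvd_pow p h1).mul_right u
    have hk : k ≤ n := by
      rw [hdvd] at hm
      omega
    rw [h.jump_pow_of_orderOf hπ hp hσ hu, ← hsum_e]
    simp only [hdvd, mul_ite, mul_zero]
    rw [← Finset.sum_filter, Int.cast_sum, Finset.sum_mul]
    refine Finset.sum_congr ?_ fun _ _ => rfl
    ext l
    simp only [Finset.mem_range, Finset.mem_filter]
    omega
  have hlayer : ∀ l ∈ Finset.range (n + 1), ∑ m ∈ Finset.range (p ^ (n + 1)),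
      (e l : ℂ) * (if p ^ l ∣ m then 1 - ζ ^ m else 0) = e l * (p : ℂ) ^ (n + 1 - l) := by
    intro l hl
    have hl' : l < n + 1 := Finset.mem_range.1 hl
    rw [← Finset.mul_sum]
    congr 1
    have hsplit : p ^ (n + 1) = p ^ l * p ^ (n + 1 - l) := by
      rw [← pow_add]; congr 1; omega
    rw [hsplit, sum_range_mul_eq (pow_pos hp.pos l) _ _ fun m hm => if_neg hm]
    simp only [dvd_mul_right, if_true, pow_mul]
    have hprim : IsPrimitiveRoot (ζ ^ p ^ l) (p ^ (n + 1 - l)) :=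
      hζ.pow (pow_pos hp.pos _) hsplit
    rw [Finset.sum_sub_distrib, hprim.geom_sum_eq_zero (Nat.one_lt_pow (by omega) hp.one_lt)]
    simp
  choose! c hc using he
  refine ⟨∑ l ∈ Finset.range (n + 1), c l, ?_⟩
  rw [Finset.sum_congr rfl fun m _ => hterm m, Finset.sum_comm, Finset.sum_congr rfl hlayer,
    Int.cast_sum, Finset.mul_sum]
  refine Finset.sum_congr rfl fun l hl => ?_
  have hl' : l < n + 1 := Finset.mem_range.1 hl
  rw [hc l (by omega)]
  push_cast
  rw [mul_right_comm, ← pow_add]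
  congr 2
  omega

end IsTotallyRamified

end Cyclic

end ArtinSwan

namespace ArtinSwan

open WithZero

/-! ### Quotients of totally ramified groups -/

section Quotient

variable {L : Type*} [Field L] {v : Valuation L ℤᵐ⁰} {π : L}

open Classical in
/-- The valuation `w` on a subfield `M` of `L` with `w ^ e = v`, if the valuations of all nonzero
elements of `M` are divisible by `e`. -/
def rootValuation (v : Valuation L ℤᵐ⁰) (M : Subfield L) (e : ℕ) (he : 0 < e)
    (hM : ∀ y : M, y ≠ 0 → (e : ℤ) ∣ log (v y)) : Valuation M ℤᵐ⁰ where
  toFun y := if y = 0 then 0 else exp (log (v y) / e)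
  map_zero' := if_pos rfl
  map_one' := by simp
  map_mul' x y := by
    rcases eq_or_ne x 0 with rfl | hx
    · simp
    rcases eq_or_ne y 0 with rfl | hy
    · simp
    rw [if_neg (mul_ne_zero hx hy), if_neg hx, if_neg hy, ← exp_add, Subfield.coe_mul, map_mul,
      log_mul (by simpa using hx) (by simpa using hy), Int.add_ediv_of_dvd_left (hM x hx)]
  map_add_le_max' x y := by
    rcases eq_or_ne (x + y) 0 with hxy | hxy
    · rw [if_pos hxy]
      exact zero_le
    rcases eq_or_ne x 0 with rfl | hx
    · simp
    rcases eq_or_ne y 0 with rfl | hy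
    · simp
    rw [if_neg hxy, if_neg hx, if_neg hy, le_max_iff, exp_le_exp, exp_le_exp]
    have h0 : ∀ z : M, z ≠ 0 → v (z : L) ≠ 0 := fun z hz => by simpa using hz
    rcases v.map_add' (x : L) y with h | h
    · left
      exact Int.ediv_le_ediv (by exact_mod_cast he) ((log_le_log (h0 _ hxy) (h0 _ hx)).2 h)
    · right
      exact Int.ediv_le_ediv (by exact_mod_cast he) ((log_le_log (h0 _ hxy) (h0 _ hy)).2 h)

lemma rootValuation_pow {M : Subfield L} {e : ℕ} {he : 0 < e}
    {hM : ∀ y : M, y ≠ 0 → (e : ℤ) ∣ log (v y)} (y : M) :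
    rootValuation v M e he hM y ^ e = v y := by
  classical
  change (if y = 0 then 0 else exp (log (v y) / e)) ^ e = v y
  split_ifs with h
  · simp [h, he.ne']
  · rw [← exp_nsmul, nsmul_eq_mul, Int.mul_ediv_cancel' (hM y h), exp_log]
    simpa using h

variable {P : Type*} [Group P] [MulSemiringAction P L]

instance isInvariantSubfield_fixedPoints (N : Subgroup P) [N.Normal] :
    IsInvariantSubfield P (FixedPoints.subfield N L) where
  smul_mem g {x} hx n := by
    have h1 := hx ⟨g⁻¹ * n * g, by
      simpa using Subgroup.Normal.conj_mem ‹N.Normal› n n.2 g⁻¹⟩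
    rw [Subgroup.mk_smul, mul_smul, mul_smul, inv_smul_eq_iff] at h1
    exact h1

/-- The image of `P` in the automorphism group of the fixed field of a normal subgroup `N`. If the
action is faithful this is a copy of `P ⧸ N`. -/
abbrev quotientGroup (L : Type*) [Field L] {P : Type*} [Group P] [MulSemiringAction P L]
    (N : Subgroup P) [N.Normal] : Subgroup (RingAut (FixedPoints.subfield N L)) :=
  (MulSemiringAction.toRingAut P (FixedPoints.subfield N L)).range

/-- The class of `g` in `quotientGroup L N`. -/
abbrev toQuotientGroup (L : Type*) [Field L] {P : Type*} [Group P] [MulSemiringAction P L]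
    (N : Subgroup P) [N.Normal] : P →* quotientGroup L N :=
  (MulSemiringAction.toRingAut P (FixedPoints.subfield N L)).rangeRestrict

instance finite_quotientGroup [Finite P] (N : Subgroup P) [N.Normal] :
    Finite (quotientGroup L N) :=
  Finite.of_surjective _ (MonoidHom.rangeRestrict_surjective _)

lemma coe_toQuotientGroup_smul (N : Subgroup P) [N.Normal] (g : P)
    (y : FixedPoints.subfield N L) : ((toQuotientGroup L N g • y : _) : L) = g • (y : L) := rfl

namespace IsTotallyRamified

variable [Finite P] (N : Subgroup P) [N.Normal]

omit [N.Normal] in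
lemma card_dvd_log (h : IsTotallyRamified v P) (y : FixedPoints.subfield N L) (hy : y ≠ 0) :
    (Nat.card N : ℤ) ∣ log (v y) :=
  (h.subgroup N).dvd_of_fixed y (by simpa using hy) y.2

/-- The normalized valuation of the fixed field of a subgroup. -/
def fixedValuation (h : IsTotallyRamified v P) : Valuation (FixedPoints.subfield N L) ℤᵐ⁰ :=
  rootValuation v _ (Nat.card N) Nat.card_pos (h.card_dvd_log N)

omit [N.Normal] in
lemma fixedValuation_pow (h : IsTotallyRamified v P) (y : FixedPoints.subfield N L) :
    h.fixedValuation N y ^ Nat.card N = v y := rootValuation_pow y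

omit [N.Normal] in
lemma fixedValuation_le_iff (h : IsTotallyRamified v P) (x y : FixedPoints.subfield N L) :
    h.fixedValuation N x ≤ h.fixedValuation N y ↔ v x ≤ v y := by
  rw [← h.fixedValuation_pow, ← h.fixedValuation_pow,
    pow_le_pow_iff_left₀ zero_le zero_le Nat.card_pos.ne']

omit [N.Normal] in
lemma fixedValuation_eq_of_pow (h : IsTotallyRamified v P) {y : FixedPoints.subfield N L} {c : ℤᵐ⁰}
    (hc : v y = c ^ Nat.card N) : h.fixedValuation N y = c := by
  rw [← h.fixedValuation_pow] at hc
  exact (pow_left_inj₀ zero_le zero_le Nat.card_pos.ne').1 hc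

omit [N.Normal] in
/-- The norm of an element of valuation `c` down to the fixed field of `N`. -/
lemma exists_fixedValuation_eq (h : IsTotallyRamified v P) (c : ℤᵐ⁰) :
    ∃ y : FixedPoints.subfield N L, h.fixedValuation N y = c := by
  have := Fintype.ofFinite N
  obtain ⟨x, hx⟩ := h.surjective c
  refine ⟨⟨∏ n : N, n • x, fun n => ?_⟩, h.fixedValuation_eq_of_pow N ?_⟩
  · change n • ∏ n : N, n • x = _
    rw [Finset.smul_prod']
    exact Fintype.prod_bijective (n * ·) (Group.mulLeft_bijective n) _ _ fun m =>
      (mul_smul n m x).symm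
  · change v (∏ n : N, n • x) = _
    rw [map_prod, Finset.prod_congr rfl fun n _ => (h.subgroup N).map_smul n x, Finset.prod_const,
      hx, Finset.card_univ, Nat.card_eq_fintype_card]

/-- An automorphism in `P` that is trivial on the fixed field of `N` lies in `N`. -/
lemma ker_toQuotientGroup (h : IsTotallyRamified v P) : (toQuotientGroup L N).ker = N := by
  symm
  refine Subgroup.eq_of_le_of_card_ge ?_ ?_
  · intro n hn
    rw [MonoidHom.mem_ker]
    ext y
    exact y.2 ⟨n, hn⟩
  · obtain ⟨y, hy⟩ := h.exists_fixedValuation_eq N (exp 1)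
    have hvy : v (y : L) = exp (Nat.card N : ℤ) := by
      rw [← h.fixedValuation_pow, hy, ← exp_nsmul]
      simp
    have h1 := (h.subgroup (toQuotientGroup L N).ker).dvd_of_fixed y (ne_zero_of_val_eq_exp hvy) (by
      rintro ⟨g, hg⟩
      have := coe_toQuotientGroup_smul N g y
      rw [MonoidHom.mem_ker.1 hg, one_smul] at this
      exact this.symm)
    rw [hvy, log_exp] at h1
    exact Nat.le_of_dvd Nat.card_pos (Int.natCast_dvd_natCast.1 h1)

lemma card_quotientGroup (h : IsTotallyRamified v P) :
    Nat.card N * Nat.card (quotientGroup L N) = Nat.card P := by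
  have h1 := Subgroup.index_ker (toQuotientGroup L N)
  rw [h.ker_toQuotientGroup N, MonoidHom.range_eq_top.2 (MonoidHom.rangeRestrict_surjective _),
    Subgroup.card_top] at h1
  rw [← h1, Subgroup.card_mul_index]

/-- The quotient by a normal subgroup acts in a totally ramified way on the fixed field. -/
lemma quotient (h : IsTotallyRamified v P) :
    IsTotallyRamified (h.fixedValuation N) (quotientGroup L N) where
  surjective := h.exists_fixedValuation_eq N
  map_smul g x := by
    obtain ⟨g, rfl⟩ := MonoidHom.rangeRestrict_surjective _ g
    refine h.fixedValuation_eq_of_pow N ?_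
    rw [h.fixedValuation_pow]
    exact h.map_smul g x
  dvd_of_fixed a ha hfix := by
    have ha' : (a : L) ≠ 0 := by simpa using ha
    have h1 := h.dvd_of_fixed a ha' fun g => by
      rw [← coe_toQuotientGroup_smul, hfix]
    rw [← h.fixedValuation_pow, log_pow, ← h.card_quotientGroup N, nsmul_eq_mul, Nat.cast_mul] at h1
    exact Int.dvd_of_mul_dvd_mul_left (by exact_mod_cast (Nat.card_pos (α := N)).ne') h1

variable [FaithfulSMul P L]

/-- Transitivity of the function `i(s) = v(s π - π)` in the tower given by a normal subgroup `N`,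
in product form. Both sides are compared through the minimal polynomial `F` of `π` over the fixed
field of `N`: the coefficients of `s F - F` are multiples of `s ϖ - ϖ`, and conversely `F` divides
`g - ϖ` if `ϖ = g(π)` with `g` having invariant coefficients. -/
lemma prod_val_smul_sub [Fintype N] (h : IsTotallyRamified v P) (hπ : v π = exp (-1))
    {ϖ : FixedPoints.subfield N L} (hϖ : h.fixedValuation N ϖ = exp (-1)) (s : P) :
    ∏ n : N, v ((s * n) • π - π) = v (s • (ϖ : L) - ϖ) := by
  classical
  set B := v.integer
  let f : B →+* L := (MulSemiringAction.toRingHom P L s).comp B.subtype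
  have hf : ∀ b : B, f b = s • (b : L) := fun b => rfl
  have hπ1 : v π ≤ 1 := by
    rw [hπ, ← exp_zero, exp_le_exp]; omega
  let r : N → B := fun n => ⟨n • π, by
    rw [Valuation.mem_integer_iff, (h.subgroup N).map_smul]; exact hπ1⟩
  let F : Polynomial B := ∏ n : N, (Polynomial.X - Polynomial.C (r n))
  have hFs : F.eval₂ f π = ∏ n : N, (π - (s * n) • π) := by
    simp only [F, Polynomial.eval₂_finsetProd, Polynomial.eval₂_sub, Polynomial.eval₂_X,
      Polynomial.eval₂_C, hf, r]
    exact Finset.prod_congr rfl fun n _ => by rw [mul_smul]; rfl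
  have hF0 : F.eval₂ B.subtype π = 0 := by
    simp only [F, Polynomial.eval₂_finsetProd, Polynomial.eval₂_sub, Polynomial.eval₂_X,
      Polynomial.eval₂_C]
    refine Finset.prod_eq_zero (Finset.mem_univ 1) ?_
    simp [r]
  have hlhs : ∏ n : N, v ((s * n) • π - π) = v (F.eval₂ f π) := by
    rw [hFs, map_prod]
    exact Finset.prod_congr rfl fun n _ => Valuation.map_sub_swap _ _ _
  have hint : ∀ Q : Polynomial B, v (Q.eval₂ f π) ≤ 1 := by
    intro Q
    rw [Polynomial.eval₂_eq_sum_range]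
    refine v.map_sum_le fun i _ => ?_
    rw [map_mul, map_pow, hf, h.map_smul]
    exact mul_le_one' (Q.coeff i).2 (pow_le_one' hπ1 i)
  have hvϖ : v (ϖ : L) ≤ 1 := by
    rw [← h.fixedValuation_pow, hϖ]
    refine pow_le_one' ?_ _
    rw [← exp_zero, exp_le_exp]; omega
  rw [hlhs]
  apply le_antisymm
  · have hcoeff : ∀ i, ∀ n : N, n • (F.coeff i : L) = F.coeff i := by
      intro i n
      have hmap : (F.map B.subtype).map (MulSemiringAction.toRingHom N L n) = F.map B.subtype := by
        simp only [F, Polynomial.map_prod, Polynomial.map_sub, Polynomial.map_X, Polynomial.map_C]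
        refine Fintype.prod_bijective (n * ·) (Group.mulLeft_bijective n) _ _ fun m => ?_
        simp [r, mul_smul]
      have := congrArg (fun Q => Polynomial.coeff Q i) hmap
      simpa using this
    have hsub : F.eval₂ f π = ∑ i ∈ Finset.range (F.natDegree + 1),
        (s • (F.coeff i : L) - F.coeff i) * π ^ i := by
      rw [← sub_zero (F.eval₂ f π), ← hF0, Polynomial.eval₂_eq_sum_range,
        Polynomial.eval₂_eq_sum_range, ← Finset.sum_sub_distrib]
      refine Finset.sum_congr rfl fun i _ => ?_
      rw [hf, sub_mul]
      rfl
    rw [hsub]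
    refine v.map_sum_le fun i _ => ?_
    rw [map_mul, map_pow]
    refine (mul_le_of_le_one_right' (pow_le_one' hπ1 i)).trans ?_
    let c : FixedPoints.subfield N L := ⟨F.coeff i, hcoeff i⟩
    have hc : h.fixedValuation N c ≤ 1 := by
      rw [← map_one (h.fixedValuation N), h.fixedValuation_le_iff]
      rw [OneMemClass.coe_one, map_one]
      exact (F.coeff i).2
    have := (h.quotient N).val_smul_sub_le_of_integral hϖ (toQuotientGroup L N s) hc
    rw [h.fixedValuation_le_iff] at this
    exact this
  · obtain ⟨a, ha, hϖa, hle⟩ := h.exists_expansion_of_integral hπ hvϖ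
    let a' : ℕ → B := fun i => if hi : i < Nat.card P then ⟨a i, hle i hi⟩ else 0
    have ha' : ∀ i ∈ Finset.range (Nat.card P), (a' i : L) = a i := by
      intro i hi
      simp only [a', dif_pos (Finset.mem_range.1 hi)]
    let Q : Polynomial B := ∑ i ∈ Finset.range (Nat.card P), Polynomial.C (a' i) * Polynomial.X ^ i
      - Polynomial.C ⟨ϖ, hvϖ⟩
    have hdvd : F ∣ Q := by
      rcases eq_or_ne Q 0 with hQ | hQ
      · rw [hQ]; exact dvd_zero _
      have hF : F = ((Finset.univ.val.map r).map fun x => Polynomial.X - Polynomial.C x).prod := by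
        rw [Multiset.map_map]; rfl
      have hr : Function.Injective r := by
        intro n m hnm
        have h1 : (n : P) • π = (m : P) • π := congrArg Subtype.val hnm
        have h2 : ((m : P)⁻¹ * n) • π / π - 1 = 0 := by
          rw [mul_smul, h1, inv_smul_smul, div_self (ne_zero_of_val_eq_exp hπ), sub_self]
        have h3 := (h.smul_div_sub_one_eq_zero_iff hπ).1 h2
        exact Subtype.ext (inv_mul_eq_one.1 h3).symm
      rw [hF, Multiset.prod_X_sub_C_dvd_iff_le_roots hQ,
        Multiset.le_iff_subset (Finset.univ.nodup.map hr)]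
      intro x hx
      obtain ⟨n, -, rfl⟩ := Multiset.mem_map.1 hx
      rw [Polynomial.mem_roots hQ, Polynomial.IsRoot]
      have h1 : n • (ϖ : L) = ϖ := ϖ.2 n
      have h2 : B.subtype (Q.eval (r n)) = 0 := by
        rw [← Polynomial.eval₂_at_apply]
        simp only [Q, Polynomial.eval₂_sub, Polynomial.eval₂_finsetSum, Polynomial.eval₂_mul,
          Polynomial.eval₂_C, Polynomial.eval₂_X_pow, Subring.subtype_apply]
        rw [sub_eq_zero]
        conv_rhs => rw [← h1, hϖa, Finset.smul_sum]
        refine Finset.sum_congr rfl fun i hi => ?_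
        rw [ha' i hi, smul_mul', smul_pow', Subgroup.smul_def, Subgroup.smul_def, ha]
        rfl
      exact Subtype.ext h2
    obtain ⟨R, hR⟩ := hdvd
    have hQs : Q.eval₂ f π = ϖ - s • (ϖ : L) := by
      simp only [Q, Polynomial.eval₂_sub, Polynomial.eval₂_finsetSum, Polynomial.eval₂_mul,
        Polynomial.eval₂_C, Polynomial.eval₂_X_pow, hf]
      congr 1
      conv_rhs => rw [hϖa]
      exact Finset.sum_congr rfl fun i hi => by rw [ha' i hi, ha]
    rw [Valuation.map_sub_swap, ← hQs, hR, Polynomial.eval₂_mul, map_mul]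
    exact mul_le_of_le_one_right' (hint R)

/-- The jump of a nontrivial class modulo `N` is the mean of the jumps of its elements. -/
theorem sum_jump_coset [Fintype N] (h : IsTotallyRamified v P) (hπ : v π = exp (-1))
    {ϖ : FixedPoints.subfield N L} (hϖ : h.fixedValuation N ϖ = exp (-1)) {s : P} (hs : s ∉ N) :
    ∑ n : N, jump v π (s * n) =
      Nat.card N * jump (h.fixedValuation N) ϖ (toQuotientGroup L N s) := by
  have h1 := h.prod_val_smul_sub N hπ hϖ s
  have hs' : toQuotientGroup L N s ≠ 1 := by
    rw [Ne, ← MonoidHom.mem_ker, h.ker_toQuotientGroup N]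
    exact hs
  have h2 : v (s • (ϖ : L) - ϖ) = exp (-(jump (h.fixedValuation N) ϖ (toQuotientGroup L N s) + 1))
      ^ Nat.card N := by
    rw [← (h.quotient N).val_smul_sub hϖ hs', h.fixedValuation_pow]
    rfl
  have h3 : ∀ n : N, v ((s * n) • π - π) = exp (-(jump v π (s * n) + 1)) := by
    intro n
    refine h.val_smul_sub hπ ?_
    intro h3
    exact hs (by rw [eq_inv_of_mul_eq_one_left h3]; exact inv_mem n.2)
  rw [h2, Finset.prod_congr rfl fun n _ => h3 n, prod_exp, ← exp_nsmul, exp_inj,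
    Finset.sum_neg_distrib, Finset.sum_add_distrib] at h1
  simp only [Finset.sum_const, Finset.card_univ, ← Nat.card_eq_fintype_card, nsmul_eq_mul] at h1
  linarith

omit N [N.Normal] in
/-- The Hasse–Arf theorem for a group of prime power order, as the integrality of the pairing of the
jump function with a character of degree one: the kernel of the character reduces this to the
cyclic group that is its image. -/
theorem exists_sum_jump_mul_one_sub_eq [Fintype P] (h : IsTotallyRamified v P)
    (hπ : v π = exp (-1)) {p : ℕ} [Fact p.Prime] (hP : IsPGroup p P) (χ : P →* ℂˣ) :
    ∃ c : ℤ, ∑ g : P, (jump v π g : ℂ) * (1 - χ g) = Nat.card P * c := by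
  classical
  obtain ⟨y, hy⟩ := IsCyclic.exists_generator (α := χ.range)
  obtain ⟨σ, hσ⟩ : ∃ σ, χ σ = y := y.2
  have hord : orderOf (χ σ) = Nat.card χ.range := by
    rw [← orderOf_eq_card_of_forall_mem_zpowers hy, hσ, Subgroup.orderOf_coe]
  have hindex : orderOf (χ σ) * Nat.card χ.ker = Nat.card P := by
    rw [hord, ← Subgroup.index_ker, mul_comm, Subgroup.card_mul_index]
  obtain ⟨k, hk⟩ : ∃ k, orderOf (χ σ) = p ^ k := by
    obtain ⟨m, hm⟩ := IsPGroup.iff_card.1 hP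
    obtain ⟨k, -, hk⟩ := (Nat.dvd_prime_pow Fact.out).1 (hm ▸ Dvd.intro _ hindex)
    exact ⟨k, hk⟩
  have hζ : IsPrimitiveRoot ((χ σ : ℂˣ) : ℂ) (orderOf (χ σ)) :=
    IsPrimitiveRoot.coe_units_iff.2 (IsPrimitiveRoot.orderOf _)
  set N := χ.ker
  -- every element of `P` is `σ ^ m * n` with unique `m < orderOf (χ σ)` and `n ∈ N`
  have hsum : ∀ F : P → ℂ, ∑ g, F g =
      ∑ m ∈ Finset.range (orderOf (χ σ)), ∑ n : N, F (σ ^ m * n) := by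
    intro F
    rw [Finset.sum_range, ← Fintype.sum_prod_type']
    refine (Fintype.sum_bijective
      (fun x : Fin (orderOf (χ σ)) × N => σ ^ (x.1 : ℕ) * (x.2 : P)) ?_ _ _ fun _ => rfl).symm
    rw [Fintype.bijective_iff_injective_and_card]
    refine ⟨?_, ?_⟩
    · rintro ⟨m, n⟩ ⟨m', n'⟩ hmn
      have h1 := congrArg χ hmn
      simp only [map_mul, map_pow, MonoidHom.mem_ker.1 n.2, MonoidHom.mem_ker.1 n'.2, mul_one] at h1
      have h2 : m = m' := Fin.ext ((IsPrimitiveRoot.orderOf (χ σ)).pow_inj m.2 m'.2 h1)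
      subst h2
      exact Prod.ext rfl (Subtype.ext (mul_left_cancel hmn))
    · rw [Fintype.card_prod, Fintype.card_fin, ← Nat.card_eq_fintype_card,
        ← Nat.card_eq_fintype_card, hindex]
  rcases k with _ | k
  · refine ⟨0, ?_⟩
    rw [pow_zero, orderOf_eq_one_iff] at hk
    rw [hsum]
    simp [hk, MonoidHom.mem_ker.1 (Subtype.prop _)]
  obtain ⟨ϖ, hϖ⟩ := h.exists_fixedValuation_eq N (exp (-1))
  have hord' : orderOf (toQuotientGroup L N σ) = p ^ (k + 1) := by
    rw [← hk]
    refine orderOf_eq_orderOf_iff.2 fun m => ?_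
    rw [← map_pow, ← map_pow, ← MonoidHom.mem_ker, h.ker_toQuotientGroup N, MonoidHom.mem_ker]
  rw [hk] at hζ
  obtain ⟨c, hc⟩ := (h.quotient N).exists_sum_jump_pow_eq hϖ Fact.out hord' hζ
  refine ⟨c, ?_⟩
  have hinner : ∀ m ∈ Finset.range (p ^ (k + 1)),
      ∑ n : N, (jump v π (σ ^ m * n) : ℂ) * (1 - χ (σ ^ m * n)) = Nat.card N *
        ((jump (h.fixedValuation N) ϖ (toQuotientGroup L N σ ^ m) : ℂ) * (1 - (χ σ : ℂ) ^ m)) := by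
    intro m hm
    have h1 : ∀ n : N, ((χ (σ ^ m * n) : ℂˣ) : ℂ) = (χ σ : ℂ) ^ m := by
      intro n
      rw [map_mul, MonoidHom.mem_ker.1 n.2, mul_one, map_pow, Units.val_pow_eq_pow_val]
    simp only [h1]
    rw [← Finset.sum_mul, ← mul_assoc]
    rcases Nat.eq_zero_or_pos m with rfl | hm0
    · simp
    congr 1
    rw [← map_pow, ← Int.cast_sum, h.sum_jump_coset N hπ hϖ]
    · push_cast
      rfl
    · rw [MonoidHom.mem_ker, map_pow]
      exact fun h2 => hm0.ne' (Nat.eq_zero_of_dvd_of_lt (orderOf_dvd_of_pow_eq_one h2)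
        (hk ▸ Finset.mem_range.1 hm))
  rw [hsum, hk, Finset.sum_congr rfl hinner, ← Finset.mul_sum, hc, ← hindex, hk]
  push_cast
  ring

end IsTotallyRamified

end Quotient

end ArtinSwan

namespace ArtinSwan

/-! ### Complex representations of finite groups -/

section Representations

open Module

variable {G : Type*} [Group G]

lemma trace_eq_add_of_isCompl {V : Type*} [AddCommGroup V] [Module ℂ V] [FiniteDimensional ℂ V]
    {W W' : Submodule ℂ V} (h : IsCompl W W') {f : V →ₗ[ℂ] V} (hW : ∀ x ∈ W, f x ∈ W)
    (hW' : ∀ x ∈ W', f x ∈ W') :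
    LinearMap.trace ℂ V f =
      LinearMap.trace ℂ W (f.restrict hW) + LinearMap.trace ℂ W' (f.restrict hW') := by
  rw [← LinearMap.trace_prodMap', ← LinearMap.trace_conj' _ (Submodule.prodEquivOfIsCompl W W' h)]
  congr 1
  refine LinearMap.ext fun x => ?_
  obtain ⟨⟨y, z⟩, rfl⟩ := (Submodule.prodEquivOfIsCompl W W' h).surjective x
  rw [LinearEquiv.conj_apply_apply, LinearEquiv.symm_apply_apply]
  simp

/-- To prove a property of all characters of a finite group it suffices, by complete reducibility,
to prove it for the characters of irreducible representations and for sums. -/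
theorem character_induction [Finite G] {motive : (G → ℂ) → Prop} (zero : motive 0)
    (add : ∀ φ ψ, motive φ → motive ψ → motive (φ + ψ))
    (irreducible : ∀ (V : Type) [AddCommGroup V] [Module ℂ V] [FiniteDimensional ℂ V]
      (ρ : Representation ℂ G V) [ρ.IsIrreducible], motive ρ.character)
    (V : Type) [AddCommGroup V] [Module ℂ V] [FiniteDimensional ℂ V] (ρ : Representation ℂ G V) :
    motive ρ.character := by
  obtain ⟨n, hn⟩ : ∃ n, finrank ℂ V = n := ⟨_, rfl⟩
  induction n using Nat.strong_induction_on generalizing V with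
  | _ n ih =>
  by_cases hirr : ρ.IsIrreducible
  · exact irreducible V ρ
  rcases subsingleton_or_nontrivial V with hV | hV
  · have : ρ.character = 0 := by
      funext g
      rw [Representation.character, Subsingleton.elim (ρ g) 0, map_zero, Pi.zero_apply]
    rwa [this]
  have : Nontrivial (Subrepresentation ρ) :=
    ⟨⊥, ⊤, fun h => bot_ne_top (α := Submodule ℂ V) (congrArg Subrepresentation.toSubmodule h)⟩
  obtain ⟨W, hW⟩ : ∃ W : Subrepresentation ρ, ¬ (W = ⊥ ∨ W = ⊤) := by
    by_contra hno
    push Not at hno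
    exact hirr ⟨hno⟩
  rw [not_or] at hW
  have : NeZero (Nat.card G : ℂ) := ⟨by exact_mod_cast (Nat.card_pos (α := G)).ne'⟩
  obtain ⟨W', hWW'⟩ := exists_isCompl W
  have hcompl : IsCompl W.toSubmodule W'.toSubmodule := by
    constructor
    · rw [disjoint_iff, ← Subrepresentation.toSubmodule_inf, hWW'.inf_eq_bot]; rfl
    · rw [codisjoint_iff, ← Subrepresentation.toSubmodule_sup, hWW'.sup_eq_top]; rfl
  have hchar : ρ.character = W.toRepresentation.character + W'.toRepresentation.character := by
    funext g
    exact trace_eq_add_of_isCompl hcompl (fun _ hx => W.apply_mem_toSubmodule g hx)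
      (fun _ hx => W'.apply_mem_toSubmodule g hx)
  have hW1 : W.toSubmodule ≠ ⊤ := fun h => hW.2 (Subrepresentation.toSubmodule_injective h)
  have hW2 : W'.toSubmodule ≠ ⊤ := by
    intro h
    have := hcompl.inf_eq_bot
    rw [h, inf_top_eq] at this
    exact hW.1 (Subrepresentation.toSubmodule_injective this)
  rw [hchar]
  exact add _ _
    (ih _ (hn ▸ Submodule.finrank_lt hW1) W.toSubmodule _ rfl)
    (ih _ (hn ▸ Submodule.finrank_lt hW2) W'.toSubmodule _ rfl)

lemma nontrivial_of_isIrreducible {V : Type*} [AddCommGroup V] [Module ℂ V]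
    (ρ : Representation ℂ G V) [hirr : ρ.IsIrreducible] : Nontrivial V := by
  by_contra h
  rw [not_nontrivial_iff_subsingleton] at h
  have : Subsingleton (Subrepresentation ρ) :=
    ⟨fun W W' => Subrepresentation.toSubmodule_injective (Subsingleton.elim _ _)⟩
  exact not_subsingleton (Subrepresentation ρ) this

/-- Schur's lemma. -/
lemma exists_eq_smul_one_of_commute {V : Type*} [AddCommGroup V] [Module ℂ V]
    [FiniteDimensional ℂ V] (ρ : Representation ℂ G V) [ρ.IsIrreducible] (T : End ℂ V)
    (hT : ∀ g, T * ρ g = ρ g * T) : ∃ c : ℂ, T = c • 1 := by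
  let f : Representation.IntertwiningMap ρ ρ := ⟨T, hT⟩
  obtain ⟨c, hc⟩ :=
    (Representation.IsIrreducible.algebraMap_intertwiningMap_bijective_of_isAlgClosed
      (ρ := ρ)).2 f
  refine ⟨c, ?_⟩
  rw [Algebra.algebraMap_eq_smul_one] at hc
  exact (congrArg Representation.IntertwiningMap.toLinearMap hc).symm

/-- If every `ρ g` is a scalar, then these scalars form a character of degree one. -/
lemma exists_monoidHom_of_smul {V : Type*} [AddCommGroup V] [Module ℂ V] [Nontrivial V]
    (ρ : Representation ℂ G V) (h : ∀ g, ∃ c : ℂ, ρ g = c • 1) :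
    ∃ χ : G →* ℂˣ, ∀ g, ρ g = (χ g : ℂ) • 1 := by
  choose l hl using h
  have hinj : Function.Injective fun c : ℂ => c • (1 : End ℂ V) := smul_left_injective ℂ one_ne_zero
  let l' : G →* ℂ :=
    { toFun := l
      map_one' := hinj (by simp only [← hl, map_one, one_smul])
      map_mul' := fun g g' => hinj (by
        simp only [← hl, map_mul]
        rw [hl g, hl g', smul_mul_smul_comm, mul_one]) }
  exact ⟨l'.toHomUnits, hl⟩

/-! ### Integrality over a group of prime power order -/

/-- The pairing `∑_g j(g) (χ(1) - χ(g))` of an integer valued function `j` on a finite group with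
`χ(1) - χ`. -/
def defectSum [Fintype G] (j : G → ℤ) (χ : G → ℂ) : ℂ := ∑ g, (j g : ℂ) * (χ 1 - χ g)

lemma defectSum_zero [Fintype G] (j : G → ℤ) : defectSum j 0 = 0 := by simp [defectSum]

lemma defectSum_add [Fintype G] (j : G → ℤ) (φ ψ : G → ℂ) :
    defectSum j (φ + ψ) = defectSum j φ + defectSum j ψ := by
  rw [defectSum, defectSum, defectSum, ← Finset.sum_add_distrib]
  refine Finset.sum_congr rfl fun g _ => ?_
  rw [Pi.add_apply, Pi.add_apply]
  ring

lemma defectSum_sum [Fintype G] {ι : Type*} (j : G → ℤ) (s : Finset ι) (φ : ι → G → ℂ) :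
    defectSum j (fun g => ∑ i ∈ s, φ i g) = ∑ i ∈ s, defectSum j (φ i) := by
  simp only [defectSum]
  rw [Finset.sum_comm]
  refine Finset.sum_congr rfl fun g _ => ?_
  rw [← Finset.mul_sum, Finset.sum_sub_distrib]

/-- The order of `ω` divides the sum over a finite set `S` stable under multiplication by `ω` of a
function that is invariant under multiplication by `ω`. -/
lemma orderOf_dvd_sum_of_mul_invariant {ω : ℂˣ} (hω : IsOfFinOrder ω) {S : Finset ℂ}
    (h0 : (0 : ℂ) ∉ S) (hS : ∀ κ ∈ S, (ω : ℂ) * κ ∈ S) {n : ℂ → ℤ} (hn : ∀ κ, n (ω * κ) = n κ) :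
    (orderOf ω : ℤ) ∣ ∑ κ ∈ S, n κ := by
  classical
  have hζ : IsPrimitiveRoot (ω : ℂ) (orderOf ω) :=
    IsPrimitiveRoot.coe_units_iff.2 (IsPrimitiveRoot.orderOf _)
  have hpos : 0 < orderOf ω := hω.orderOf_pos
  have hSpow : ∀ κ ∈ S, ∀ i : ℕ, (ω : ℂ) ^ i * κ ∈ S := by
    intro κ hκ i
    induction i with
    | zero => simpa using hκ
    | succ i ih => rw [pow_succ', mul_assoc]; exact hS _ ih
  have hnpow : ∀ κ, ∀ i : ℕ, n ((ω : ℂ) ^ i * κ) = n κ := by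
    intro κ i
    induction i with
    | zero => simp
    | succ i ih => rw [pow_succ', mul_assoc, hn, ih]
  rw [← Finset.sum_fiberwise_of_maps_to
    (fun κ hκ => Finset.mem_image_of_mem (fun κ => κ ^ orderOf ω) hκ)]
  refine Finset.dvd_sum fun c hc => ?_
  obtain ⟨κ, hκ, rfl⟩ := Finset.mem_image.1 hc
  have hκ0 : κ ≠ 0 := fun h => h0 (h ▸ hκ)
  have hfib : S.filter (fun x => x ^ orderOf ω = κ ^ orderOf ω) =
      (Finset.range (orderOf ω)).image (fun i => (ω : ℂ) ^ i * κ) := by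
    ext x
    rw [Finset.mem_filter, Finset.mem_image]
    constructor
    · rintro ⟨-, hx⟩
      have h1 : (x / κ) ^ orderOf ω = 1 := by
        rw [div_pow, hx, div_self (pow_ne_zero _ hκ0)]
      have := NeZero.of_pos hpos
      obtain ⟨i, hi, h2⟩ := hζ.eq_pow_of_pow_eq_one h1
      exact ⟨i, Finset.mem_range.2 hi, by rw [h2, div_mul_cancel₀ _ hκ0]⟩
    · rintro ⟨i, -, rfl⟩
      exact ⟨hSpow κ hκ i, by rw [mul_pow, ← pow_mul, mul_comm i, pow_mul, hζ.pow_eq_one, one_pow,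
        one_mul]⟩
  rw [hfib, Finset.sum_image]
  · simp only [hnpow]
    simp
  · intro i hi i' hi' h
    exact hζ.pow_inj (Finset.mem_range.1 hi) (Finset.mem_range.1 hi') (mul_right_cancel₀ hκ0 h)

/-- The property of a function `j` on `G` that its pairings with the characters of degree one of all
subgroups `H` of `G` are divisible by `|H|`. -/
def LinearCharactersIntegral (j : G → ℤ) : Prop :=
  ∀ (H : Subgroup G) [Fintype H] (χ : H →* ℂˣ),
    ∃ c : ℤ, ∑ h : H, (j h : ℂ) * (1 - χ h) = Nat.card H * c

lemma LinearCharactersIntegral.subgroup {j : G → ℤ} (hj : LinearCharactersIntegral j)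
    (H : Subgroup G) : LinearCharactersIntegral (fun h : H => j h) := by
  intro K _ χ
  let e := K.equivMapOfInjective H.subtype H.subtype_injective
  have := Fintype.ofEquiv K e.toEquiv
  obtain ⟨c, hc⟩ := hj (K.map H.subtype) (χ.comp e.symm.toMonoidHom)
  refine ⟨c, ?_⟩
  rw [Nat.card_congr e.toEquiv, ← hc]
  exact Fintype.sum_equiv e.toEquiv _ _ fun k => by simp [e]

lemma LinearCharactersIntegral.top [Fintype G] {j : G → ℤ} (hj : LinearCharactersIntegral j)
    (χ : G →* ℂˣ) : ∃ c : ℤ, ∑ g, (j g : ℂ) * (1 - χ g) = Nat.card G * c := by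
  have := Fintype.ofFinite (⊤ : Subgroup G)
  obtain ⟨c, hc⟩ := hj ⊤ (χ.comp (⊤ : Subgroup G).subtype)
  refine ⟨c, ?_⟩
  rw [← Subgroup.card_top (G := G), ← hc]
  exact (Fintype.sum_equiv Subgroup.topEquiv.toEquiv _ _ fun k => rfl).symm

/-- Summing over the powers of a character `χ` of degree one gives the divisibility of the sum of
`j` over the complement of the kernel. -/
lemma LinearCharactersIntegral.card_ker_dvd_sum [Fintype G] {j : G → ℤ}
    (hj : LinearCharactersIntegral j) (χ : G →* ℂˣ) [DecidablePred (· ∈ χ.ker)] :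
    (Nat.card χ.ker : ℤ) ∣ ∑ g with g ∉ χ.ker, j g := by
  set r := Nat.card χ.range with hr
  have hr0 : 0 < r := Nat.card_pos
  have hpow : ∀ g, χ g ^ r = 1 := fun g =>
    orderOf_dvd_iff_pow_eq_one.1 (Subgroup.orderOf_dvd_natCard _ ⟨g, rfl⟩)
  have hcard : r * Nat.card χ.ker = Nat.card G := by
    rw [hr, ← Subgroup.index_ker, mul_comm, Subgroup.card_mul_index]
  choose c hc using fun k : ℕ => hj.top (χ ^ k)
  have hgeom : ∀ g, ∑ k ∈ Finset.range r, ((1 : ℂ) - (χ ^ k) g) =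
      if g ∉ χ.ker then (r : ℂ) else 0 := by
    intro g
    rw [Finset.sum_sub_distrib]
    simp only [MonoidHom.pow_apply, Units.val_pow_eq_pow_val, Finset.sum_const, Finset.card_range,
      nsmul_eq_mul, mul_one]
    by_cases hg : g ∈ χ.ker
    · rw [if_neg (not_not.2 hg)]
      simp [MonoidHom.mem_ker.1 hg]
    · rw [if_pos hg]
      have h1 : ((χ g : ℂˣ) : ℂ) ≠ 1 := by
        rw [Ne, Units.val_eq_one]
        exact hg
      have h2 : ((χ g : ℂˣ) : ℂ) ^ r = 1 := by
        rw [← Units.val_pow_eq_pow_val, hpow, Units.val_one]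
      rw [geom_sum_eq h1, h2, sub_self, zero_div, sub_zero]
  have hsum : (r : ℂ) * ∑ g with g ∉ χ.ker, (j g : ℂ) =
      r * (Nat.card χ.ker * ∑ k ∈ Finset.range r, (c k : ℂ)) := by
    rw [← mul_assoc, ← Nat.cast_mul, hcard, Finset.mul_sum (Finset.range r),
      ← Finset.sum_congr rfl fun k _ => hc k, Finset.sum_comm, Finset.sum_filter, Finset.mul_sum]
    refine Finset.sum_congr rfl fun g _ => ?_
    rw [← Finset.mul_sum, hgeom]
    split_ifs <;> simp [mul_comm]
  have h1 := mul_left_cancel₀ (by exact_mod_cast hr0.ne' : (r : ℂ) ≠ 0) hsum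
  exact ⟨∑ k ∈ Finset.range r, c k, by exact_mod_cast h1⟩

/-- If `ρ a` commutes with `ρ g` up to the scalar `χ g`, then `χ g ≠ 1` forces the trace of `ρ g` to
vanish. -/
lemma character_eq_zero_of_mul_eq_smul {V : Type*} [AddCommGroup V] [Module ℂ V]
    (ρ : Representation ℂ G V) {a g : G} {c : ℂ} (hc : c ≠ 1) (h : ρ a * ρ g = c • (ρ g * ρ a)) :
    ρ.character g = 0 := by
  have h1 : ρ.character (a * g * a⁻¹) = c * ρ.character g := by
    rw [Representation.character, map_mul ρ, map_mul ρ, h, smul_mul_assoc, mul_assoc, ← map_mul ρ a,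
      mul_inv_cancel, map_one, mul_one, map_smul, smul_eq_mul, Representation.character]
  rw [Representation.char_mul_comm, inv_mul_cancel_left] at h1
  have h2 : (1 - c) * ρ.character g = 0 := by rw [sub_mul, one_mul, ← h1, sub_self]
  exact (mul_eq_zero.1 h2).resolve_left (sub_ne_zero.2 hc.symm)

/-- The representation of a subgroup commuting with `ρ a` on a generalized eigenspace of `ρ a`. -/
def eigenRepresentation {V : Type*} [AddCommGroup V] [Module ℂ V] (ρ : Representation ℂ G V) (a : G)
    (H : Subgroup G) (hH : ∀ h ∈ H, Commute (ρ a) (ρ h)) (κ : ℂ) :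
    Representation ℂ H (End.maxGenEigenspace (ρ a) κ) where
  toFun h := (ρ h).restrict (End.mapsTo_maxGenEigenspace_of_comm (hH h h.2) κ)
  map_one' := by ext; simp
  map_mul' g h := by ext; simp; rfl

lemma isInternal_maxGenEigenspace {V : Type*} [AddCommGroup V] [Module ℂ V] [FiniteDimensional ℂ V]
    (f : End ℂ V) : DirectSum.IsInternal fun κ => f.maxGenEigenspace κ :=
  (DirectSum.isInternal_submodule_iff_iSupIndep_and_iSup_eq_top _).2
    ⟨f.independent_maxGenEigenspace, End.iSup_maxGenEigenspace_eq_top f⟩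

lemma maxGenEigenspace_zero_of_isUnit {V : Type*} [AddCommGroup V] [Module ℂ V] {f : End ℂ V}
    (hf : IsUnit f) : f.maxGenEigenspace 0 = ⊥ := by
  rw [eq_bot_iff]
  intro x hx
  obtain ⟨k, hk⟩ := (End.mem_maxGenEigenspace _ _ _).1 hx
  rw [zero_smul, sub_zero] at hk
  obtain ⟨u, hu⟩ := (hf.pow k)
  have h1 : (↑u⁻¹ * (u : End ℂ V)) x = 0 := by rw [hu, Module.End.mul_apply, hk, map_zero]
  rwa [Units.inv_mul] at h1

/-- If `f e = c e f`, then `e` maps the generalized eigenspace of `f` for `κ` to that for `c κ`. -/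
lemma map_maxGenEigenspace_of_mul_eq_smul {V : Type*} [AddCommGroup V] [Module ℂ V] {f e : End ℂ V}
    {c : ℂ} (h : f * e = c • (e * f)) (κ : ℂ) {x : V} (hx : x ∈ f.maxGenEigenspace κ) :
    e x ∈ f.maxGenEigenspace (c * κ) := by
  obtain ⟨k, hk⟩ := (End.mem_maxGenEigenspace _ _ _).1 hx
  refine (End.mem_maxGenEigenspace _ _ _).2 ⟨k, ?_⟩
  have h1 : SemiconjBy e (c • (f - κ • (1 : End ℂ V))) (f - (c * κ) • 1) := by
    rw [SemiconjBy, sub_mul, h, smul_mul_assoc, one_mul, mul_smul_comm, mul_sub, mul_smul_comm,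
      mul_one, smul_sub, smul_smul]
  have h2 := (h1.pow_right k).eq
  rw [smul_pow] at h2
  have h3 := LinearMap.congr_fun h2 x
  rw [Module.End.mul_apply, LinearMap.smul_apply, hk, smul_zero, map_zero] at h3
  exact h3.symm

universe u in
/-- Over a group of prime power order, integrality of the pairing with characters of degree one
implies integrality of the pairing with all characters. If an irreducible representation `ρ` is not
scalar, there is a nonscalar `ρ a` commuting with all `ρ g` up to scalars `χ g`. The character of
`ρ` then vanishes outside the kernel `H` of `χ`, and `ρ` restricted to `H` splits into the
eigenspaces of `ρ a`, which are permuted freely by the group generated by the values of `χ`. -/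
theorem exists_defectSum_eq_of_isPGroup {p : ℕ} [Fact p.Prime] (n : ℕ) : ∀ (G : Type u) [Group G]
    [Fintype G] (_ : Nat.card G = n) (_ : IsPGroup p G) {j : G → ℤ}
    (_ : ∀ c g, j (c * g * c⁻¹) = j g) (_ : LinearCharactersIntegral j) (V : Type)
    [AddCommGroup V] [Module ℂ V] [FiniteDimensional ℂ V] (ρ : Representation ℂ G V),
    ∃ c : ℤ, defectSum j ρ.character = Nat.card G * c := by
  classical
  induction n using Nat.strong_induction_on with
  | _ n ih =>
  intro G _ _ hn hG j hconj hj
  refine character_induction (motive := fun φ => ∃ c : ℤ, defectSum j φ = Nat.card G * c)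
    ⟨0, by simp [defectSum_zero]⟩ ?_ ?_
  · rintro φ ψ ⟨c, hc⟩ ⟨d, hd⟩
    exact ⟨c + d, by rw [defectSum_add, hc, hd]; push_cast; ring⟩
  intro V _ _ _ ρ hirr
  have hV := nontrivial_of_isIrreducible ρ
  have hunit : ∀ g, ρ g ≠ 0 := by
    intro g h
    have h1 : ρ g * ρ g⁻¹ = 1 := by rw [← map_mul, mul_inv_cancel, map_one]
    rw [h, zero_mul] at h1
    exact zero_ne_one h1
  -- the elements acting by scalars
  let Z : Subgroup G := {
    carrier := {g | ∃ c : ℂ, ρ g = c • 1}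
    one_mem' := ⟨1, by rw [map_one, one_smul]⟩
    mul_mem' := by
      rintro g g' ⟨c, hc⟩ ⟨d, hd⟩
      exact ⟨c * d, by rw [map_mul, hc, hd, smul_mul_smul_comm, mul_one]⟩
    inv_mem' := by
      rintro g ⟨c, hc⟩
      have h1 : ρ g * ρ g⁻¹ = 1 := by rw [← map_mul, mul_inv_cancel, map_one]
      rw [hc, smul_mul_assoc, one_mul] at h1
      have hc0 : c ≠ 0 := by
        rintro rfl
        rw [zero_smul] at h1
        exact zero_ne_one h1
      exact ⟨c⁻¹, by rw [← h1, smul_smul, inv_mul_cancel₀ hc0, one_smul]⟩ }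
  have hZn : Z.Normal := ⟨by
    rintro g ⟨c, hc⟩ x
    refine ⟨c, ?_⟩
    rw [map_mul, map_mul, hc, mul_smul_comm, mul_one, smul_mul_assoc, ← map_mul, mul_inv_cancel,
      map_one]⟩
  by_cases hZ : Z = ⊤
  · obtain ⟨χ, hχ⟩ := exists_monoidHom_of_smul ρ fun g => (hZ ▸ Subgroup.mem_top g : g ∈ Z)
    obtain ⟨c, hc⟩ := hj.top χ
    refine ⟨finrank ℂ V * c, ?_⟩
    have hchar : ∀ g, ρ.character g = finrank ℂ V * (χ g : ℂ) := by
      intro g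
      rw [Representation.character, hχ, map_smul, LinearMap.trace_one, smul_eq_mul, mul_comm]
    simp only [defectSum, hchar, map_one, Units.val_one, mul_one]
    push_cast
    rw [mul_left_comm, ← hc, Finset.mul_sum]
    exact Finset.sum_congr rfl fun g _ => by ring
  have hnt : Nontrivial (G ⧸ Z) := QuotientGroup.nontrivial_iff.2 hZ
  have := (hG.to_quotient Z).center_nontrivial
  -- a representative `a` of a nontrivial central element of `G ⧸ Z`
  obtain ⟨⟨q, hq⟩, hq1⟩ := exists_ne (1 : Subgroup.center (G ⧸ Z))
  obtain ⟨a, rfl⟩ := QuotientGroup.mk_surjective q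
  have haZ : a ∉ Z := by
    intro h
    exact hq1 (Subtype.ext ((QuotientGroup.eq_one_iff a).2 h))
  have hcomm : ∀ g, ∃ c : ℂ, ρ a * ρ g = c • (ρ g * ρ a) := by
    intro g
    have h1 := Subgroup.mem_center_iff.1 hq (g : G ⧸ Z)
    rw [← QuotientGroup.mk_mul, ← QuotientGroup.mk_mul, QuotientGroup.eq] at h1
    obtain ⟨c, hc⟩ := h1
    refine ⟨c, ?_⟩
    have h2 : a * g = g * a * ((g * a)⁻¹ * (a * g)) := by group
    rw [← map_mul, h2, map_mul, hc, mul_smul_comm, mul_one, map_mul]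
  choose l hl using hcomm
  have hga : ∀ g, ρ g * ρ a ≠ 0 := fun g => by rw [← map_mul]; exact hunit _
  let l' : G →* ℂ :=
    { toFun := l
      map_one' := by
        have h1 := hl 1
        rw [map_one, mul_one, one_mul] at h1
        exact (smul_left_injective ℂ (hunit a) (by simpa using h1)).symm
      map_mul' := fun g g' => by
        have h1 := hl (g * g')
        refine (smul_left_injective ℂ (hga (g * g')) ?_)
        simp only
        rw [← h1, map_mul, ← mul_assoc, hl g, smul_mul_assoc, mul_assoc, hl g', mul_smul_comm,
          smul_smul, mul_assoc] }
  set χ : G →* ℂˣ := l'.toHomUnits with hχdef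
  have hχ : ∀ g, ρ a * ρ g = (χ g : ℂ) • (ρ g * ρ a) := hl
  set H := χ.ker with hH
  have hHcomm : ∀ h ∈ H, Commute (ρ a) (ρ h) := by
    intro h hh
    have h1 := hχ h
    rw [MonoidHom.mem_ker.1 hh, Units.val_one, one_smul] at h1
    exact h1
  have hHlt : Nat.card H < n := by
    rw [← hn]
    refine lt_of_le_of_ne (Subgroup.card_le_card_group H) fun h => haZ ?_
    have h1 := Subgroup.eq_top_of_card_eq H h
    exact exists_eq_smul_one_of_commute ρ (ρ a) fun g => (hHcomm g (h1 ▸ Subgroup.mem_top g)).eq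
  -- a generator `ω = χ s` of the image of `χ`
  obtain ⟨y, hy⟩ := IsCyclic.exists_generator (α := χ.range)
  obtain ⟨s, hs⟩ : ∃ s, χ s = y := y.2
  have hord : orderOf (χ s) = Nat.card χ.range := by
    rw [← orderOf_eq_card_of_forall_mem_zpowers hy, hs, Subgroup.orderOf_coe]
  have hindex : Nat.card H * orderOf (χ s) = Nat.card G := by
    rw [hord, ← Subgroup.index_ker, Subgroup.card_mul_index]
  have hfin : IsOfFinOrder (χ s) := χ.isOfFinOrder (isOfFinOrder_of_finite s)
  -- the eigenspaces of `ρ a` and the action of `s` on them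
  set E : ℂ → Submodule ℂ V := fun κ => End.maxGenEigenspace (ρ a) κ with hE
  have hint : DirectSum.IsInternal E := isInternal_maxGenEigenspace (ρ a)
  have hEfin : {κ | E κ ≠ ⊥}.Finite := WellFoundedGT.finite_ne_bot_of_iSupIndep
    hint.submodule_iSupIndep
  have hmap : ∀ g κ, (E κ).map (ρ g) = E ((χ g : ℂ) * κ) := by
    have hle : ∀ g κ, (E κ).map (ρ g) ≤ E ((χ g : ℂ) * κ) := by
      intro g κ
      rintro _ ⟨x, hx, rfl⟩
      exact map_maxGenEigenspace_of_mul_eq_smul (hχ g) κ hx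
    intro g κ
    refine le_antisymm (hle g κ) fun x hx => ?_
    have h1 := hle g⁻¹ _ ⟨x, hx, rfl⟩
    rw [map_inv, ← mul_assoc, ← Units.val_mul, inv_mul_cancel, Units.val_one, one_mul] at h1
    refine ⟨_, h1, ?_⟩
    change (ρ g * ρ g⁻¹) x = x
    rw [← map_mul, mul_inv_cancel, map_one]
    rfl
  let e (κ : ℂ) : E κ ≃ₗ[ℂ] E ((χ s : ℂ) * κ) :=
    ((LinearMap.GeneralLinearGroup.generalLinearEquiv ℂ V (ρ.asGroupHom s)).submoduleMap
      (E κ)).trans (LinearEquiv.ofEq _ _ (hmap s κ))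
  have he : ∀ κ (x : E κ), (e κ x : V) = ρ s x := fun κ x => rfl
  let S : Finset ℂ := hEfin.toFinset
  have hS0 : (0 : ℂ) ∉ S := by
    rw [Set.Finite.mem_toFinset, Set.mem_ofPred_eq, not_not]
    exact maxGenEigenspace_zero_of_isUnit ((Group.isUnit a).map ρ)
  have hSs : ∀ κ ∈ S, (χ s : ℂ) * κ ∈ S := by
    intro κ hκ
    rw [Set.Finite.mem_toFinset, Set.mem_ofPred_eq] at hκ ⊢
    intro h0
    refine hκ ?_
    refine Submodule.map_injective_of_injective (f := ρ s) ?_ (((hmap s κ).trans h0).trans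
      (Submodule.map_bot _).symm)
    refine Function.LeftInverse.injective (g := ρ s⁻¹) fun x => ?_
    change (ρ s⁻¹ * ρ s) x = x
    rw [← map_mul, inv_mul_cancel, map_one]
    rfl
  let τ (κ : ℂ) : Representation ℂ H (E κ) := eigenRepresentation ρ a H hHcomm κ
  have hτ : ∀ h : H, ρ.character h = ∑ κ ∈ S, (τ κ).character h := fun h =>
    LinearMap.trace_eq_sum_trace_restrict' hint hEfin
      (fun κ => End.mapsTo_maxGenEigenspace_of_comm (hHcomm h h.2) κ)
  have hτs : ∀ κ (h : H), (τ ((χ s : ℂ) * κ)).character ⟨s * h * s⁻¹,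
      (MonoidHom.normal_ker χ).conj_mem h h.2 s⟩ = (τ κ).character h := by
    intro κ h
    rw [Representation.character, Representation.character, ← LinearMap.trace_conj' _ (e κ)]
    congr 1
    refine LinearMap.ext fun x => Subtype.ext ?_
    obtain ⟨y, rfl⟩ := (e κ).surjective x
    rw [LinearEquiv.conj_apply_apply, LinearEquiv.symm_apply_apply, he]
    change ρ (s * h * s⁻¹) (e κ y) = ρ s (ρ h y)
    rw [he]
    change (ρ (s * h * s⁻¹) * ρ s) _ = (ρ s * ρ h) _
    rw [← map_mul, inv_mul_cancel_right, map_mul]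
  -- integrality over `H`
  have hih : ∀ κ, ∃ c : ℤ, defectSum (fun h : H => j h) (τ κ).character = Nat.card H * c := fun κ =>
    ih _ hHlt H rfl (hG.to_subgroup H) (fun c g => hconj c g) (hj.subgroup H) (E κ) (τ κ)
  choose m hm using hih
  have hms : ∀ κ, m ((χ s : ℂ) * κ) = m κ := by
    intro κ
    have h1 : defectSum (fun h : H => j h) (τ ((χ s : ℂ) * κ)).character =
        defectSum (fun h : H => j h) (τ κ).character := by
      refine (Fintype.sum_bijective (fun h : H => (⟨s * h * s⁻¹,
        (MonoidHom.normal_ker χ).conj_mem h h.2 s⟩ : H)) ?_ _ _ ?_).symm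
      · refine Finite.injective_iff_bijective.1 fun h h' hh' => Subtype.ext ?_
        simpa using congrArg Subtype.val hh'
      · intro h
        simp only [hconj]
        rw [hτs, Representation.char_one, Representation.char_one, (e κ).finrank_eq]
    rw [hm, hm] at h1
    exact_mod_cast mul_left_cancel₀ (by exact_mod_cast (Nat.card_pos (α := H)).ne') h1
  obtain ⟨M, hM⟩ := orderOf_dvd_sum_of_mul_invariant hfin hS0 hSs hms
  obtain ⟨d, hd⟩ := orderOf_dvd_sum_of_mul_invariant hfin hS0 hSs
    (n := fun κ => finrank ℂ (E κ)) (fun κ => by rw [(e κ).finrank_eq])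
  obtain ⟨c, hc⟩ := hj.card_ker_dvd_sum χ
  have hdim : ρ.character 1 = orderOf (χ s) * d := by
    have h1 := hτ 1
    simp only [Representation.char_one] at h1
    rw [← Int.cast_natCast (orderOf (χ s)), ← Int.cast_mul, ← hd]
    push_cast
    exact h1
  have hinside : ∑ g with g ∈ H, (j g : ℂ) * (ρ.character 1 - ρ.character g) =
      Nat.card H * (orderOf (χ s) * M) := by
    have h1 : ∑ g with g ∈ H, (j g : ℂ) * (ρ.character 1 - ρ.character g) =
        defectSum (fun h : H => j h) (fun h => ∑ κ ∈ S, (τ κ).character h) := by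
      rw [defectSum, ← Finset.sum_subtype_eq_sum_filter, Finset.subtype_univ]
      refine Finset.sum_congr rfl fun h _ => ?_
      rw [← hτ, ← hτ]
      rfl
    rw [h1, defectSum_sum, Finset.sum_congr rfl fun κ _ => hm κ, ← Finset.mul_sum,
      ← Int.cast_sum, hM]
    push_cast
    ring
  have houtside : ∑ g with g ∉ H, (j g : ℂ) * (ρ.character 1 - ρ.character g) =
      Nat.card H * c * (orderOf (χ s) * d) := by
    have h1 : ∀ g ∈ Finset.univ.filter (fun g => g ∉ H),
        (j g : ℂ) * (ρ.character 1 - ρ.character g) = j g * (orderOf (χ s) * d) := by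
      intro g hg
      have hg' : χ g ≠ 1 := (Finset.mem_filter.1 hg).2
      rw [character_eq_zero_of_mul_eq_smul ρ (fun h => hg' (Units.ext h)) (hχ g), sub_zero, hdim]
    rw [Finset.sum_congr rfl h1, ← Finset.sum_mul, ← Int.cast_sum, hc]
    push_cast
    ring
  refine ⟨M + c * d, ?_⟩
  rw [defectSum, ← Finset.sum_filter_add_sum_filter_not Finset.univ (fun g => g ∈ H), hinside,
    houtside, ← hindex]
  push_cast
  ring

end Representations

end ArtinSwan

namespace ArtinSwan

/-! ### Integrality over a totally ramified group -/

section Representations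

open Module

variable {G : Type*} [Group G]

/-- The values of characters of finite groups are algebraic integers. -/
lemma isIntegral_character [Finite G] {V : Type*} [AddCommGroup V] [Module ℂ V]
    [FiniteDimensional ℂ V] (ρ : Representation ℂ G V) (g : G) :
    IsIntegral ℤ (ρ.character g) := by
  rw [Representation.character, End.trace_eq_sum_roots_charpoly_of_splits (IsAlgClosed.splits _)]
  refine IsIntegral.multiset_sum fun μ hμ => ?_
  have h1 := (End.hasEigenvalue_iff_isRoot_charpoly _ _).2 (Polynomial.isRoot_of_mem_roots hμ)
  obtain ⟨x, hx⟩ := h1.exists_hasEigenvector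
  refine IsIntegral.of_pow (orderOf_pos g) ?_
  have h2 := hx.pow_apply (orderOf g)
  rw [← map_pow, pow_orderOf_eq_one, map_one, End.one_apply] at h2
  have h3 : (μ ^ orderOf g - 1) • x = 0 := by rw [sub_smul, ← h2, one_smul, sub_self]
  rw [sub_eq_zero.1 ((smul_eq_zero.1 h3).resolve_right hx.2)]
  exact isIntegral_one

lemma sum_subgroup_character [Finite G] (H : Subgroup G) [Fintype H] {V : Type*} [AddCommGroup V]
    [Module ℂ V] [FiniteDimensional ℂ V] (ρ : Representation ℂ G V) :
    ∑ h : H, ρ.character h =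
      Nat.card H * finrank ℂ (Representation.invariants (ρ.comp H.subtype)) := by
  have h0 : (Nat.card H : ℂ) ≠ 0 := by exact_mod_cast (Nat.card_pos (α := H)).ne'
  have := invertibleOfNonzero h0
  rw [← Representation.card_inv_mul_sum_char_eq_finrank, mul_inv_cancel_left₀ h0]
  rfl

/-- If the sets `{g | t < j g} ∪ {1}` are subgroups, then summing over these subgroups shows that
the pairing of `j` with `χ(1) - χ` is a natural number. -/
lemma exists_defectSum_eq_natCast [Fintype G] {j : G → ℤ} (hj : ∀ g, 0 ≤ j g)
    (N : ℕ → Subgroup G) (hN : ∀ t g, g ≠ 1 → (g ∈ N t ↔ (t : ℤ) < j g)) {V : Type*}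
    [AddCommGroup V] [Module ℂ V] [FiniteDimensional ℂ V] (ρ : Representation ℂ G V) :
    ∃ n : ℕ, defectSum j ρ.character = n := by
  classical
  set M : ℕ := ∑ g, (j g).toNat with hM
  have hjM : ∀ g, (j g).toNat ≤ M := fun g =>
    Finset.single_le_sum (f := fun g => (j g).toNat) (fun _ _ => Nat.zero_le _) (Finset.mem_univ g)
  have hlayer : ∀ g, (j g : ℂ) * (ρ.character 1 - ρ.character g) =
      ∑ t ∈ Finset.range M, if g ∈ N t then ρ.character 1 - ρ.character g else 0 := by
    intro g
    rcases eq_or_ne g 1 with rfl | hg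
    · simp
    have h1 : (Finset.range M).filter (fun t => g ∈ N t) = Finset.range (j g).toNat := by
      ext t
      rw [Finset.mem_filter, Finset.mem_range, Finset.mem_range, hN t g hg]
      have := hjM g
      have := hj g
      omega
    rw [← Finset.sum_filter, h1, Finset.sum_const, Finset.card_range, nsmul_eq_mul]
    congr 1
    rw [← Int.cast_natCast, Int.toNat_of_nonneg (hj g)]
  refine ⟨∑ t ∈ Finset.range M, Nat.card (N t) *
    (finrank ℂ V - finrank ℂ (Representation.invariants (ρ.comp (N t).subtype))), ?_⟩
  rw [defectSum, Finset.sum_congr rfl fun g _ => hlayer g, Finset.sum_comm]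
  push_cast
  refine Finset.sum_congr rfl fun t _ => ?_
  rw [← Finset.sum_filter, Nat.cast_sub (Submodule.finrank_le _), mul_sub,
    ← sum_subgroup_character, ← Finset.sum_subtype_eq_sum_filter, Finset.subtype_univ,
    Finset.sum_sub_distrib, Representation.char_one]
  simp [Nat.card_eq_fintype_card]

/-- If every element of a cyclic subgroup `Q` that commutes with `g` has order dividing `j g`, then
the order of `Q` divides the contribution of every `Q`-conjugacy class to the pairing. -/
lemma exists_defectSum_eq_card_mul_isIntegral [Fintype G] (Q : Subgroup G) [IsCyclic Q] {j : G → ℤ}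
    (hconj : ∀ c g, j (c * g * c⁻¹) = j g)
    (hQ : ∀ c ∈ Q, ∀ g, c * g = g * c → (orderOf c : ℤ) ∣ j g) {V : Type*}
    [AddCommGroup V] [Module ℂ V] [FiniteDimensional ℂ V] (ρ : Representation ℂ G V) :
    ∃ z, IsIntegral ℤ z ∧ defectSum j ρ.character = Nat.card Q * z := by
  classical
  let Q' : Subgroup (ConjAct G) := Q.map (ConjAct.toConjAct : G ≃* ConjAct G).toMonoidHom
  let e : Q ≃* Q' := Q.equivMapOfInjective _ (ConjAct.toConjAct : G ≃* ConjAct G).injective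
  have hcyc : IsCyclic Q' := isCyclic_of_surjective e e.surjective
  have hcard : Nat.card Q' = Nat.card Q := (Nat.card_congr e.toEquiv).symm
  have hdvd : ∀ g : G, (Nat.card (MulAction.stabilizer Q' g) : ℤ) ∣ j g := by
    intro g
    obtain ⟨c, hc⟩ := IsCyclic.exists_generator (α := MulAction.stabilizer Q' g)
    have h1 : orderOf (ConjAct.ofConjAct ((c : Q') : ConjAct G)) =
        Nat.card (MulAction.stabilizer Q' g) := by
      rw [← orderOf_eq_card_of_forall_mem_zpowers hc, MulEquiv.orderOf_eq, Subgroup.orderOf_coe,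
        Subgroup.orderOf_coe]
    rw [← h1]
    refine hQ _ ?_ g ?_
    · obtain ⟨q, hq, hq'⟩ := (c : Q').2
      rw [← hq']
      exact hq
    · have h2 : (c : Q') • g = g := c.2
      rw [Subgroup.smul_def, ConjAct.smul_def] at h2
      exact mul_inv_eq_iff_eq_mul.1 h2
  choose m hm using hdvd
  let φ : G → ℂ := fun g => (j g : ℂ) * (ρ.character 1 - ρ.character g)
  have hφ : ∀ (c : Q') (g : G), φ (c • g) = φ g := by
    intro c g
    simp only [φ]
    rw [Subgroup.smul_def, ConjAct.smul_def, hconj, Representation.char_conj]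
  let Ω := MulAction.orbitRel.Quotient Q' G
  refine ⟨∑ ω : Ω, (m ω.out : ℂ) * (ρ.character 1 - ρ.character ω.out), ?_, ?_⟩
  · exact IsIntegral.sum _ fun ω _ => isIntegral_algebraMap.mul
      ((isIntegral_character ρ 1).sub (isIntegral_character ρ _))
  · change ∑ g, φ g = _
    rw [← Finset.sum_fiberwise Finset.univ (fun g => (Quotient.mk _ g : Ω)), Finset.mul_sum]
    refine Finset.sum_congr rfl fun ω _ => ?_
    have hmem : ∀ g : G, g ∈ Finset.univ.filter (fun g => (Quotient.mk _ g : Ω) = ω) ↔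
        g ∈ MulAction.orbit Q' (ω.out : G) := by
      intro g
      rw [Finset.mem_filter, ← MulAction.orbitRel_apply,
        ← Quotient.eq (r := MulAction.orbitRel Q' G), Quotient.out_eq]
      simp only [Finset.mem_univ, true_and]
    have hval : ∀ g ∈ Finset.univ.filter (fun g => (Quotient.mk _ g : Ω) = ω), φ g = φ ω.out := by
      intro g hg
      obtain ⟨c, rfl⟩ := (hmem g).1 hg
      exact hφ c _
    have hcardω : (Finset.univ.filter (fun g => (Quotient.mk _ g : Ω) = ω)).card *
        Nat.card (MulAction.stabilizer Q' (ω.out : G)) = Nat.card Q := by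
      have h1 := MulAction.card_orbit_mul_card_stabilizer_eq_card_group Q' (ω.out : G)
      rw [← Nat.card_eq_fintype_card, ← Nat.card_eq_fintype_card, ← Nat.card_eq_fintype_card,
        hcard] at h1
      rw [← h1]
      congr 1
      rw [← Nat.card_eq_finsetCard]
      exact Nat.card_congr (Equiv.subtypeEquivRight hmem)
    rw [Finset.sum_congr rfl hval, Finset.sum_const, nsmul_eq_mul, ← hcardω]
    simp only [φ]
    rw [hm]
    push_cast
    ring

lemma natCast_dvd_of_isIntegral {T m : ℕ} (hm : m ≠ 0) {z : ℂ} (hz : IsIntegral ℤ z)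
    (h : (T : ℂ) = m * z) : m ∣ T := by
  have h1 : algebraMap ℚ ℂ ((T : ℚ) / m) = z := by
    rw [map_div₀, map_natCast, map_natCast, h, mul_div_cancel_left₀]
    exact_mod_cast hm
  rw [← h1, isIntegral_algebraMap_iff (algebraMap ℚ ℂ).injective] at hz
  obtain ⟨y, hy⟩ := IsIntegrallyClosed.isIntegral_iff.1 hz
  have h2 : (y : ℚ) * m = T := by
    rw [eq_div_iff (by exact_mod_cast hm)] at hy
    exact hy
  have h3 : (m : ℤ) ∣ T := ⟨y, by rw [mul_comm]; exact_mod_cast h2.symm⟩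
  exact_mod_cast h3

end Representations

open WithZero

lemma lt_one_iff_le_exp_neg_one {x : ℤᵐ⁰} : x < 1 ↔ x ≤ exp (-1) := by
  rcases eq_or_ne x 0 with rfl | hx
  · simp
  rw [← exp_log hx, ← exp_zero, exp_lt_exp, exp_le_exp]
  omega

namespace IsTotallyRamified

variable {L : Type*} [Field L] {v : Valuation L ℤᵐ⁰} {π : L} {P : Type*} [Group P]
  [MulSemiringAction P L] [Finite P] [FaithfulSMul P L]

/-- On an element `g` of the wild ramification group, `k ↦ g ^ k • π / π - 1` is additive up to
terms of larger valuation. -/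
lemma val_pow_smul_div_sub_lt (h : IsTotallyRamified v P) (hπ : v π = exp (-1)) {g : P}
    (hg1 : g ≠ 1) (hg : v (g • π / π - 1) < 1) (k : ℕ) :
    v (g ^ k • π / π - 1 - k * (g • π / π - 1)) < v (g • π / π - 1) := by
  have hπ0 := ne_zero_of_val_eq_exp hπ
  have hu0 : 0 < v (g • π / π - 1) := by
    rw [zero_lt_iff, Valuation.ne_zero_iff]
    exact (h.smul_div_sub_one_eq_zero_iff hπ).not.2 hg1
  induction k with
  | zero => simpa [div_self hπ0] using hu0
  | succ k ih =>
    set u := g • π / π - 1 with hu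
    set a := g ^ k • π / π - 1 with ha
    have hau : v a ≤ v u := (h.ramificationSubgroup hπ (v u)).pow_mem
      ((h.mem_ramificationSubgroup hπ).2 le_rfl) k
    have h1 : g ^ (k + 1) • π / π - 1 = (1 + g • a) * (1 + u) - 1 := by
      have hgπ : g • π ≠ 0 := (smul_ne_zero_iff_ne g).2 hπ0
      rw [ha, hu, smul_sub, smul_one, smul_div₀', smul_smul, ← pow_succ', add_sub_cancel,
        add_sub_cancel, div_mul_div_cancel₀ hgπ]
    have h2 : g ^ (k + 1) • π / π - 1 - (k + 1 : ℕ) * u =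
        (g • a - a) + (a - k * u) + u * g • a := by
      rw [h1]
      push_cast
      ring
    rw [h2]
    refine v.map_add_lt (v.map_add_lt ?_ ih) ?_
    · refine (h.val_smul_sub_le hπ g a).trans_lt ?_
      exact (mul_le_mul_left hau _).trans_lt (mul_lt_of_lt_one_right hu0 hg)
    · rw [map_mul, h.map_smul]
      exact mul_lt_of_lt_one_right hu0 (hau.trans_lt hg)

/-- The order of a nontrivial element of the wild ramification group vanishes in the residue
field. -/
lemma val_orderOf_lt_one (h : IsTotallyRamified v P) (hπ : v π = exp (-1)) {g : P}
    (hg1 : g ≠ 1) (hg : v (g • π / π - 1) < 1) : v (orderOf g : L) < 1 := by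
  have h1 := h.val_pow_smul_div_sub_lt hπ hg1 hg (orderOf g)
  rw [pow_orderOf_eq_one, one_smul, div_self (ne_zero_of_val_eq_exp hπ), sub_self, zero_sub,
    Valuation.map_neg, map_mul] at h1
  exact lt_of_mul_lt_mul_right (a := v (g • π / π - 1)) (by rwa [one_mul]) zero_le

/-- If a prime number `p` divides the order of the wild ramification group, then this group is a
`p`-group. -/
lemma isPGroup_ramificationSubgroup (h : IsTotallyRamified v P) (hπ : v π = exp (-1)) {p : ℕ}
    (hp : p.Prime) (hdvd : p ∣ Nat.card (h.ramificationSubgroup hπ (exp (-1)))) :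
    IsPGroup p (h.ramificationSubgroup hπ (exp (-1))) := by
  have key : ∀ q : ℕ, q.Prime → q ∣ Nat.card (h.ramificationSubgroup hπ (exp (-1))) →
      v (q : L) < 1 := by
    intro q hq hqd
    have := Fact.mk hq
    obtain ⟨g, hg⟩ := exists_prime_orderOf_dvd_card' q hqd
    rw [← hg, ← Subgroup.orderOf_coe]
    refine h.val_orderOf_lt_one hπ (fun h1 => hq.one_lt.ne' ?_) (lt_one_iff_le_exp_neg_one.2 g.2)
    rw [← hg, ← Subgroup.orderOf_coe, h1, orderOf_one]
  refine IsPGroup.of_card (Nat.eq_prime_pow_of_unique_prime_dvd Nat.card_pos.ne'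
    fun {q} hq hqd => ?_)
  by_contra hqp
  obtain ⟨a, b, hab⟩ := Nat.isCoprime_iff_coprime.2 ((Nat.coprime_primes hq hp).2 hqp)
  have h1 : ∀ (n : ℤ) {r : ℕ}, v (r : L) < 1 → v (n * (r : L)) < 1 := fun n r hr => by
    rw [map_mul]
    have hn : v (n : L) ≤ 1 := (intCast_mem v.integer n :)
    exact (mul_le_of_le_one_left' hn).trans_lt hr
  have h2 : (a * (q : L) + b * (p : L)) = 1 := by exact_mod_cast congrArg (Int.cast (R := L)) hab
  have h3 := v.map_add_lt (h1 a (key q hq hqd)) (h1 b (key p hp hdvd))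
  rw [h2, map_one] at h3
  exact h3.ne rfl

lemma residue_eq_residue_iff (v : Valuation L ℤᵐ⁰) (x y : v.valuationSubring) :
    IsLocalRing.residue v.valuationSubring x = IsLocalRing.residue _ y ↔ v ((x : L) - y) < 1 := by
  rw [← sub_eq_zero, ← map_sub, IsLocalRing.residue_eq_zero_iff, Valuation.mem_maximalIdeal_iff]
  rfl

/-- The homomorphism `g ↦ g π / π` to the residue field. Its kernel is the wild ramification
group. -/
def tameCharacter (h : IsTotallyRamified v P) (hπ : v π = exp (-1)) :
    P →* IsLocalRing.ResidueField v.valuationSubring where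
  toFun g := IsLocalRing.residue _ ⟨g • π / π, (h.val_smul_div (ne_zero_of_val_eq_exp hπ) g).le⟩
  map_one' := by
    rw [← map_one (IsLocalRing.residue _)]
    congr 1
    exact Subtype.ext (by simp [div_self (ne_zero_of_val_eq_exp hπ)])
  map_mul' g g' := by
    have hπ0 := ne_zero_of_val_eq_exp hπ
    rw [← map_mul, residue_eq_residue_iff]
    have hgπ : g • π ≠ 0 := (smul_ne_zero_iff_ne g).2 hπ0
    have h1 : (g * g') • π / π - g • π / π * (g' • π / π) =
        (g • π / π) * (g • (g' • π / π) - g' • π / π) := by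
      rw [mul_sub, smul_div₀', smul_smul,
        mul_comm (g • π / π) ((g * g') • π / g • π), div_mul_div_cancel₀ hgπ]
    change v ((g * g') • π / π - g • π / π * (g' • π / π)) < 1
    rw [h1, map_mul, h.val_smul_div hπ0, one_mul]
    refine (h.val_smul_sub_le_of_integral hπ g (h.val_smul_div hπ0 g').le).trans_lt ?_
    rw [lt_one_iff_le_exp_neg_one, ← hπ]
    exact v.map_sub_le (h.map_smul g π).le le_rfl

lemma tameCharacter_eq_one_iff (h : IsTotallyRamified v P) (hπ : v π = exp (-1)) {g : P} :
    h.tameCharacter hπ g = 1 ↔ v (g • π / π - 1) < 1 := by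
  rw [← map_one (IsLocalRing.residue v.valuationSubring)]
  exact residue_eq_residue_iff v _ _

/-- Conjugation by `c` acts on the graded piece containing a wild element `g` as multiplication by a
power of the tame character; this power is trivial at `c` if `c` commutes with `g`. -/
lemma tameCharacter_pow_jump (h : IsTotallyRamified v P) (hπ : v π = exp (-1)) {c g : P}
    (hg1 : g ≠ 1) (hcg : c * g = g * c) : h.tameCharacter hπ c ^ (jump v π g).toNat = 1 := by
  have hπ0 := ne_zero_of_val_eq_exp hπ
  set u := g • π / π - 1 with hu
  set y := c • π / π with hy
  set n := (jump v π g).toNat with hn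
  have hvu : v u = exp (-n : ℤ) := by
    rw [hn, Int.toNat_of_nonneg (h.jump_nonneg hπ g)]
    exact h.val_smul_div_sub_one hπ hg1
  have hvu0 : 0 < v u := by
    rw [hvu]
    exact exp_pos
  have hvy : v y = 1 := h.val_smul_div hπ0 c
  have hgπ : g • π = π * (1 + u) := by rw [hu, add_sub_cancel, mul_div_cancel₀ _ hπ0]
  have hcπ : c • π = y * π := by rw [hy, div_mul_cancel₀ _ hπ0]
  have h1 : y * (1 + c • u) = g • y * (1 + u) := by
    have h2 : c • g • π = g • c • π := by rw [smul_smul, smul_smul, hcg]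
    rw [hgπ, hcπ, smul_mul', smul_mul', smul_add, smul_one, hgπ, hcπ] at h2
    refine mul_left_cancel₀ hπ0 ?_
    linear_combination h2
  have h3 : v (c • u - u) < v u := by
    have h4 : y * (c • u - u) = (g • y - y) * (1 + u) := by linear_combination h1
    have h5 : v (c • u - u) = v ((g • y - y) * (1 + u)) := by rw [← h4, map_mul, hvy, one_mul]
    rw [h5, map_mul]
    have h6 : v (1 + u) ≤ 1 := by
      rw [hu, add_sub_cancel]
      exact (h.val_smul_div hπ0 g).le
    refine (mul_le_of_le_one_right' h6).trans_lt
      ((h.val_smul_sub_le_of_integral hπ g hvy.le).trans_lt ?_)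
    rw [h.val_smul_sub hπ hg1, h.val_smul_div_sub_one hπ hg1, exp_lt_exp]
    omega
  -- `u = a π ^ n` with a unit `a`
  set a := u / π ^ n with ha
  have hua : u = a * π ^ n := by rw [ha, div_mul_cancel₀ _ (pow_ne_zero _ hπ0)]
  have hva : v a = 1 := by
    rw [ha, map_div₀, val_pow_uniformizer hπ, hvu, div_self exp_ne_zero]
  have h7 : v (c • a - a) < 1 := by
    refine (h.val_smul_sub_le_of_integral hπ c hva.le).trans_lt ?_
    rw [lt_one_iff_le_exp_neg_one, ← hπ]
    exact v.map_sub_le (h.map_smul c π).le le_rfl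
  have h8 : v (c • a * y ^ n - a) < 1 := by
    have h9 : c • u - u = (c • a * y ^ n - a) * π ^ n := by
      rw [hua, smul_mul', smul_pow', hcπ, mul_pow]
      ring
    rw [h9, map_mul, val_pow_uniformizer hπ, hvu] at h3
    exact lt_of_mul_lt_mul_right (a := exp (-n : ℤ)) (by rwa [one_mul]) zero_le
  have h10 : v (y ^ n - 1) < 1 := by
    have h11 : a * (y ^ n - 1) = (c • a * y ^ n - a) - (c • a - a) * y ^ n := by ring
    have h12 := v.map_sub_lt h8 (y := (c • a - a) * y ^ n)
      (by rwa [map_mul, map_pow, hvy, one_pow, mul_one])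
    rwa [← h11, map_mul, hva, one_mul] at h12
  rw [← map_one (IsLocalRing.residue v.valuationSubring)]
  change IsLocalRing.residue _ _ ^ n = _
  rw [← map_pow, residue_eq_residue_iff]
  exact h10

/-- The jump function of a totally ramified group of prime power order has integral pairings with
the characters of degree one of all subgroups. -/
lemma linearCharactersIntegral (h : IsTotallyRamified v P) (hπ : v π = exp (-1)) {p : ℕ}
    [Fact p.Prime] (hP : IsPGroup p P) : LinearCharactersIntegral (jump v π : P → ℤ) := by
  intro H _ χ
  exact (h.subgroup H).exists_sum_jump_mul_one_sub_eq hπ (hP.to_subgroup H) χ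

/-- For a totally ramified group `P` with jump function `j`, the pairing of `j` with `χ(1) - χ` is a
multiple of the order of `P`. For a Sylow subgroup `Q` for the residue characteristic `p`, this
follows from the case of `p`-groups, because `j` vanishes outside `Q`. A Sylow subgroup `Q` for
another prime is cyclic, and the order of the centralizer in `Q` of a wild element `g` divides
`j g`. -/
theorem exists_defectSum_eq_card_mul [Fintype P] (h : IsTotallyRamified v P) (hπ : v π = exp (-1))
    (V : Type) [AddCommGroup V] [Module ℂ V] [FiniteDimensional ℂ V] (ρ : Representation ℂ P V) :
    ∃ n : ℕ, defectSum (jump v π) ρ.character = Nat.card P * n := by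
  classical
  obtain ⟨T, hT⟩ := exists_defectSum_eq_natCast (h.jump_nonneg hπ)
    (fun t => h.ramificationSubgroup hπ (exp (-(t + 1) : ℤ))) (fun t g hg => by
      rw [mem_ramificationSubgroup, h.val_smul_div_sub_one hπ hg, exp_le_exp]
      omega) ρ
  suffices hdvd : Nat.card P ∣ T by
    obtain ⟨n, rfl⟩ := hdvd
    exact ⟨n, by rw [hT]; push_cast; rfl⟩
  rw [Nat.dvd_iff_prime_pow_dvd_dvd]
  intro p k hp hk
  have := Fact.mk hp
  obtain ⟨Q⟩ : Nonempty (Sylow p P) := inferInstance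
  refine (Q.pow_dvd_card_of_pow_dvd_card hk).trans ?_
  set W := h.ramificationSubgroup hπ (exp (-1)) with hW
  have hWn : W.Normal := ⟨fun g hg c => by
    rw [hW, mem_ramificationSubgroup] at hg ⊢
    rcases eq_or_ne g 1 with rfl | hg1
    · simp [div_self (ne_zero_of_val_eq_exp hπ)]
    rw [h.val_smul_div_sub_one hπ (by simpa using hg1), h.jump_conj hπ]
    rwa [h.val_smul_div_sub_one hπ hg1] at hg⟩
  have hjW : ∀ g, g ∉ W → jump v π g = 0 := by
    intro g hg
    have hg1 : g ≠ 1 := fun h1 => hg (h1 ▸ W.one_mem)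
    rw [hW, mem_ramificationSubgroup, h.val_smul_div_sub_one hπ hg1, exp_le_exp] at hg
    have := h.jump_nonneg hπ g
    omega
  by_cases hpW : p ∣ Nat.card W
  · have hWQ : W ≤ Q := (h.isPGroup_ramificationSubgroup hπ hp hpW).le_sylow_of_normal Q
    obtain ⟨c, hc⟩ := exists_defectSum_eq_of_isPGroup (p := p) _ Q rfl Q.isPGroup'
      (j := fun g : Q => jump v π (g : P)) (fun c g => h.jump_conj hπ _ _)
      ((h.subgroup Q).linearCharactersIntegral hπ Q.isPGroup') V (ρ.comp (Q : Subgroup P).subtype)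
    have h1 : defectSum (jump v π) ρ.character = defectSum (fun g : Q => jump v π (g : P))
        (Representation.character (ρ.comp (Q : Subgroup P).subtype)) := by
      have h2 : ∀ g, g ∉ Q → (jump v π g : ℂ) * (ρ.character 1 - ρ.character g) = 0 := by
        intro g hg
        rw [hjW g fun h3 => hg (hWQ h3), Int.cast_zero, zero_mul]
      rw [defectSum, defectSum, ← Finset.sum_subset (Finset.subset_univ
        (Finset.univ.filter (fun g => g ∈ Q))) (fun g _ hg => h2 g (by simpa using hg)),
        ← Finset.sum_subtype_eq_sum_filter, Finset.subtype_univ]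
      rfl
    rw [← h1, hT] at hc
    have h3 : (Nat.card Q : ℤ) ∣ T := ⟨c, by exact_mod_cast hc⟩
    exact_mod_cast h3
  · have hdisj : ∀ c ∈ Q, h.tameCharacter hπ c = 1 → c = 1 := by
      intro c hcQ hc
      rw [tameCharacter_eq_one_iff, lt_one_iff_le_exp_neg_one] at hc
      have hcop : (Nat.card Q).Coprime (Nat.card W) := by
        obtain ⟨n, hn⟩ := IsPGroup.iff_card.1 Q.isPGroup'
        rw [hn]
        exact Nat.Coprime.pow_left _ ((Nat.Prime.coprime_iff_not_dvd hp).2 hpW)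
      have h1 := (Subgroup.disjoint_of_coprime_natCard hcop).eq_bot
      exact Subgroup.mem_bot.1 (h1 ▸ Subgroup.mem_inf.2 ⟨hcQ, hc⟩)
    have hcyc : IsCyclic Q := isCyclic_of_injective_ringHom
      ((h.tameCharacter hπ).comp (Q : Subgroup P).subtype) (by
        rw [injective_iff_map_eq_one]
        exact fun c hc => Subtype.ext (hdisj c c.2 hc))
    obtain ⟨z, hz, hz'⟩ := exists_defectSum_eq_card_mul_isIntegral (Q : Subgroup P)
      (h.jump_conj hπ) (fun c hc g hcg => by
        rcases eq_or_ne g 1 with rfl | hg1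
        · rw [jump_one]
          exact dvd_zero _
        rw [← Int.toNat_of_nonneg (h.jump_nonneg hπ g), Int.natCast_dvd_natCast]
        refine orderOf_dvd_of_pow_eq_one (hdisj _ (pow_mem hc _) ?_)
        rw [map_pow, h.tameCharacter_pow_jump hπ hg1 hcg]) ρ
    exact natCast_dvd_of_isIntegral Nat.card_pos.ne' hz (hT.symm.trans hz')

end IsTotallyRamified

end ArtinSwan

namespace ArtinSwan

/-! ### Recognition of characters -/

section Representations

open Module

variable {G : Type*} [Group G]

lemma isComplexCharacter_character {V : Type*} [AddCommGroup V] [Module ℂ V] [FiniteDimensional ℂ V]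
    (ρ : Representation ℂ G V) : IsComplexCharacter ρ.character := by
  let e : V ≃ₗ[ℂ] (Fin (finrank ℂ V) → ℂ) := (finBasis ℂ V).equivFun
  refine ⟨Fin (finrank ℂ V) → ℂ, inferInstance, inferInstance, inferInstance,
    (e.conjRingEquiv.toMulEquiv.toMonoidHom).comp ρ, ?_⟩
  funext g
  exact (LinearMap.trace_conj' (ρ g) e).symm

lemma isComplexCharacter_zero : IsComplexCharacter (0 : G → ℂ) := by
  refine ⟨PUnit, inferInstance, inferInstance, inferInstance, 1, ?_⟩
  funext g
  rw [Representation.character, Subsingleton.elim ((1 : Representation ℂ G PUnit) g) 0, map_zero,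
    Pi.zero_apply]

lemma IsComplexCharacter.add {φ ψ : G → ℂ} (hφ : IsComplexCharacter φ)
    (hψ : IsComplexCharacter ψ) : IsComplexCharacter (φ + ψ) := by
  obtain ⟨V, _, _, _, ρ, rfl⟩ := hφ
  obtain ⟨W, _, _, _, σ, rfl⟩ := hψ
  have h := isComplexCharacter_character (ρ.prod σ)
  convert h using 1
  funext g
  exact (LinearMap.trace_prodMap' (ρ g) (σ g)).symm

lemma ofMulAction_character {X : Type*} [Fintype X] [DecidableEq X] [MulAction G X] (g : G) :
    (Representation.ofMulAction ℂ G X).character g = Fintype.card {x : X // g • x = x} := by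
  rw [Representation.character, LinearMap.trace_eq_matrix_trace ℂ (MonoidAlgebra.basis X ℂ),
    Matrix.trace, Fintype.card_subtype, ← Finset.sum_boole]
  refine Finset.sum_congr rfl fun x _ => ?_
  rw [Matrix.diag_apply, LinearMap.toMatrix_apply]
  simp [MonoidAlgebra.basis, Finsupp.single_apply]

lemma regularCharacter_apply [Fintype G] [DecidableEq G] (g : G) :
    regularCharacter G g = if g = 1 then (Nat.card G : ℂ) else 0 := by
  rw [regularCharacter, Representation.leftRegular, ofMulAction_character]
  split_ifs with hg
  · subst hg
    simp [Nat.card_eq_fintype_card]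
  · simp [hg]

open Classical in
lemma cosetCharacter_apply [Finite G] (N : Subgroup G) [N.Normal] (g : G) :
    cosetCharacter N g = if g ∈ N then (N.index : ℂ) else 0 := by
  have := Fintype.ofFinite (G ⧸ N)
  have h1 : ∀ x : G ⧸ N, g • x = x ↔ g ∈ N := by
    intro x
    obtain ⟨y, rfl⟩ := QuotientGroup.mk_surjective x
    rw [MulAction.Quotient.smul_mk, smul_eq_mul, QuotientGroup.mk_mul, mul_eq_right,
      QuotientGroup.eq_one_iff]
  rw [cosetCharacter, ofMulAction_character]
  simp only [h1]
  split_ifs with hg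
  · simp [hg, Subgroup.index, Nat.card_eq_fintype_card]
  · simp [hg]

/-- The bilinear pairing `|G|⁻¹ ∑_g φ(g) ψ(g⁻¹)` of functions on a finite group. -/
def bilinPairing [Fintype G] (φ ψ : G → ℂ) : ℂ := (Nat.card G : ℂ)⁻¹ * ∑ g, φ g * ψ g⁻¹

lemma bilinPairing_add_right [Fintype G] (φ ψ ψ' : G → ℂ) :
    bilinPairing φ (ψ + ψ') = bilinPairing φ ψ + bilinPairing φ ψ' := by
  simp only [bilinPairing, Pi.add_apply, mul_add, Finset.sum_add_distrib]

lemma bilinPairing_sub_left [Fintype G] (φ φ' ψ : G → ℂ) :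
    bilinPairing (φ - φ') ψ = bilinPairing φ ψ - bilinPairing φ' ψ := by
  simp only [bilinPairing, Pi.sub_apply, sub_mul, mul_sub, Finset.sum_sub_distrib]

lemma bilinPairing_regularCharacter [Fintype G] (φ : G → ℂ) :
    bilinPairing φ (regularCharacter G) = φ 1 := by
  classical
  simp only [bilinPairing, regularCharacter_apply, inv_eq_one]
  simp [mul_comm (φ 1)]

/-- A class function orthogonal to all irreducible characters vanishes: by Schur's lemma
`∑_g φ(g) ρ(g⁻¹)` is zero for irreducible `ρ`, and hence for the regular representation. -/
theorem eq_zero_of_bilinPairing_eq_zero [Fintype G] {φ : G → ℂ}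
    (hφ : ∀ c g, φ (c * g * c⁻¹) = φ g)
    (h : ∀ (V : Type) [AddCommGroup V] [Module ℂ V] [FiniteDimensional ℂ V]
      (ρ : Representation ℂ G V) [ρ.IsIrreducible], bilinPairing φ ρ.character = 0) : φ = 0 := by
  classical
  have hcard : (Nat.card G : ℂ) ≠ 0 := by exact_mod_cast (Nat.card_pos (α := G)).ne'
  have key : ∀ χ : G → ℂ, IsComplexCharacter χ → ∀ x, ∑ g, φ g * χ (g⁻¹ * x) = 0 := by
    rintro χ ⟨V, _, _, _, ρ, rfl⟩
    refine character_induction (motive := fun χ => ∀ x, ∑ g, φ g * χ (g⁻¹ * x) = 0) ?_ ?_ ?_ V ρ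
    · simp
    · intro ψ ψ' hψ hψ' x
      simp only [Pi.add_apply, mul_add, Finset.sum_add_distrib, hψ, hψ', add_zero]
    · intro V _ _ _ ρ _ x
      have hV := nontrivial_of_isIrreducible ρ
      set T : End ℂ V := ∑ g, φ g • ρ g⁻¹ with hT
      have hTc : ∀ c, T * ρ c = ρ c * T := by
        intro c
        rw [hT, Finset.sum_mul, Finset.mul_sum]
        refine Fintype.sum_equiv (MulAut.conj c⁻¹).toEquiv _ _ fun g => ?_
        change φ g • ρ g⁻¹ * ρ c = ρ c * φ (c⁻¹ * g * c⁻¹⁻¹) • ρ (c⁻¹ * g * c⁻¹⁻¹)⁻¹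
        rw [hφ, smul_mul_assoc, mul_smul_comm, ← map_mul, ← map_mul]
        congr 2
        group
      obtain ⟨c, hc⟩ := exists_eq_smul_one_of_commute ρ T hTc
      have htr : LinearMap.trace ℂ V T = 0 := by
        have h1 := h V ρ
        rw [bilinPairing, mul_eq_zero, or_iff_right (inv_ne_zero hcard)] at h1
        rw [hT, map_sum, ← h1]
        exact Finset.sum_congr rfl fun g _ => by rw [map_smul, smul_eq_mul]; rfl
      have hc0 : c = 0 := by
        rw [hc, map_smul, LinearMap.trace_one, smul_eq_mul, mul_eq_zero] at htr
        exact htr.resolve_right (by exact_mod_cast (finrank_pos (R := ℂ) (M := V)).ne')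
      have h2 : LinearMap.trace ℂ V (T * ρ x) = 0 := by
        rw [hc, hc0, zero_smul, zero_mul, map_zero]
      rw [← h2, hT, Finset.sum_mul, map_sum]
      refine Finset.sum_congr rfl fun g _ => ?_
      rw [smul_mul_assoc, map_smul, smul_eq_mul, ← map_mul]
      rfl
  funext x
  have h1 := key _ (isComplexCharacter_character (Representation.leftRegular ℂ G)) x
  change ∑ g, φ g * regularCharacter G (g⁻¹ * x) = 0 at h1
  simp only [regularCharacter_apply, inv_mul_eq_one] at h1
  simpa [hcard] using h1

/-- A class function whose pairings with all characters are natural numbers is a character. -/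
theorem isComplexCharacter_of_bilinPairing [Fintype G] {φ : G → ℂ}
    (hφ : ∀ c g, φ (c * g * c⁻¹) = φ g)
    (h : ∀ χ, IsComplexCharacter χ → ∃ n : ℕ, bilinPairing φ χ = n) : IsComplexCharacter φ := by
  classical
  have hcard : (Nat.card G : ℂ) ≠ 0 := by exact_mod_cast (Nat.card_pos (α := G)).ne'
  have := invertibleOfNonzero hcard
  obtain ⟨n, hn⟩ := h _ (isComplexCharacter_character (Representation.leftRegular ℂ G))
  change bilinPairing φ (regularCharacter G) = n at hn
  rw [bilinPairing_regularCharacter] at hn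
  -- induction on the degree `φ(1)`
  induction n using Nat.strong_induction_on generalizing φ with
  | _ n ih =>
  by_cases h0 : ∀ (V : Type) [AddCommGroup V] [Module ℂ V] [FiniteDimensional ℂ V]
      (ρ : Representation ℂ G V) [ρ.IsIrreducible], bilinPairing φ ρ.character = 0
  · rw [eq_zero_of_bilinPairing_eq_zero hφ h0]
    exact isComplexCharacter_zero
  push Not at h0
  obtain ⟨V, _, _, _, ρ, hρ, hne⟩ := h0
  have hV := nontrivial_of_isIrreducible ρ
  have hφ' : ∀ c g, (φ - ρ.character) (c * g * c⁻¹) = (φ - ρ.character) g := fun c g => by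
    rw [Pi.sub_apply, Pi.sub_apply, hφ, Representation.char_conj]
  have h' : ∀ χ, IsComplexCharacter χ → ∃ n : ℕ, bilinPairing (φ - ρ.character) χ = n := by
    rintro χ ⟨W, _, _, _, σ, rfl⟩
    refine character_induction
      (motive := fun χ => ∃ n : ℕ, bilinPairing (φ - ρ.character) χ = n) ?_ ?_ ?_ W σ
    · exact ⟨0, by simp [bilinPairing]⟩
    · rintro ψ ψ' ⟨a, ha⟩ ⟨b, hb⟩
      exact ⟨a + b, by rw [bilinPairing_add_right, ha, hb, Nat.cast_add]⟩
    · intro W _ _ _ σ _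
      obtain ⟨a, ha⟩ := h _ ⟨W, _, _, inferInstance, σ, rfl⟩
      rw [bilinPairing_sub_left, ha]
      have horth : bilinPairing ρ.character σ.character =
        if Nonempty (Representation.Equiv σ ρ) then 1 else 0 := Representation.char_orthonormal ρ σ
      rw [horth]
      split_ifs with he
      · obtain ⟨e⟩ := he
        rw [Representation.char_iso e] at ha
        obtain ⟨b, rfl⟩ : ∃ b, a = b + 1 := Nat.exists_eq_succ_of_ne_zero (by
          rintro rfl
          exact hne (by rw [ha, Nat.cast_zero]))
        exact ⟨b, by push_cast; ring⟩
      · exact ⟨a, by rw [sub_zero]⟩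
  obtain ⟨m, hm⟩ := h' _ (isComplexCharacter_character (Representation.leftRegular ℂ G))
  change bilinPairing (φ - ρ.character) (regularCharacter G) = m at hm
  rw [bilinPairing_regularCharacter] at hm
  have hmn : m + finrank ℂ V = n := by
    rw [Pi.sub_apply, hn, Representation.char_one, sub_eq_iff_eq_add] at hm
    exact_mod_cast hm.symm
  have hpos := finrank_pos (R := ℂ) (M := V)
  have h1 := (ih m (by omega) hφ' h' hm).add (isComplexCharacter_character ρ)
  rwa [sub_add_cancel] at h1

/-- The Artin and the Swan function attached to a function `i` on a finite group that is
concentrated on a normal subgroup `N`, with `i - 1 = j` on `N ∖ {1}`, are characters provided that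
the pairings of `j` with `χ(1) - χ` for characters `χ` of `N` are natural multiples of the order
of `N`. -/
theorem isComplexCharacter_of_defectSum [Fintype G] [DecidableEq G] (N : Subgroup G) [N.Normal]
    [Fintype N] {f : ℕ} (hf : f * Nat.card N = Nat.card G) {i a : G → ℤ} {j : N → ℤ}
    (hconj : ∀ c g, g ≠ 1 → i (c * g * c⁻¹) = i g) (hinv : ∀ g, g ≠ 1 → i g⁻¹ = i g)
    (hout : ∀ g, g ∉ N → i g = 0)
    (hj : ∀ g : N, g ≠ 1 → i g = j g + 1)
    (hT : ∀ (V : Type) [AddCommGroup V] [Module ℂ V] [FiniteDimensional ℂ V]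
      (ρ : Representation ℂ N V), ∃ n : ℕ, defectSum j ρ.character = Nat.card N * n)
    (ha1 : a 1 = f * ∑ g ∈ Finset.univ.erase 1, i g) (ha : ∀ g, g ≠ 1 → a g = -(f * i g)) :
    IsComplexCharacter (fun g => (a g : ℂ)) ∧
    (∀ χ, IsComplexCharacter χ → ∃ n : ℕ, charPairing (fun g => (a g : ℂ)) χ = n) ∧
    IsComplexCharacter (fun g => (a g : ℂ) - (regularCharacter G g - cosetCharacter N g)) := by
  classical
  have hcard : (Nat.card G : ℂ) ≠ 0 := by exact_mod_cast (Nat.card_pos (α := G)).ne'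
  have hcardN : (Nat.card N : ℂ) ≠ 0 := by exact_mod_cast (Nat.card_pos (α := N)).ne'
  have hfC : (f : ℂ) * Nat.card N = Nat.card G := by exact_mod_cast hf
  have hindex : N.index = f := by
    refine Nat.eq_of_mul_eq_mul_right (Nat.card_pos (α := N)) ?_
    rw [hf, Subgroup.index_mul_card]
  have haconj : ∀ c g, a (c * g * c⁻¹) = a g := by
    intro c g
    rcases eq_or_ne g 1 with rfl | hg
    · simp
    · rw [ha _ (by simpa using hg), ha g hg, hconj c g hg]
  have hainv : ∀ g, a g⁻¹ = a g := by
    intro g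
    rcases eq_or_ne g 1 with rfl | hg
    · simp
    · rw [ha _ (by simpa using hg), ha g hg, hinv g hg]
  have hregconj : ∀ c g : G, regularCharacter G (c * g * c⁻¹) = regularCharacter G g := fun c g =>
    Representation.char_conj _ _ _
  have hcosconj : ∀ c g : G, cosetCharacter N (c * g * c⁻¹) = cosetCharacter N g := fun c g => by
    have h1 := (inferInstance : N.Normal).mem_comm_iff (a := c * g) (b := c⁻¹)
    rw [inv_mul_cancel_left] at h1
    simp only [cosetCharacter_apply, h1]
  -- the pairings of the Artin function, the regular character and the coset character
  have hsum : ∀ (V : Type) [AddCommGroup V] [Module ℂ V] [FiniteDimensional ℂ V]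
      (ρ : Representation ℂ G V), ∃ n : ℕ,
      (Nat.card G : ℂ)⁻¹ * ∑ g, (a g : ℂ) * ρ.character g =
        n + (finrank ℂ V - finrank ℂ (Representation.invariants (ρ.comp N.subtype))) := by
    intro V _ _ _ ρ
    obtain ⟨n, hn⟩ := hT V (ρ.comp N.subtype)
    refine ⟨n, ?_⟩
    have h1 : ∑ g, (a g : ℂ) * ρ.character g =
        f * ∑ g ∈ Finset.univ.erase 1, (i g : ℂ) * (ρ.character 1 - ρ.character g) := by
      rw [← Finset.add_sum_erase _ _ (Finset.mem_univ (1 : G)), ha1]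
      have h2 : ∀ g ∈ Finset.univ.erase (1 : G),
          (a g : ℂ) * ρ.character g = -(f * (i g * ρ.character g)) := fun g hg => by
        rw [ha g (Finset.ne_of_mem_erase hg)]
        push_cast
        ring
      rw [Finset.sum_congr rfl h2, Finset.sum_neg_distrib, ← Finset.mul_sum]
      simp only [mul_sub, Finset.sum_sub_distrib]
      rw [← Finset.sum_mul]
      push_cast
      ring
    have h3 : ∑ g ∈ Finset.univ.erase 1, (i g : ℂ) * (ρ.character 1 - ρ.character g) =
        ∑ g : N, ((j g : ℂ) + 1) * (ρ.character 1 - ρ.character g) := by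
      rw [Finset.sum_erase _ (by simp), ← Finset.sum_subset (Finset.subset_univ
        (Finset.univ.filter (fun g => g ∈ N))) (fun g _ hg => by
          rw [hout g (by simpa using hg), Int.cast_zero, zero_mul]),
        ← Finset.sum_subtype_eq_sum_filter, Finset.subtype_univ]
      refine Finset.sum_congr rfl fun g _ => ?_
      rcases eq_or_ne g 1 with rfl | hg
      · simp
      · rw [hj g hg]
        push_cast
        rfl
    have h4 : ∑ g : N, (j g : ℂ) * (ρ.character 1 - ρ.character g) = Nat.card N * n := hn
    rw [h1, h3]
    simp only [add_mul, one_mul, Finset.sum_add_distrib]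
    rw [h4, Finset.sum_sub_distrib, sum_subgroup_character, Representation.char_one,
      Finset.sum_const, nsmul_eq_mul, Finset.card_univ, ← Nat.card_eq_fintype_card, ← hfC]
    have hf0 : (f : ℂ) ≠ 0 := fun h => hcard (by rw [← hfC, h, zero_mul])
    field_simp
  have hbilin : ∀ χ : G → ℂ, bilinPairing (fun g => (a g : ℂ)) χ =
      (Nat.card G : ℂ)⁻¹ * ∑ g, (a g : ℂ) * χ g := by
    intro χ
    rw [bilinPairing]
    congr 1
    refine Fintype.sum_equiv (Equiv.inv G) _ _ fun g => ?_
    rw [Equiv.inv_apply, hainv]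
  have hcos : ∀ (V : Type) [AddCommGroup V] [Module ℂ V] [FiniteDimensional ℂ V]
      (ρ : Representation ℂ G V), bilinPairing (cosetCharacter N) ρ.character =
        finrank ℂ (Representation.invariants (ρ.comp N.subtype)) := by
    intro V _ _ _ ρ
    have h1 : ∑ g, cosetCharacter N g * ρ.character g⁻¹ = ∑ g : N, f * ρ.character g := by
      have h2 : ∀ g, cosetCharacter N g * ρ.character g⁻¹ =
          if g ∈ N then (f : ℂ) * ρ.character g⁻¹ else 0 := fun g => by
        rw [cosetCharacter_apply, hindex, ite_mul, zero_mul]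
      rw [Finset.sum_congr rfl fun g _ => h2 g, ← Finset.sum_filter,
        ← Finset.sum_subtype_eq_sum_filter, Finset.subtype_univ]
      exact Fintype.sum_equiv (Equiv.inv N) _ _ fun g => rfl
    rw [bilinPairing, h1, ← Finset.mul_sum, sum_subgroup_character, ← mul_assoc (f : ℂ), hfC,
      inv_mul_cancel_left₀ hcard]
  have hreg : ∀ (V : Type) [AddCommGroup V] [Module ℂ V] [FiniteDimensional ℂ V]
      (ρ : Representation ℂ G V), bilinPairing (regularCharacter G) ρ.character = finrank ℂ V := by
    intro V _ _ _ ρ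
    simp only [bilinPairing, regularCharacter_apply]
    simp
  have hle : ∀ (V : Type) [AddCommGroup V] [Module ℂ V] [FiniteDimensional ℂ V]
      (ρ : Representation ℂ G V),
      finrank ℂ (Representation.invariants (ρ.comp N.subtype)) ≤ finrank ℂ V :=
    fun V _ _ _ ρ => Submodule.finrank_le _
  have hnat : ∀ (V : Type) [AddCommGroup V] [Module ℂ V] [FiniteDimensional ℂ V]
      (ρ : Representation ℂ G V), ∃ n : ℕ,
      (Nat.card G : ℂ)⁻¹ * ∑ g, (a g : ℂ) * ρ.character g = n := by
    intro V _ _ _ ρ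
    obtain ⟨n, hn⟩ := hsum V ρ
    refine ⟨n + (finrank ℂ V - finrank ℂ (Representation.invariants (ρ.comp N.subtype))), ?_⟩
    rw [hn, Nat.cast_add, Nat.cast_sub (hle V ρ)]
  refine ⟨?_, ?_, ?_⟩
  · refine isComplexCharacter_of_bilinPairing (fun c g => by simp only [haconj]) ?_
    rintro χ ⟨V, _, _, _, ρ, rfl⟩
    rw [hbilin]
    exact hnat V ρ
  · rintro χ ⟨V, _, _, _, ρ, rfl⟩
    obtain ⟨n, hn⟩ := hnat V ρ
    refine ⟨n, ?_⟩
    -- the pairing is the complex conjugate of a natural number, as `a` is real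
    have h1 := congrArg (starRingEnd ℂ) hn
    rw [map_mul, map_sum, map_inv₀, map_natCast, map_natCast] at h1
    rw [charPairing, ← Nat.card_eq_fintype_card, ← h1]
    congr 1
    refine Finset.sum_congr rfl fun g _ => ?_
    rw [map_mul, map_intCast]
  · refine isComplexCharacter_of_bilinPairing
      (fun c g => by simp only [haconj, hregconj, hcosconj]) ?_
    rintro χ ⟨V, _, _, _, ρ, rfl⟩
    obtain ⟨n, hn⟩ := hsum V ρ
    refine ⟨n, ?_⟩
    have h1 : (fun g => (a g : ℂ) - (regularCharacter G g - cosetCharacter N g)) =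
        (fun g => (a g : ℂ)) - (regularCharacter G - cosetCharacter N) := rfl
    rw [h1, bilinPairing_sub_left, bilinPairing_sub_left, hbilin, hn, hcos, hreg]
    ring

end Representations

end ArtinSwan

namespace ArtinSwan

/-! ### Galois invariance of the valuation -/

open WithZero

section Invariance

lemma isRankOneDiscrete_of_surjective {F : Type*} [Field F] {v : Valuation F ℤᵐ⁰}
    (hv : Function.Surjective v) : v.IsRankOneDiscrete := by
  refine ⟨Units.mk0 (exp (-1)) exp_ne_zero, ?_, ?_⟩
  · refine le_antisymm ?_ ?_
    · rw [Subgroup.zpowers_le]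
      obtain ⟨x, hx⟩ := hv (exp (-1))
      exact MonoidWithZeroHom.mem_valueGroup _ ⟨x, hx⟩
    · intro u _
      refine ⟨-log (u : ℤᵐ⁰), Units.ext ?_⟩
      simp only [Units.val_zpow_eq_zpow_val, Units.val_mk0]
      rw [← exp_zsmul]
      simp [exp_log u.ne_zero]
  · rw [← Units.val_lt_val]
    change (exp (-1) : ℤᵐ⁰) < 1
    rw [← exp_zero, exp_lt_exp]
    omega

variable {K L : Type*} [Field K] [Field L] [Algebra K L] [Valued K ℤᵐ⁰] [Valued L ℤᵐ⁰]
  [Valuation.HasExtension (Valued.v : Valuation K ℤᵐ⁰) (Valued.v : Valuation L ℤᵐ⁰)]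

/-- The valuation of `L` restricts to a multiple of that of `K`. -/
lemma exists_val_algebraMap_eq (hK : Function.Surjective (Valued.v : Valuation K ℤᵐ⁰)) :
    ∃ e : ℕ, 0 < e ∧ ∀ x : K, (Valued.v (algebraMap K L x) : ℤᵐ⁰) = Valued.v x ^ e := by
  obtain ⟨ϖ, hϖ⟩ := hK (exp (-1))
  have hϖ0 : ϖ ≠ 0 := by
    rintro rfl
    rw [map_zero] at hϖ
    exact exp_ne_zero hϖ.symm
  have hϖL : (Valued.v (algebraMap K L ϖ) : ℤᵐ⁰) ≠ 0 := by
    rw [Valuation.ne_zero_iff]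
    exact (map_ne_zero _).2 hϖ0
  have hlt : (Valued.v (algebraMap K L ϖ) : ℤᵐ⁰) < 1 := by
    rw [Valuation.HasExtension.val_map_lt_one_iff (Valued.v : Valuation K ℤᵐ⁰), hϖ, ← exp_zero,
      exp_lt_exp]
    omega
  rw [lt_one_iff_le_exp_neg_one, ← exp_log hϖL, exp_le_exp] at hlt
  refine ⟨(-log (Valued.v (algebraMap K L ϖ) : ℤᵐ⁰)).toNat, by omega, fun x => ?_⟩
  rcases eq_or_ne x 0 with rfl | hx
  · rw [map_zero, map_zero, map_zero, zero_pow (by omega)]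
  have hvx : (Valued.v x : ℤᵐ⁰) ≠ 0 := (Valuation.ne_zero_iff _).2 hx
  -- `x ϖ ^ n` is a unit for `n = log (v x)`
  have h1 : (Valued.v (x * ϖ ^ log (Valued.v x : ℤᵐ⁰)) : ℤᵐ⁰) = 1 := by
    rw [map_mul, map_zpow₀, hϖ, ← exp_zsmul]
    nth_rewrite 1 [← exp_log hvx]
    rw [← exp_add]
    simp
  have h2 := (Valuation.HasExtension.val_map_eq_one_iff (Valued.v : Valuation K ℤᵐ⁰)
    (Valued.v : Valuation L ℤᵐ⁰) _).2 h1
  rw [map_mul, map_mul, map_zpow₀, map_zpow₀] at h2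
  rw [eq_inv_of_mul_eq_one_left h2, ← exp_log hϖL, ← exp_log hvx, ← exp_zsmul, ← exp_nsmul,
    ← exp_neg, log_exp, log_exp]
  congr 1
  rw [nsmul_eq_mul, zsmul_eq_mul, Int.toNat_of_nonneg (by omega)]
  simp [mul_comm]

variable [CompleteSpace K] [Algebra.IsAlgebraic K L]

/-- A discrete valuation on an algebraic extension `L` of a complete field `K` is invariant under
`K`-automorphisms, because the corresponding absolute value is the spectral norm. -/
theorem val_algEquiv (hK : Function.Surjective (Valued.v : Valuation K ℤᵐ⁰)) (g : L ≃ₐ[K] L)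
    (y : L) : (Valued.v (g y) : ℤᵐ⁰) = Valued.v y := by
  obtain ⟨e, he, hval⟩ := exists_val_algebraMap_eq (L := L) hK
  have := isRankOneDiscrete_of_surjective hK
  -- with base `2 ^ e` on `K` and base `2` on `L`, the absolute value of `L` extends that of `K`
  have he2 : (1 : NNReal) < 2 ^ e := one_lt_pow₀ one_lt_two he.ne'
  let _ : (Valued.v : Valuation K ℤᵐ⁰).RankOne :=
    Valuation.IsRankOneDiscrete.rankOne (Valued.v : Valuation K ℤᵐ⁰) he2
  let _ : NontriviallyNormedField K := Valued.toNontriviallyNormedField K ℤᵐ⁰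
  let f : AbsoluteValue L ℝ :=
    { toFun := fun y => WithZeroMulInt.toNNReal (two_ne_zero : (2 : NNReal) ≠ 0) (Valued.v y)
      map_mul' := fun x y => by rw [map_mul, map_mul, NNReal.coe_mul]
      nonneg' := fun x => NNReal.coe_nonneg _
      eq_zero' := fun x => by
        rw [NNReal.coe_eq_zero, map_eq_zero, map_eq_zero]
      add_le' := fun x y => by
        have hmono := (WithZeroMulInt.toNNReal_strictMono (one_lt_two : (1 : NNReal) < 2)).monotone
        have h1 := hmono (Valuation.map_add Valued.v x y)
        rw [hmono.map_max] at h1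
        exact_mod_cast h1.trans (max_le_add_of_nonneg zero_le zero_le) }
  have hf : ∀ x : K, f (algebraMap K L x) = ‖x‖ := by
    intro x
    have h1 : ‖x‖ = WithZeroMulInt.toNNReal (zero_lt_one.trans he2).ne' (Valued.v x : ℤᵐ⁰) := by
      rw [←
        Valuation.IsRankOneDiscrete.valueGroup₀_equiv_withZeroMulInt_restrict_apply_of_surjective
        hK x]
      rfl
    rw [h1]
    change ((WithZeroMulInt.toNNReal _ _ : NNReal) : ℝ) = _
    rw [hval, map_pow]
    congr 1
    rcases eq_or_ne (Valued.v x : ℤᵐ⁰) 0 with h0 | h0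
    · rw [h0, map_zero, map_zero, zero_pow he.ne']
    · rw [WithZeroMulInt.toNNReal_neg_apply _ h0, WithZeroMulInt.toNNReal_neg_apply _ h0,
        ← zpow_natCast, ← zpow_natCast, zpow_comm]
  have h1 : f (g y) = f y := by
    rw [spectralNorm_unique_field_norm_ext hf, spectralNorm_unique_field_norm_ext hf,
      ← spectralNorm_eq_of_equiv]
  exact (WithZeroMulInt.toNNReal_strictMono (one_lt_two : (1 : NNReal) < 2)).injective
    (NNReal.coe_injective h1)

end Invariance

end ArtinSwan

namespace ArtinSwan

/-! ### Finite extensions of local rings with separable residue extension -/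

section LocalRings

open IsLocalRing Polynomial

variable {A B : Type*} [CommRing A] [IsLocalRing A] [CommRing B] [IsLocalRing B] [Algebra A B]

/-- Let `B` be finite over `A` with principal maximal ideal `(ϖ)`. A subalgebra that contains `ϖ`
and represents all residue classes is all of `B`: it is dense for the `ϖ`-adic topology, and
Nakayama's lemma applies. -/
theorem subalgebra_eq_top_of_residue [Module.Finite A B] {S : Subalgebra A B} {ϖ : B} (hϖS : ϖ ∈ S)
    (hϖ : maximalIdeal B = Ideal.span {ϖ})
    (hpow : ∃ n, ϖ ^ n ∈ (maximalIdeal A).map (algebraMap A B))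
    (hS : ∀ y : B, ∃ s ∈ S, residue B s = residue B y) : S = ⊤ := by
  have happrox : ∀ (n : ℕ) (y : B), ∃ s ∈ S, ∃ z, y = s + ϖ ^ n * z := by
    intro n
    induction n with
    | zero => exact fun y => ⟨0, S.zero_mem, y, by simp⟩
    | succ n ih =>
      intro y
      obtain ⟨s, hs, z, rfl⟩ := ih y
      obtain ⟨t, ht, htz⟩ := hS z
      rw [← sub_eq_zero, ← map_sub, residue_eq_zero_iff, hϖ, Ideal.mem_span_singleton'] at htz
      obtain ⟨w, hw⟩ := htz
      refine ⟨s + ϖ ^ n * t, S.add_mem hs (S.mul_mem (S.pow_mem hϖS n) ht), -w, ?_⟩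
      linear_combination ϖ ^ n * hw
  obtain ⟨n, hn⟩ := hpow
  have h1 : (⊤ : Submodule A B) ≤ Subalgebra.toSubmodule S := by
    refine Submodule.le_of_le_smul_of_le_jacobson_bot (I := maximalIdeal A) Module.Finite.fg_top
      (by rw [jacobson_eq_maximalIdeal _ bot_ne_top]) ?_
    intro y _
    obtain ⟨s, hs, z, rfl⟩ := happrox n y
    refine Submodule.add_mem_sup hs ?_
    rw [Ideal.smul_top_eq_map]
    exact Ideal.mul_mem_right _ _ hn
  exact Algebra.toSubmodule_eq_top.1 (top_le_iff.1 h1)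

variable [IsLocalHom (algebraMap A B)]

/-- A finite extension of local rings with separable residue extension is monogenic if the maximal
ideal of the upper ring is principal. If `x` lifts a primitive element of the residue extension and
`q` lifts its minimal polynomial, then `q(x)` or `q(x + ϖ)` generates the maximal ideal. -/
theorem exists_adjoin_eq_top [Module.Finite A B]
    [Algebra.IsSeparable (ResidueField A) (ResidueField B)] {ϖ : B}
    (hϖ : maximalIdeal B = Ideal.span {ϖ})
    (hpow : ∃ n, ϖ ^ n ∈ (maximalIdeal A).map (algebraMap A B)) :
    ∃ x : B, Algebra.adjoin A {x} = ⊤ := by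
  obtain ⟨α, hα⟩ := Field.exists_primitive_element (ResidueField A) (ResidueField B)
  obtain ⟨q, hq⟩ := map_surjective _ residue_surjective (minpoly (ResidueField A) α)
  have hres : ∀ (p : A[X]) (y : B), residue B (aeval y p) =
      aeval (residue B y) (p.map (residue A)) := by
    intro p y
    rw [aeval_def, aeval_def, eval₂_map, hom_eval₂]
    rfl
  have hkey : ∀ x : B, residue B x = α → maximalIdeal B = Ideal.span {aeval x q} →
      Algebra.adjoin A {x} = ⊤ := by
    intro x hx hspan
    have hmem : ∀ p : A[X], aeval x p ∈ Algebra.adjoin A {x} := fun p =>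
      aeval_mem_adjoin_singleton A x
    obtain ⟨n, hn⟩ := hpow
    refine subalgebra_eq_top_of_residue (hmem q) hspan ⟨n, ?_⟩ fun y => ?_
    · have h1 : aeval x q ∈ Ideal.span {ϖ} := by
        rw [← hϖ, hspan]
        exact Ideal.mem_span_singleton_self _
      obtain ⟨c, hc⟩ := Ideal.mem_span_singleton'.1 h1
      rw [← hc, mul_pow]
      exact Ideal.mul_mem_left _ _ hn
    · have h1 : residue B y ∈ (IntermediateField.adjoin (ResidueField A) {α}).toSubalgebra := by
        rw [hα]
        exact IntermediateField.mem_top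
      rw [IntermediateField.adjoin_simple_toSubalgebra_of_isAlgebraic
        (Algebra.IsAlgebraic.isAlgebraic α), Algebra.adjoin_singleton_eq_range_aeval] at h1
      obtain ⟨p, hp⟩ := h1
      obtain ⟨P, rfl⟩ := map_surjective _ residue_surjective p
      exact ⟨aeval x P, hmem P, by rw [hres, hx]; exact hp⟩
  obtain ⟨x, hx⟩ := residue_surjective α
  have hqx : aeval x q ∈ maximalIdeal B := by
    rw [← residue_eq_zero_iff, hres, hx, hq, minpoly.aeval]
  by_cases hgen : maximalIdeal B = Ideal.span {aeval x q}
  · exact ⟨x, hkey x hx hgen⟩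
  have hϖm : ϖ ∈ maximalIdeal B := hϖ ▸ Ideal.mem_span_singleton_self ϖ
  refine ⟨x + ϖ, hkey _ ?_ ?_⟩
  · rw [map_add, (residue_eq_zero_iff ϖ).2 hϖm, add_zero, hx]
  obtain ⟨w, hw⟩ := Ideal.mem_span_singleton'.1 (hϖ ▸ hqx)
  have hw' : w ∈ maximalIdeal B := by
    by_contra hwu
    rw [mem_maximalIdeal, mem_nonunits_iff, not_not] at hwu
    refine hgen ?_
    rw [hϖ, ← hw, Ideal.span_singleton_mul_left_unit hwu]
  have hderiv : IsUnit (aeval x (derivative q)) := by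
    rw [← residue_ne_zero_iff_isUnit, hres, hx, ← derivative_map, hq]
    exact (Algebra.IsSeparable.isSeparable (ResidueField A) α).aeval_derivative_ne_zero
      (minpoly.aeval _ _)
  obtain ⟨k, hk⟩ := (q.map (algebraMap A B)).binomExpansion x ϖ
  rw [derivative_map, eval_map_algebraMap, eval_map_algebraMap, eval_map_algebraMap, ← hw] at hk
  have hfac : aeval (x + ϖ) q = (aeval x (derivative q) + (w + k * ϖ)) * ϖ := by
    rw [hk]
    ring
  have hunit : IsUnit (aeval x (derivative q) + (w + k * ϖ)) := by
    rw [← residue_ne_zero_iff_isUnit, map_add, (residue_eq_zero_iff (w + k * ϖ)).2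
      (Ideal.add_mem _ hw' (Ideal.mul_mem_left _ _ hϖm)), add_zero, residue_ne_zero_iff_isUnit]
    exact hderiv
  rw [hfac, Ideal.span_singleton_mul_left_unit hunit, hϖ]

/-- Let a finite group `H` act on `B` by `A`-algebra automorphisms, where the residue extension of
`B / A` is separable. If the residue class of `y` is invariant under `H`, it is represented by an
element of the fixed ring: over the residue field of the fixed ring, it is separable and a root of
a polynomial that is a power of a linear one. -/
theorem exists_fixed_residue_eq (H : Type*) [Group H] [Finite H] [MulSemiringAction H B]
    [SMulCommClass H A B] [Algebra.IsSeparable (ResidueField A) (ResidueField B)] {y : B}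
    (hy : ∀ h : H, residue B (h • y) = residue B y) :
    ∃ a : B, (∀ h : H, h • a = a) ∧ residue B a = residue B y := by
  have := Fintype.ofFinite H
  let R := FixedPoints.subalgebra A B H
  let φ : R →+* ResidueField B := (residue B).comp R.val.toRingHom
  -- the image of the fixed ring is a field
  let F : IntermediateField (ResidueField A) (ResidueField B) :=
    { φ.range with
      algebraMap_mem' := fun r => by
        obtain ⟨a, rfl⟩ := residue_surjective r
        exact ⟨algebraMap A R a, rfl⟩
      inv_mem' := by
        rintro _ ⟨b, rfl⟩
        by_cases hb : φ b = 0
        · exact ⟨0, by rw [hb, inv_zero, map_zero]⟩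
        obtain ⟨c, hc⟩ := isUnit_iff_exists_inv.1 ((residue_ne_zero_iff_isUnit (b : B)).1 hb)
        have hcR : ∀ h : H, h • c = c := fun h => by
          have h1 : (b : B) * h • c = 1 := by
            have h2 := congrArg (h • ·) hc
            simp only [smul_mul', smul_one] at h2
            rwa [b.2 h] at h2
          calc h • c = (b * c) * h • c := by rw [hc, one_mul]
            _ = c := by rw [mul_right_comm, h1, one_mul]
        refine ⟨⟨c, hcR⟩, eq_inv_of_mul_eq_one_right ?_⟩
        change residue B b * residue B c = 1
        rw [← map_mul, hc, map_one] }
  have hF : ∀ r : R, φ r ∈ F := fun r => ⟨r, rfl⟩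
  let ψ : R →+* F := φ.codRestrict F.toSubring hF
  obtain ⟨P, hP⟩ : ∃ P : R[X], P.map R.val.toRingHom = MulSemiringAction.charpoly H y := by
    rw [← mem_lifts, lifts_iff_coeff_lifts]
    exact fun n => ⟨⟨_, fun h => MulSemiringAction.smul_coeff_charpoly y n h⟩, rfl⟩
  have hPF : (P.map ψ).map (algebraMap F (ResidueField B)) =
      (X - C (residue B y)) ^ Fintype.card H := by
    have h1 : (algebraMap F (ResidueField B)).comp ψ = (residue B).comp R.val.toRingHom := rfl
    rw [map_map, h1, ← map_map, hP, MulSemiringAction.charpoly_eq, Polynomial.map_prod]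
    simp [hy]
  have hsep : ((minpoly F (residue B y)).map (algebraMap F (ResidueField B))).Separable :=
    Separable.map (Algebra.IsSeparable.isSeparable F (residue B y))
  have hdvd : (minpoly F (residue B y)).map (algebraMap F (ResidueField B)) ∣
      (X - C (residue B y)) ^ Fintype.card H := by
    rw [← hPF]
    refine Polynomial.map_dvd _ (minpoly.dvd F _ ?_)
    rw [← eval_map_algebraMap, hPF, eval_pow, eval_sub, eval_X, eval_C, sub_self,
      zero_pow Fintype.card_ne_zero]
  rw [hsep.squarefree.dvd_pow_iff_dvd Fintype.card_ne_zero] at hdvd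
  have hdeg := natDegree_le_of_dvd hdvd (X_sub_C_ne_zero _)
  rw [natDegree_X_sub_C, natDegree_map] at hdeg
  have hint : IsIntegral F (residue B y) := Algebra.IsIntegral.isIntegral _
  obtain ⟨⟨_, ⟨a, rfl⟩⟩, ha⟩ := minpoly.natDegree_eq_one_iff.1
    (le_antisymm hdeg (minpoly.natDegree_pos hint))
  exact ⟨a, a.2, ha⟩

end LocalRings

end ArtinSwan

namespace ArtinSwan

/-! ### The valuation ring of a finite Galois extension -/

open WithZero

section Galois

open IsLocalRing Polynomial

lemma isDiscreteValuationRing_valRing {F : Type*} [Field F] [Valued F ℤᵐ⁰]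
    (hF : Function.Surjective (Valued.v : Valuation F ℤᵐ⁰)) :
    IsDiscreteValuationRing (valRing F) := by
  have := isRankOneDiscrete_of_surjective hF
  infer_instance

lemma maximalIdeal_valRing_eq_span {F : Type*} [Field F] [Valued F ℤᵐ⁰] {ϖ : valRing F}
    (hϖ : (Valued.v (ϖ : F) : ℤᵐ⁰) = exp (-1)) :
    maximalIdeal (valRing F) = Ideal.span {ϖ} := by
  have hϖ0 := ne_zero_of_val_eq_exp hϖ
  ext y
  rw [Valuation.mem_maximalIdeal_iff, Ideal.mem_span_singleton', lt_one_iff_le_exp_neg_one]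
  constructor
  · intro hy
    refine ⟨⟨y / ϖ, ?_⟩, Subtype.ext (div_mul_cancel₀ _ hϖ0)⟩
    rw [Valuation.mem_valuationSubring_iff, map_div₀, hϖ]
    exact div_le_one_of_le₀ hy zero_le
  · rintro ⟨z, rfl⟩
    change (Valued.v ((z : F) * ϖ) : ℤᵐ⁰) ≤ _
    rw [map_mul, hϖ]
    exact mul_le_of_le_one_left' z.2

variable {K L : Type*} [Field K] [Field L] [Algebra K L] [Valued K ℤᵐ⁰] [Valued L ℤᵐ⁰]
  [Valuation.HasExtension (Valued.v : Valuation K ℤᵐ⁰) (Valued.v : Valuation L ℤᵐ⁰)]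
  [CompleteSpace K] [FiniteDimensional K L]

omit [CompleteSpace K] [FiniteDimensional K L] in
lemma exists_pow_mem_map_maximalIdeal (hK : Function.Surjective (Valued.v : Valuation K ℤᵐ⁰))
    {ϖ : valRing L} (hϖ : (Valued.v (ϖ : L) : ℤᵐ⁰) = exp (-1)) :
    ∃ n, ϖ ^ n ∈ (maximalIdeal (valRing K)).map (algebraMap (valRing K) (valRing L)) := by
  obtain ⟨e, he, hval⟩ := exists_val_algebraMap_eq (L := L) hK
  obtain ⟨p, hp⟩ := hK (exp (-1))
  have hp1 : (Valued.v p : ℤᵐ⁰) < 1 := by rw [lt_one_iff_le_exp_neg_one, hp]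
  let p' : valRing K := ⟨p, hp1.le⟩
  have hp0 : algebraMap K L p ≠ 0 := (_root_.map_ne_zero _).2 (ne_zero_of_val_eq_exp hp)
  have hv : (Valued.v ((ϖ : L) ^ e / algebraMap K L p) : ℤᵐ⁰) = 1 := by
    rw [map_div₀, map_pow, hval, hϖ, hp, div_self (pow_ne_zero _ exp_ne_zero)]
  refine ⟨e, ?_⟩
  have h1 : ϖ ^ e = ⟨(ϖ : L) ^ e / algebraMap K L p, hv.le⟩ *
      algebraMap (valRing K) (valRing L) p' :=
    Subtype.ext (div_mul_cancel₀ _ hp0).symm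
  rw [h1]
  exact Ideal.mul_mem_left _ _ (Ideal.mem_map_of_mem _ ((Valuation.mem_maximalIdeal_iff _ _).2 hp1))

/-- The action of the Galois group on the valuation ring. -/
@[reducible]
def galoisAction (hK : Function.Surjective (Valued.v : Valuation K ℤᵐ⁰)) :
    MulSemiringAction (L ≃ₐ[K] L) (valRing L) where
  smul g y := ⟨g y, (val_algEquiv hK g y).trans_le y.2⟩
  one_smul _ := rfl
  mul_smul _ _ _ := rfl
  smul_zero g := Subtype.ext (map_zero g)
  smul_add g _ _ := Subtype.ext (map_add g _ _)
  smul_one g := Subtype.ext (map_one g)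
  smul_mul g _ _ := Subtype.ext (map_mul g _ _)

lemma smulCommClass_galoisAction (hK : Function.Surjective (Valued.v : Valuation K ℤᵐ⁰)) :
    letI := galoisAction (L := L) hK
    SMulCommClass (L ≃ₐ[K] L) (valRing K) (valRing L) := by
  let _ := galoisAction (L := L) hK
  refine ⟨fun g a y => Subtype.ext ?_⟩
  exact map_smul g (a : K) (y : L)

open scoped Pointwise in
lemma decompositionSubgroup_eq_top (hK : Function.Surjective (Valued.v : Valuation K ℤᵐ⁰)) :
    (valRing L).decompositionSubgroup K = ⊤ := by
  refine top_le_iff.1 fun g _ => ?_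
  rw [MulAction.mem_stabilizer_iff]
  ext x
  rw [ValuationSubring.mem_pointwise_smul_iff_inv_smul_mem, Valuation.mem_valuationSubring_iff,
    Valuation.mem_valuationSubring_iff, AlgEquiv.smul_def, val_algEquiv hK]

lemma mem_inertia_iff (hK : Function.Surjective (Valued.v : Valuation K ℤᵐ⁰)) {g : L ≃ₐ[K] L} :
    g ∈ inertia K L ↔ ∀ y : L, (Valued.v y : ℤᵐ⁰) ≤ 1 → (Valued.v (g y - y) : ℤᵐ⁰) < 1 := by
  have key : ∀ d : (valRing L).decompositionSubgroup K,
      d ∈ (valRing L).inertiaSubgroup K ↔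
        ∀ y : L, (Valued.v y : ℤᵐ⁰) ≤ 1 → (Valued.v ((d : L ≃ₐ[K] L) y - y) : ℤᵐ⁰) < 1 := by
    intro d
    rw [ValuationSubring.inertiaSubgroup, MonoidHom.mem_ker]
    constructor
    · intro h y hy
      have h1 := DFunLike.congr_fun h (residue (valRing L) ⟨y, hy⟩)
      exact (IsTotallyRamified.residue_eq_residue_iff (Valued.v : Valuation L ℤᵐ⁰) _ _).1 h1
    · intro h
      refine RingEquiv.ext fun r => ?_
      obtain ⟨y, rfl⟩ := residue_surjective r
      exact (IsTotallyRamified.residue_eq_residue_iff (Valued.v : Valuation L ℤᵐ⁰) _ _).2 (h y y.2)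
  rw [inertia, Subgroup.mem_map]
  constructor
  · rintro ⟨d, hd, rfl⟩
    exact (key d).1 hd
  · intro h
    have hg : g ∈ (valRing L).decompositionSubgroup K := by
      rw [decompositionSubgroup_eq_top hK]
      exact Subgroup.mem_top g
    exact ⟨⟨g, hg⟩, (key _).2 h, rfl⟩

variable [IsGalois K L]

omit [Valued K ℤᵐ⁰] [Valued L ℤᵐ⁰] [CompleteSpace K]
  [Valuation.HasExtension (Valued.v : Valuation K ℤᵐ⁰) (Valued.v : Valuation L ℤᵐ⁰)] in
lemma exists_algebraMap_eq_of_fixed {y : L} (hy : ∀ g : L ≃ₐ[K] L, g y = y) :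
    ∃ a : K, algebraMap K L a = y :=
  (IsGalois.mem_range_algebraMap_iff_fixed y).2 hy

lemma finite_valRing (hK : Function.Surjective (Valued.v : Valuation K ℤᵐ⁰)) :
    Module.Finite (valRing K) (valRing L) := by
  let _ := galoisAction (L := L) hK
  have := smulCommClass_galoisAction (L := L) hK
  have : Algebra.IsInvariant (valRing K) (valRing L) (L ≃ₐ[K] L) := ⟨fun y hy => by
    obtain ⟨a, ha⟩ := exists_algebraMap_eq_of_fixed fun g => congrArg Subtype.val (hy g)
    have hva : (Valued.v a : ℤᵐ⁰) ≤ 1 := by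
      rw [← Valuation.HasExtension.val_map_le_one_iff (Valued.v : Valuation K ℤᵐ⁰)
        (Valued.v : Valuation L ℤᵐ⁰), ha]
      exact y.2
    exact ⟨⟨a, hva⟩, Subtype.ext ha⟩⟩
  have hint : Algebra.IsIntegral (valRing K) (valRing L) :=
    Algebra.IsInvariant.isIntegral _ _ (L ≃ₐ[K] L)
  have : IsIntegralClosure (valRing L) (valRing K) L :=
    { algebraMap_injective := Subtype.val_injective
      isIntegral_iff := fun {x} => by
        constructor
        · intro hx
          exact IsIntegrallyClosed.isIntegral_iff.1 (hx.tower_top (A := valRing L))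
        · rintro ⟨y, rfl⟩
          exact (hint.isIntegral y).algebraMap }
  have := isDiscreteValuationRing_valRing hK
  exact IsIntegralClosure.finite (valRing K) K L (valRing L)

variable [Algebra.IsSeparable (resField K) (resField L)]

theorem exists_adjoin_valRing_eq_top (hK : Function.Surjective (Valued.v : Valuation K ℤᵐ⁰))
    (hL : Function.Surjective (Valued.v : Valuation L ℤᵐ⁰)) :
    ∃ x : valRing L, Algebra.adjoin (valRing K) {x} = ⊤ := by
  obtain ⟨π, hπ⟩ := hL (exp (-1))
  have hπ1 : (Valued.v π : ℤᵐ⁰) ≤ 1 := (lt_one_iff_le_exp_neg_one.2 hπ.le).le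
  have := finite_valRing (L := L) hK
  exact exists_adjoin_eq_top (maximalIdeal_valRing_eq_span (ϖ := ⟨π, hπ1⟩) hπ)
    (exists_pow_mem_map_maximalIdeal hK hπ)

/-- The inertia group is totally ramified. Indeed all residue classes are represented by elements of
the fixed ring `R` of the inertia group `H`, so the valuation ring is `R[π]`. Hence the powers
`π ^ i`, `i < |H|`, are a basis of it over `R`. If the valuation `r` of an element `a` of `R`
satisfied `0 < r < |H|`, then `a⁻¹ π ^ r` would be an integral element with a nonintegral coefficient. -/
theorem isTotallyRamified_inertia (hK : Function.Surjective (Valued.v : Valuation K ℤᵐ⁰))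
    (hL : Function.Surjective (Valued.v : Valuation L ℤᵐ⁰)) :
    IsTotallyRamified (Valued.v : Valuation L ℤᵐ⁰) (inertia K L) := by
  classical
  let _ := galoisAction (L := L) hK
  have := smulCommClass_galoisAction (L := L) hK
  have := finite_valRing (L := L) hK
  set H := inertia K L with hH
  have : SMulCommClass H (valRing K) (valRing L) := ⟨fun h => smul_comm (h : L ≃ₐ[K] L)⟩
  have := Fintype.ofFinite H
  have hcard : Nat.card H = Fintype.card H := Nat.card_eq_fintype_card
  have hsmul : ∀ (h : H) (y : L), (Valued.v (h • y) : ℤᵐ⁰) = Valued.v y := fun h y =>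
    val_algEquiv hK h y
  obtain ⟨π', hπ⟩ := hL (exp (-1))
  have hπ0 := ne_zero_of_val_eq_exp hπ
  have hπ1 : (Valued.v π' : ℤᵐ⁰) ≤ 1 := (lt_one_iff_le_exp_neg_one.2 hπ.le).le
  let π : valRing L := ⟨π', hπ1⟩
  let R := FixedPoints.subalgebra (valRing K) (valRing L) H
  have htop : (Algebra.adjoin R {π}).restrictScalars (valRing K) = ⊤ := by
    refine subalgebra_eq_top_of_residue (ϖ := π) (Algebra.self_mem_adjoin_singleton R π)
      (maximalIdeal_valRing_eq_span hπ) (exists_pow_mem_map_maximalIdeal hK hπ) fun y => ?_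
    obtain ⟨a, ha, hay⟩ := exists_fixed_residue_eq (A := valRing K) H (y := y) fun h =>
      (IsTotallyRamified.residue_eq_residue_iff (Valued.v : Valuation L ℤᵐ⁰) _ _).2
        ((mem_inertia_iff hK).1 h.2 y y.2)
    exact ⟨a, (Algebra.adjoin R {π}).algebraMap_mem ⟨a, ha⟩, hay⟩
  have hpoly : ∀ y : valRing L, ∃ p : R[X], aeval π p = y := by
    intro y
    have h1 : y ∈ Algebra.adjoin R {π} := by
      change y ∈ (Algebra.adjoin R {π}).restrictScalars (valRing K)
      rw [htop]
      exact Algebra.mem_top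
    rwa [Algebra.adjoin_singleton_eq_range_aeval] at h1
  have hsmul_aeval : ∀ (h : H) (p : R[X]), h • aeval π p = aeval (h • π) p := by
    intro h p
    rw [aeval_eq_sum_range, aeval_eq_sum_range, Finset.smul_sum]
    refine Finset.sum_congr rfl fun i _ => ?_
    rw [Algebra.smul_def, Algebra.smul_def, smul_mul', smul_pow']
    congr 1
    exact (p.coeff i).2 h
  -- reduction modulo the characteristic polynomial of `π`
  obtain ⟨F, hF, -, hFm⟩ : ∃ F : R[X], F.map (algebraMap R (valRing L)) =
      MulSemiringAction.charpoly H π ∧ F.degree = (MulSemiringAction.charpoly H π).degree ∧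
      F.Monic := by
    refine lifts_and_degree_eq_and_monic ?_ (MulSemiringAction.monic_charpoly H π)
    rw [lifts_iff_coeff_lifts]
    exact fun n => ⟨⟨_, fun h => MulSemiringAction.smul_coeff_charpoly π n h⟩, rfl⟩
  have hFdeg : F.natDegree = Nat.card H := by
    rw [← hFm.natDegree_map (algebraMap R (valRing L)), hF, MulSemiringAction.charpoly_eq,
      natDegree_prod_of_monic _ _ fun h _ => monic_X_sub_C _]
    simp
  have hpoly' : ∀ y : valRing L, ∃ p : R[X], p.natDegree < Nat.card H ∧ aeval π p = y := by
    intro y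
    obtain ⟨p, rfl⟩ := hpoly y
    refine ⟨p %ₘ F, ?_, ?_⟩
    · rw [← hFdeg]
      exact natDegree_modByMonic_lt _ hFm fun h1 => by
        have h2 := Nat.card_pos (α := H)
        rw [← hFdeg, h1, natDegree_one] at h2
        exact h2.ne rfl
    · have h1 : aeval π F = 0 := by
        rw [← eval_map_algebraMap, hF, MulSemiringAction.eval_charpoly]
      exact aeval_modByMonic_eq_self_of_root h1
  have hinj : ∀ h : H, h • π = π → h = 1 := by
    intro h hπh
    have hint : ∀ y : L, (Valued.v y : ℤᵐ⁰) ≤ 1 → h • y = y := by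
      intro y hy
      obtain ⟨p, hp⟩ := hpoly ⟨y, hy⟩
      have h1 := hsmul_aeval h p
      rw [hπh, hp] at h1
      exact congrArg Subtype.val h1
    refine Subtype.ext (AlgEquiv.ext fun y => ?_)
    rcases le_total (Valued.v y : ℤᵐ⁰) 1 with hy | hy
    · exact hint y hy
    · have h1 : h • y⁻¹ = y⁻¹ := hint _ (by rw [map_inv₀]; exact inv_le_one_of_one_le₀ hy)
      rw [smul_inv''] at h1
      exact inv_injective h1
  refine ⟨hL, hsmul, fun a ha hfix => ?_⟩
  by_contra hnd
  set d : ℤ := (Nat.card H : ℤ) with hd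
  have hd0 : 0 < d := Int.natCast_pos.2 Nat.card_pos
  set n := log (Valued.v a : ℤᵐ⁰) with hn
  have hva : (Valued.v a : ℤᵐ⁰) = exp n := val_eq_exp_log ha
  -- normalize the valuation of `a` by a power of the norm of `π`
  let N : L := ∏ h : H, h • π'
  have hNv : (Valued.v N : ℤᵐ⁰) = exp (-d) := by
    rw [map_prod]
    simp only [hsmul, hπ]
    rw [prod_exp]
    simp [hd]
  have hNfix : ∀ h : H, h • N = N := by
    intro h
    simp only [N]
    rw [Finset.smul_prod_perm]
  obtain ⟨r, hr⟩ : ∃ r : ℕ, (r : ℤ) = (-n) % d :=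
    ⟨_, Int.toNat_of_nonneg (Int.emod_nonneg _ hd0.ne')⟩
  have hrd : r < Nat.card H := by
    have := Int.emod_lt_of_pos (-n) hd0
    omega
  have hr0 : r ≠ 0 := by
    rintro rfl
    refine hnd ?_
    rw [← dvd_neg]
    exact Int.dvd_of_emod_eq_zero hr.symm
  set a' : L := a * N ^ (-((-n) / d)) with ha'
  have hva' : (Valued.v a' : ℤᵐ⁰) = exp (-r : ℤ) := by
    rw [ha', map_mul, map_zpow₀, hNv, hva, ← exp_zsmul, ← exp_add, hr]
    congr 1
    have := Int.emod_add_mul_ediv (-n) d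
    rw [smul_eq_mul]
    linarith
  have ha'0 : a' ≠ 0 := ne_zero_of_val_eq_exp hva'
  have ha'fix : ∀ h : H, h • a' = a' := by
    intro h
    have h1 : h • N ^ (-((-n) / d)) = (h • N) ^ (-((-n) / d)) :=
      map_zpow₀ (h : L ≃ₐ[K] L) _ _
    rw [ha', smul_mul', hfix, h1, hNfix]
  have hvy : (Valued.v (π' ^ r / a') : ℤᵐ⁰) = 1 := by
    rw [map_div₀, val_pow_uniformizer hπ, hva', div_self exp_ne_zero]
  obtain ⟨p, hpdeg, hp⟩ := hpoly' ⟨π' ^ r / a', hvy.le⟩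
  let ι : R →+* L := (valRing L).subtype.comp R.val.toRingHom
  let Q : L[X] := X ^ r - C a' * p.map ι
  have hQdeg : Q.natDegree < Fintype.card H := by
    rw [← hcard]
    refine (natDegree_sub_le _ _).trans_lt (max_lt (by rwa [natDegree_X_pow]) ?_)
    refine (natDegree_C_mul_le _ _).trans_lt (natDegree_map_le.trans_lt hpdeg)
  have hroot : ∀ h : H, Q.eval (h • π') = 0 := by
    intro h
    have h1 : (p.map ι).eval (h • π') = h • (π' ^ r / a') := by
      have h2 := congrArg Subtype.val (hsmul_aeval h p)
      rw [hp] at h2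
      refine Eq.trans ?_ h2.symm
      rw [aeval_def, eval_map]
      exact (hom_eval₂ p (algebraMap R (valRing L)) (valRing L).subtype (h • π)).symm
    simp only [Q]
    rw [eval_sub, eval_pow, eval_X, eval_mul, eval_C, h1, smul_div₀', ha'fix, smul_pow',
      mul_div_cancel₀ _ ha'0, sub_self]
  have hQ : Q = 0 := by
    refine eq_zero_of_natDegree_lt_card_of_eval_eq_zero Q (f := fun h : H => h • π') ?_ hroot hQdeg
    intro h h' (hh : h • π' = h' • π')
    have h1 : (h'⁻¹ * h) • π = π := Subtype.ext (by
      change (h'⁻¹ * h) • π' = π'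
      rw [mul_smul, hh, inv_smul_smul])
    exact (inv_mul_eq_one.1 (hinj _ h1)).symm
  have hcoeff := congrArg (fun q => q.coeff r) hQ
  simp only [Q, coeff_sub, coeff_X_pow, if_true, coeff_C_mul, coeff_map, coeff_zero] at hcoeff
  have h1 : (Valued.v (a' * ι (p.coeff r)) : ℤᵐ⁰) = 1 := by
    rw [← sub_eq_zero.1 hcoeff, map_one]
  have h2 : (Valued.v (ι (p.coeff r)) : ℤᵐ⁰) ≤ 1 := ((p.coeff r : R) : valRing L).2
  rw [map_mul, hva'] at h1
  have h3 : (exp (-r : ℤ) : ℤᵐ⁰) < 1 := by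
    rw [← exp_zero, exp_lt_exp]
    omega
  exact ((mul_le_of_le_one_right' h2).trans_lt h3).ne h1

/-- The residue degree is the index of the inertia group, as `k_K` is the fixed field of the
Galois group acting on `k_L`. -/
theorem resDegree_mul_card_inertia (hK : Function.Surjective (Valued.v : Valuation K ℤᵐ⁰)) :
    resDegree K L * Nat.card (inertia K L) = Nat.card (L ≃ₐ[K] L) := by
  classical
  let _ := galoisAction (L := L) hK
  have := smulCommClass_galoisAction (L := L) hK
  let ρ : (L ≃ₐ[K] L) →* RingAut (resField L) := MulSemiringAction.toRingAut _ _
  have hker : ρ.ker = inertia K L := by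
    ext g
    rw [mem_inertia_iff hK, MonoidHom.mem_ker]
    constructor
    · intro h y hy
      have h1 := DFunLike.congr_fun h (residue (valRing L) ⟨y, hy⟩)
      exact (IsTotallyRamified.residue_eq_residue_iff (Valued.v : Valuation L ℤᵐ⁰) _ _).1 h1
    · intro h
      refine RingEquiv.ext fun r => ?_
      obtain ⟨y, rfl⟩ := residue_surjective r
      exact (IsTotallyRamified.residue_eq_residue_iff (Valued.v : Valuation L ℤᵐ⁰) _ _).2 (h y y.2)
  have := Fintype.ofFinite ρ.range
  have hfix : ∀ r : resField K, algebraMap (resField K) (resField L) r ∈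
      FixedPoints.subfield ρ.range (resField L) := by
    rintro r ⟨_, ⟨g, rfl⟩⟩
    obtain ⟨a, rfl⟩ := residue_surjective r
    change residue (valRing L) (g • algebraMap (valRing K) (valRing L) a) = _
    rw [smul_algebraMap]
    rfl
  let i : resField K →+* FixedPoints.subfield ρ.range (resField L) :=
    (algebraMap (resField K) (resField L)).codRestrict _ hfix
  have hi : Function.Bijective i := by
    refine ⟨i.injective, ?_⟩
    rintro ⟨z, hz⟩
    obtain ⟨y, rfl⟩ := residue_surjective z
    obtain ⟨a, ha, hay⟩ := exists_fixed_residue_eq (A := valRing K) (L ≃ₐ[K] L) (y := y) fun g =>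
      hz ⟨ρ g, g, rfl⟩
    obtain ⟨b, hb⟩ := exists_algebraMap_eq_of_fixed fun g => congrArg Subtype.val (ha g)
    have hvb : (Valued.v b : ℤᵐ⁰) ≤ 1 := by
      rw [← Valuation.HasExtension.val_map_le_one_iff (Valued.v : Valuation K ℤᵐ⁰)
        (Valued.v : Valuation L ℤᵐ⁰), hb]
      exact a.2
    refine ⟨residue _ ⟨b, hvb⟩, Subtype.ext ?_⟩
    exact Eq.trans (congrArg (residue (valRing L)) (Subtype.ext hb)) hay
  have hfin : resDegree K L = Nat.card ρ.range := by
    rw [Nat.card_eq_fintype_card, ← FixedPoints.finrank_eq_card ρ.range (resField L), resDegree]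
    exact Algebra.finrank_eq_of_equiv_equiv (RingEquiv.ofBijective i hi) (RingEquiv.refl _) rfl
  rw [hfin, ← Subgroup.index_ker, hker, Subgroup.index_mul_card]

end Galois

end ArtinSwan

namespace ArtinSwan

/-! ### The function `i_G` -/

open WithZero

section LowerNumbering

variable {K L : Type*} [Field K] [Field L] [Algebra K L] [Valued K ℤᵐ⁰] [Valued L ℤᵐ⁰]
  [Valuation.HasExtension (Valued.v : Valuation K ℤᵐ⁰) (Valued.v : Valuation L ℤᵐ⁰)]
  [CompleteSpace K] [FiniteDimensional K L]

/-- A generator `x` of the valuation ring minimizes the valuation of `g x - x`. -/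
lemma val_sub_le_of_adjoin_eq_top (hK : Function.Surjective (Valued.v : Valuation K ℤᵐ⁰))
    {x : valRing L} (hx : Algebra.adjoin (valRing K) {x} = ⊤) (g : L ≃ₐ[K] L) (y : valRing L) :
    (Valued.v (g (y : L) - y) : ℤᵐ⁰) ≤ Valued.v (g (x : L) - x) := by
  have hy : y ∈ Algebra.adjoin (valRing K) {x} := hx ▸ Algebra.mem_top
  induction hy using Algebra.adjoin_induction with
  | mem y hy =>
    rw [Set.mem_singleton_iff.1 hy]
  | algebraMap a =>
    have h1 : g (algebraMap (valRing K) (valRing L) a : L) = algebraMap K L a := g.commutes a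
    rw [h1, Valuation.HasExtension.coe_algebraMap_valuationSubring_eq, sub_self, map_zero]
    exact zero_le
  | add y z _ _ hy hz =>
    have h1 : g ((y + z : valRing L) : L) - (y + z : valRing L) = (g y - y) + (g z - z) := by
      push_cast
      rw [map_add]
      ring
    rw [h1]
    exact Valuation.map_add_le _ hy hz
  | mul y z _ _ hy hz =>
    have h1 : g ((y * z : valRing L) : L) - (y * z : valRing L) =
        g y * (g z - z) + (g y - y) * z := by
      push_cast
      rw [map_mul]
      ring
    rw [h1]
    refine Valuation.map_add_le _ ?_ ?_
    · rw [map_mul, val_algEquiv hK]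
      exact (mul_le_of_le_one_left' y.2).trans hz
    · rw [map_mul]
      exact (mul_le_of_le_one_right' z.2).trans hy

lemma iG_eq_iG (hK : Function.Surjective (Valued.v : Valuation K ℤᵐ⁰)) {x y : valRing L}
    (hx : Algebra.adjoin (valRing K) {x} = ⊤) (hy : Algebra.adjoin (valRing K) {y} = ⊤)
    (g : L ≃ₐ[K] L) : iG x g = iG y g := by
  rw [iG, iG, addOrd, addOrd, le_antisymm (val_sub_le_of_adjoin_eq_top hK hy g x)
    (val_sub_le_of_adjoin_eq_top hK hx g y)]

lemma iG_inv (hK : Function.Surjective (Valued.v : Valuation K ℤᵐ⁰)) (x : valRing L)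
    (g : L ≃ₐ[K] L) : iG x g⁻¹ = iG x g := by
  rw [iG, iG, addOrd, addOrd, ← val_algEquiv hK g, map_sub, Valuation.map_sub_swap]
  congr 3
  exact congrArg _ (AlgEquiv.apply_symm_apply g _)

/-- Conjugating `g` amounts to replacing the generator of the valuation ring by a conjugate. -/
lemma iG_conj (hK : Function.Surjective (Valued.v : Valuation K ℤᵐ⁰)) {x : valRing L}
    (hx : Algebra.adjoin (valRing K) {x} = ⊤) (c g : L ≃ₐ[K] L) :
    iG x (c * g * c⁻¹) = iG x g := by
  have key : ∀ c g : L ≃ₐ[K] L,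
      (Valued.v ((c * g * c⁻¹) (x : L) - x) : ℤᵐ⁰) ≤ Valued.v (g (x : L) - x) := by
    intro c g
    have h1 := val_sub_le_of_adjoin_eq_top hK hx g
      ⟨c⁻¹ (x : L), (val_algEquiv hK c⁻¹ _).trans_le x.2⟩
    refine le_trans (le_of_eq ?_) h1
    rw [← val_algEquiv hK c (g (c⁻¹ (x : L)) - c⁻¹ (x : L)), map_sub c]
    congr 2
    exact (AlgEquiv.apply_symm_apply c (x : L)).symm
  rw [iG, iG, addOrd, addOrd, le_antisymm (key c g) ?_]
  have h1 := key c⁻¹ (c * g * c⁻¹)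
  rwa [show c⁻¹ * (c * g * c⁻¹) * c⁻¹⁻¹ = g by group] at h1

lemma iG_eq_zero (hK : Function.Surjective (Valued.v : Valuation K ℤᵐ⁰)) {x : valRing L}
    (hx : Algebra.adjoin (valRing K) {x} = ⊤) {g : L ≃ₐ[K] L} (hg : g ∉ inertia K L) :
    iG x g = 0 := by
  rw [mem_inertia_iff hK] at hg
  push Not at hg
  obtain ⟨y, hy, hgy⟩ := hg
  have h1 : (Valued.v (g (x : L) - x) : ℤᵐ⁰) = 1 :=
    le_antisymm (Valuation.map_sub_le _ ((val_algEquiv hK g _).trans_le x.2) x.2)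
      (hgy.trans (val_sub_le_of_adjoin_eq_top hK hx g ⟨y, hy⟩))
  rw [iG, addOrd, h1, log_one, neg_zero]

lemma inertia_normal (hK : Function.Surjective (Valued.v : Valuation K ℤᵐ⁰)) :
    (inertia K L).Normal := by
  refine ⟨fun g hg c => ?_⟩
  rw [mem_inertia_iff hK] at hg ⊢
  intro y hy
  have h1 := hg (c⁻¹ y) ((val_algEquiv hK c⁻¹ y).trans_le hy)
  rw [← val_algEquiv hK c, map_sub] at h1
  refine lt_of_eq_of_lt ?_ h1
  congr 2
  exact (AlgEquiv.apply_symm_apply c y).symm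

variable [IsGalois K L] [Algebra.IsSeparable (resField K) (resField L)]

lemma iG_eq_jump_add_one (hK : Function.Surjective (Valued.v : Valuation K ℤᵐ⁰))
    (hL : Function.Surjective (Valued.v : Valuation L ℤᵐ⁰)) {x : valRing L}
    (hx : Algebra.adjoin (valRing K) {x} = ⊤) {π : L} (hπ : (Valued.v π : ℤᵐ⁰) = exp (-1))
    {g : inertia K L} (hg : g ≠ 1) : iG x (g : L ≃ₐ[K] L) = jump Valued.v π g + 1 := by
  have h := isTotallyRamified_inertia hK hL
  have hπ1 : (Valued.v π : ℤᵐ⁰) ≤ 1 := (lt_one_iff_le_exp_neg_one.2 hπ.le).le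
  have h1 : (Valued.v ((g : L ≃ₐ[K] L) (x : L) - x) : ℤᵐ⁰) = exp (-(jump Valued.v π g + 1)) := by
    rw [← h.val_smul_sub hπ hg]
    exact le_antisymm (h.val_smul_sub_le_of_integral hπ g x.2)
      (val_sub_le_of_adjoin_eq_top hK hx g ⟨π, hπ1⟩)
  rw [iG, addOrd, h1, log_exp, neg_neg]

end LowerNumbering

end ArtinSwan

end

theorem mainTheorem3 (K L : Type*) [Field K] [Field L] [Algebra K L]
    [Valued K ℤᵐ⁰] [Valued L ℤᵐ⁰]
    -- `K` is complete, `v_K` and `v_L` are normalized discrete valuations, `v_L` extends `v_K`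
    [CompleteSpace K]
    (hK : Function.Surjective (Valued.v : Valuation K ℤᵐ⁰))
    (hL : Function.Surjective (Valued.v : Valuation L ℤᵐ⁰))
    [Valuation.HasExtension (Valued.v : Valuation K ℤᵐ⁰) (Valued.v : Valuation L ℤᵐ⁰)]
    [FiniteDimensional K L] [IsGalois K L]
    [Algebra.IsSeparable (ArtinSwan.resField K) (ArtinSwan.resField L)] :
    -- the valuation ring of `L` is generated by one element, and `i_G` does not depend on it
    (∃ x : ArtinSwan.valRing L, Algebra.adjoin (ArtinSwan.valRing K) {x} = ⊤) ∧
    (∀ x y : ArtinSwan.valRing L, Algebra.adjoin (ArtinSwan.valRing K) {x} = ⊤ →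
      Algebra.adjoin (ArtinSwan.valRing K) {y} = ⊤ →
      ∀ g : L ≃ₐ[K] L, g ≠ 1 → ArtinSwan.iG x g = ArtinSwan.iG y g) ∧
    ∀ x : ArtinSwan.valRing L, Algebra.adjoin (ArtinSwan.valRing K) {x} = ⊤ →
      ArtinSwan.IsComplexCharacter (fun g : L ≃ₐ[K] L => (ArtinSwan.artin x g : ℂ)) ∧
      (∀ χ : (L ≃ₐ[K] L) → ℂ, ArtinSwan.IsComplexCharacter χ →
        ∃ n : ℕ, ArtinSwan.charPairing (fun g : L ≃ₐ[K] L => (ArtinSwan.artin x g : ℂ)) χ = n) ∧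
      ArtinSwan.IsComplexCharacter (ArtinSwan.swan (K := K) (L := L) x) := by
  classical
  refine ⟨ArtinSwan.exists_adjoin_valRing_eq_top hK hL,
    fun x y hx hy g _ => ArtinSwan.iG_eq_iG hK hx hy g, fun x hx => ?_⟩
  have h := ArtinSwan.isTotallyRamified_inertia (K := K) hK hL
  have := ArtinSwan.inertia_normal (L := L) hK
  have := Fintype.ofFinite (ArtinSwan.inertia K L)
  obtain ⟨π, hπ⟩ := h.exists_uniformizer
  refine ArtinSwan.isComplexCharacter_of_defectSum (ArtinSwan.inertia K L)
    (ArtinSwan.resDegree_mul_card_inertia hK) (i := ArtinSwan.iG x)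
    (fun c g _ => ArtinSwan.iG_conj hK hx c g) (fun g _ => ArtinSwan.iG_inv hK x g)
    (fun g hg => ArtinSwan.iG_eq_zero hK hx hg)
    (fun g hg => ArtinSwan.iG_eq_jump_add_one hK hL hx hπ hg)
    (fun V _ _ _ ρ => h.exists_defectSum_eq_card_mul hπ V ρ) ?_ ?_
  · rw [ArtinSwan.artin, if_pos rfl]
  · intro g hg
    rw [ArtinSwan.artin, if_neg hg]
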